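/- Oriented links (non-empty, up to isotopy) are given by plane diagrams up to planar isotopy and Reidemeister moves. Let $k\ge 1$. A $t_k$ move replaces, in a diagram of an oriented link $L$, two parallel strands with the same orientation by $k$ positive half twists of them; the resulting link is written $t_k(L)$. Links $L,L'$ are $t_k$ equivalent if one can go from $L$ to $L'$ by finitely many $t_k$ and $t_k^{-1}$ moves and isotopy. The level distance $|L,L'|^{\rm lev}_{t_k}$ of $t_k$ equivalent links is the number of $t_k$ moves minus the number of $t_k^{-1}$ moves used in going from $L$ to $L'$. Let $P_L(a,z)\in\mathbb Z[a^{\pm1},z^{\pm1}]$ be the Jones–Conway (Homfly) polynomial, i.e. the unique invariant of oriented links with $P_{T_1}(a,z)=1$ for the trivial knot $T_1$ and $$aP_{L_+}(a,z)+a^{-1}P_{L_-}(a,z)=zP_{L_0}(a,z)$$ whenever $L_+,L_-,L_0$ have diagrams that are identical except in one place, where they show a positive crossing, a negative crossing, and its oriented smoothing; it exists and is unique. (1) Let $k\ge 1$ and $m$ be integers and let $z_0=2\cos(\pi m/k)$ with $z_0\neq 0,\pm2$. Then for every $t_k$ move $L\mapsto t_k(L)$ $$P_{t_k(L)}(a,z_0)=(-1)^m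 a^{-k}P_L(a,z_0),$$ and for all $t_k$ equivalent links $L$ and $L'$ $$P_{L'}(a,z_0)=\bigl((-1)^m a^{-k}\bigr)^{|L,L'|^{\rm lev}_{t_k}}P_L(a,z_0),$$ where neither side is identically zero as a Laurent polynomial in $a$. (2) For $k>2$ the level distance is well defined: for $t_k$ equivalent links $L$ and $L'$, the number of $t_k$ moves minus the number of $t_k^{-1}$ moves is the same for every path from $L$ to $L'$. (The hypotheses on $z_0$ in (1) force $k>2$, so the exponent there is well defined by (2).) -/

import Mathlib

open LaurentPolynomial

namespace TkMoves

/-! ### Oriented link diagrams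

A plane link diagram in general position with respect to the height function is cut by horizontal
lines into slices, each of which contains exactly one minimum, maximum or crossing and otherwise
vertical strands.  The points where a horizontal line meets the diagram, read from left to right,
are recorded by the orientations of the strands: `true` is upward, `false` is downward. -/

/-- The non-trivial part of a slice.
* `cup a`: a local minimum; its left leg has orientation `a`, its right leg the opposite one.
* `cap a`: a local maximum; its left leg has orientation `a`, its right leg the opposite one.
* `cross isOver a b`: a crossing of the strand that runs from the bottom left to the top right
  and has orientation `a` with the strand that runs from the bottom right to the top left and has
  orientation `b`.  The former strand passes over the latter iff `isOver = true`.
  In particular `cross true true true` is the positive crossing of two upward strands and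
  `cross false true true` is the negative one. -/
inductive Piece : Type
  | cup (a : Bool) : Piece
  | cap (a : Bool) : Piece
  | cross (isOver a b : Bool) : Piece

/-- The orientations of the strands at the bottom of a piece. -/
def Piece.dom : Piece → List Bool
  | .cup _ => []
  | .cap a => [a, !a]
  | .cross _ a b => [a, b]

/-- The orientations of the strands at the top of a piece. -/
def Piece.cod : Piece → List Bool
  | .cup a => [a, !a]
  | .cap _ => []
  | .cross _ a b => [b, a]

/-- A slice: a piece with vertical strands `left` to the left and `right` to the right of it. -/
structure Slice : Type where
  left : List Bool
  piece : Piece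
  right : List Bool

/-- The strands at the bottom of a slice. -/
def Slice.dom (s : Slice) : List Bool := s.left ++ s.piece.dom ++ s.right

/-- The strands at the top of a slice. -/
def Slice.cod (s : Slice) : List Bool := s.left ++ s.piece.cod ++ s.right

/-- Add vertical strands `l` on the left and `r` on the right of a slice. -/
def Slice.pad (l r : List Bool) (s : Slice) : Slice := ⟨l ++ s.left, s.piece, s.right ++ r⟩

/-- `Joins w s t`: the slices in `w`, listed from bottom to top, fit together and form an
oriented tangle diagram with bottom boundary `s` and top boundary `t`. -/
def Joins : List Slice → List Bool → List Bool → Prop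
  | [], s, t => s = t
  | x :: w, s, t => x.dom = s ∧ Joins w x.cod t

/-- A diagram of an oriented link (with at least one component). -/
structure Diagram : Type where
  word : List Slice
  closed : Joins word [] []
  nonempty : word ≠ []

/-- The local moves between tangle diagrams that generate isotopy: isotopies of the plane
(the first five) and the three Reidemeister moves. -/
inductive LocalMove : List Slice → List Slice → Prop
  /-- Two pieces that lie side by side exchange their heights. -/
  | interchange (x y : Piece) (mid : List Bool) :
      LocalMove [⟨[], x, mid ++ y.dom⟩, ⟨x.cod ++ mid, y, []⟩]
        [⟨x.dom ++ mid, y, []⟩, ⟨[], x, mid ++ y.cod⟩]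
  /-- A minimum and a maximum on one strand cancel. -/
  | zigzag_left (a : Bool) : LocalMove [⟨[], .cup a, [a]⟩, ⟨[a], .cap (!a), []⟩] []
  | zigzag_right (a : Bool) : LocalMove [⟨[a], .cup (!a), []⟩, ⟨[], .cap a, [a]⟩] []
  /-- A strand that enters between the legs of a minimum, above or below the left leg, may
  enter above or below the right leg instead. -/
  | slide_cup (isOver s a : Bool) :
      LocalMove [⟨[s], .cup a, []⟩, ⟨[], .cross isOver s a, [!a]⟩]
        [⟨[], .cup a, [s]⟩, ⟨[a], .cross (!isOver) (!a) s, []⟩]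
  /-- The same for a maximum. -/
  | slide_cap (isOver s a : Bool) :
      LocalMove [⟨[], .cross isOver a s, [!a]⟩, ⟨[s], .cap a, []⟩]
        [⟨[a], .cross (!isOver) s (!a), []⟩, ⟨[], .cap a, [s]⟩]
  /-- First Reidemeister move, at a minimum and at a maximum. -/
  | reidemeister1_cup (isOver a : Bool) :
      LocalMove [⟨[], .cup a, []⟩, ⟨[], .cross isOver a (!a), []⟩] [⟨[], .cup (!a), []⟩]
  | reidemeister1_cap (isOver a : Bool) :
      LocalMove [⟨[], .cross isOver a (!a), []⟩, ⟨[], .cap (!a), []⟩] [⟨[], .cap a, []⟩]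
  /-- Second Reidemeister move. -/
  | reidemeister2 (isOver a b : Bool) :
      LocalMove [⟨[], .cross isOver a b, []⟩, ⟨[], .cross (!isOver) b a, []⟩] []
  /-- Third Reidemeister move. -/
  | reidemeister3 (isOver a b c : Bool) :
      LocalMove [⟨[], .cross isOver a b, [c]⟩, ⟨[b], .cross isOver a c, []⟩, ⟨[], .cross isOver b c, [a]⟩]
        [⟨[a], .cross isOver b c, []⟩, ⟨[], .cross isOver a c, [b]⟩, ⟨[c], .cross isOver a b, []⟩]

/-- `D'` arises from `D` by one local move somewhere in the diagram. -/
def Step (D D' : Diagram) : Prop :=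
  ∃ (u v x x' : List Slice) (l r : List Bool), LocalMove x x' ∧
    D.word = u ++ x.map (Slice.pad l r) ++ v ∧ D'.word = u ++ x'.map (Slice.pad l r) ++ v

/-- Isotopy of diagrams: the equivalence relation generated by the local moves. -/
def isotopy : Setoid Diagram := Relation.EqvGen.setoid Step

/-- Oriented links up to isotopy. -/
def Link : Type := Quotient isotopy

/-- The isotopy class of the link with diagram `D`. -/
def Diagram.link (D : Diagram) : Link := Quotient.mk isotopy D

/-- The trivial knot `T₁`, as a round circle. -/
def trivialKnotDiagram : Diagram where
  word := [⟨[], .cup true, []⟩, ⟨[], .cap true, []⟩]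
  closed := by simp [Joins, Slice.dom, Slice.cod, Piece.dom, Piece.cod]
  nonempty := by simp

/-- The trivial knot `T₁`. -/
def trivialKnot : Link := trivialKnotDiagram.link

/-! ### The Jones–Conway polynomial -/

/-- `(L₊, L₋, L₀)` is a Conway skein triple: the links have diagrams that are identical except in
one place, where they show a positive crossing, a negative crossing, and two parallel strands.
(Both strands are drawn upward; every crossing can be turned upward by an isotopy of the plane.) -/
def SkeinTriple (Lp Lm L0 : Link) : Prop :=
  ∃ (Dp Dm D0 : Diagram) (u v : List Slice) (l r : List Bool),
    Dp.link = Lp ∧ Dm.link = Lm ∧ D0.link = L0 ∧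
    Dp.word = u ++ [⟨l, .cross true true true, r⟩] ++ v ∧
    Dm.word = u ++ [⟨l, .cross false true true, r⟩] ++ v ∧
    D0.word = u ++ v

/-- Laurent polynomials in `a` and `z` with integer coefficients; the outer variable is `a`, the
inner one is `z`. -/
abbrev LaurentAZ : Type := LaurentPolynomial (LaurentPolynomial ℤ)

/-- The defining properties of the Jones–Conway (Homfly) polynomial `P_L(a, z)`:
`P_{T₁} = 1` and `a P_{L₊} + a⁻¹ P_{L₋} = z P_{L₀}`. -/
structure IsJonesConway (P : Link → LaurentAZ) : Prop where
  trivialKnot : P trivialKnot = 1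
  skein : ∀ Lp Lm L0 : Link, SkeinTriple Lp Lm L0 →
    T 1 * P Lp + T (-1) * P Lm = C (T 1) * P L0

/-- The variable `a`, as a unit of the ring `ℝ[a, a⁻¹]`. -/
noncomputable def aUnit : (LaurentPolynomial ℝ)ˣ where
  val := T 1
  inv := T (-1)
  val_inv := by rw [← T_add]; simp
  inv_val := by rw [← T_add]; simp

/-- The substitution `z = z₀`: it sends `p(a, z)` to `p(a, z₀)`, a real Laurent polynomial in `a`. -/
noncomputable def substZ (z₀ : ℝ) (h : z₀ ≠ 0) : LaurentAZ →+* LaurentPolynomial ℝ :=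
  LaurentPolynomial.eval₂
    ((C : ℝ →+* LaurentPolynomial ℝ).comp
      (LaurentPolynomial.eval₂ (Int.castRingHom ℝ) (Units.mk0 z₀ h)))
    aUnit

/-! ### `t_k` moves -/

/-- `L'` arises from `L` by a `t_k` move: `L` and `L'` have diagrams that are identical except in
one place, where `L` shows two parallel strands (with the same orientation) and `L'` shows `k`
positive half twists of them. -/
def TkMove (k : ℕ) (L L' : Link) : Prop :=
  ∃ (D D' : Diagram) (u v : List Slice) (l r : List Bool),
    D.link = L ∧ D'.link = L' ∧ D.word = u ++ v ∧
    D'.word = u ++ List.replicate k ⟨l, .cross true true true, r⟩ ++ v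

/-- The Laurent monomial `(-1)^m a^{-k}`, as a unit of the ring `ℝ[a, a⁻¹]`. -/
noncomputable def tkFactor (k : ℕ) (m : ℤ) : (LaurentPolynomial ℝ)ˣ :=
  (-1) ^ m * aUnit ^ (-(k : ℤ))

/-- `TkPath k L L' n`: one can go from `L` to `L'` by finitely many `t_k` and `t_k⁻¹` moves (and
isotopy), where `n` is the number of `t_k` moves minus the number of `t_k⁻¹` moves used. -/
inductive TkPath (k : ℕ) (L : Link) : Link → ℤ → Prop
  | refl : TkPath k L L 0
  | move {L' L'' : Link} {n : ℤ} : TkPath k L L' n → TkMove k L' L'' → TkPath k L L'' (n + 1)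
  | inverse {L' L'' : Link} {n : ℤ} : TkPath k L L' n → TkMove k L'' L' → TkPath k L L'' (n - 1)

/-- `t_k` equivalence of links. -/
def TkEquivalent (k : ℕ) (L L' : Link) : Prop := ∃ n : ℤ, TkPath k L L' n

open Classical in
/-- The `t_k` level distance of `t_k` equivalent links: the number of `t_k` moves minus the number
of `t_k⁻¹` moves along some chosen path from `L` to `L'` (and `0` if there is no path).  That the
choice does not matter for `k > 2` is part of the theorem. -/
noncomputable def levelDistance (k : ℕ) (L L' : Link) : ℤ :=
  if h : TkEquivalent k L L' then h.choose else 0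

end TkMoves

open TkMoves

/-! The effect of a `t_k` move is a linear recursion. Let `E n` be the link with `n` positive half
twists at the chosen place. The skein relation for `E (n + 2)`, `E n`, `E (n + 1)` says that `q n =
a ^ n * P (E n)` satisfies `q (n + 2) = z * q (n + 1) - q n`. At `z = 2 cos θ` this gives `sin θ * q
n = sin (n θ) * q 1 - sin (n θ - θ) * q 0`, and for `k θ = m π` with `sin θ ≠ 0` it reduces to `q k
= (-1) ^ m * q 0` (`IsJonesConway.tkMove`). The polynomial stays non-zero at `z₀ = 2 cos θ`, because
at `a = exp (i θ)` one has `z₀ = a + a⁻¹`, where the constant invariant `1` satisfies the skein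
relation (`IsJonesConway.substZ_ne_zero`). For `k > 2` the choice `m = 1` is admissible, and since
the powers of `(-1) ^ m * a ^ (-k)` are distinct, the exponent is determined by the two polynomials
(`TkPath.unique`).

All this rests on the existence and uniqueness of `P`, which take up most of the proof. Uniqueness
comes from a spanning theorem, `exists_smul_trivialKnot`: every skein invariant with values in any
module is, link by link, a scalar multiple of its value on the trivial knot. Diagrams are built
piece by piece from below. The tangles met on the way are combinations of nested arcs followed by a
positive braid, possibly with one separate circle, whose ends are then brought into the required
order with all upward strands above all downward ones. Closure under maxima uses the reduction of
Hecke algebra words to at most one highest generator (`hecke_mem_heckeSpan`).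

Existence combines this theorem with vertex models. For each number of labels and each `q` there is
a numerical state sum satisfying the skein relation at `a = i q ^ n`, `z = i (q - q⁻¹)`
(`quantumModel`, `StateModel.linkSum_skein`). Applied to the family of all of these at once, the
spanning theorem produces a Laurent polynomial that interpolates them; enough pairs `(a, z)` occur
for every required identity to be checked on them (`exists_isJonesConway`). -/

namespace TkMoves

/-! ### Positional words -/

/-- A piece together with the number of strands to the left of it. -/
abbrev PosPiece : Type := ℕ × Piece

/-- The position and the piece of a slice. -/
def Slice.pos (x : Slice) : PosPiece := (x.left.length, x.piece)

/-- The positional word `w` can be drawn on top of the strands `s` and ends in the strands `t`. -/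
def Runs : List Bool → List PosPiece → List Bool → Prop
  | s, [], t => s = t
  | s, x :: w, t => ∃ l r : List Bool, l.length = x.1 ∧ s = l ++ x.2.dom ++ r ∧
      Runs (l ++ x.2.cod ++ r) w t

theorem runs_append (u v : List PosPiece) (s t : List Bool) :
    Runs s (u ++ v) t ↔ ∃ m, Runs s u m ∧ Runs m v t := by
  induction u generalizing s with
  | nil => simp [Runs]
  | cons x u ih =>
    simp only [List.cons_append, Runs, ih]
    constructor
    · rintro ⟨l, r, h1, h2, m, h3, h4⟩
      exact ⟨m, ⟨l, r, h1, h2, h3⟩, h4⟩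
    · rintro ⟨m, ⟨l, r, h1, h2, h3⟩, h4⟩
      exact ⟨l, r, h1, h2, m, h3, h4⟩

theorem joins_append (u v : List Slice) (s t : List Bool) :
    Joins (u ++ v) s t ↔ ∃ m, Joins u s m ∧ Joins v m t := by
  induction u generalizing s with
  | nil => simp [Joins]
  | cons x u ih => simp [Joins, ih, and_assoc]

theorem Joins.runs {W : List Slice} {s t : List Bool} (h : Joins W s t) :
    Runs s (W.map Slice.pos) t := by
  induction W generalizing s with
  | nil => simpa [Joins, Runs] using h
  | cons x W ih =>
    obtain ⟨rfl, h⟩ := h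
    exact ⟨x.left, x.right, rfl, rfl, ih h⟩

theorem Runs.joins {w : List PosPiece} {s t : List Bool} (h : Runs s w t) :
    ∃ W : List Slice, W.map Slice.pos = w ∧ Joins W s t := by
  induction w generalizing s with
  | nil => exact ⟨[], rfl, h⟩
  | cons x w ih =>
    obtain ⟨l, r, h1, h2, h3⟩ := h
    obtain ⟨W, hW, hj⟩ := ih h3
    refine ⟨⟨l, x.2, r⟩ :: W, ?_, h2.symm, hj⟩
    simp [hW, Slice.pos, h1]

/-- Read upwards from known bottom strands, the position of a piece fixes the strands on both sides
of it. Hence passing to positional words loses nothing about a closed diagram. -/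
theorem Joins.eq_of_pos {W W' : List Slice} {s t t' : List Bool} (h : Joins W s t)
    (h' : Joins W' s t') (e : W.map Slice.pos = W'.map Slice.pos) : W = W' ∧ t = t' := by
  induction W generalizing s W' with
  | nil =>
    obtain rfl : W' = [] := by simpa using e.symm
    exact ⟨rfl, Eq.trans (Eq.symm h) h'⟩
  | cons x W ih =>
    cases W' with
    | nil => simp at e
    | cons y W' =>
      simp only [List.map_cons, List.cons.injEq, Slice.pos, Prod.mk.injEq] at e
      obtain ⟨⟨e1, e2⟩, e3⟩ := e
      obtain ⟨hx, h⟩ := h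
      obtain ⟨hy, h'⟩ := h'
      have hxy : x = y := by
        obtain ⟨xl, xp, xr⟩ := x
        obtain ⟨yl, yp, yr⟩ := y
        simp only at e1 e2
        subst e2
        simp only [Slice.dom, List.append_assoc] at hx hy
        obtain ⟨rfl, h2⟩ := List.append_inj (hx.trans hy.symm) e1
        rw [List.append_cancel_left h2]
      subst hxy
      obtain ⟨rfl, rfl⟩ := ih h h' e3
      exact ⟨rfl, rfl⟩

theorem Runs.unique {w : List PosPiece} {s t t' : List Bool} (h : Runs s w t)
    (h' : Runs s w t') : t = t' := by
  obtain ⟨W, rfl, hW⟩ := h.joins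
  obtain ⟨W', e, hW'⟩ := h'.joins
  exact (hW.eq_of_pos hW' e.symm).2

theorem Joins.pad {W : List Slice} {s t : List Bool} (h : Joins W s t) (l r : List Bool) :
    Joins (W.map (Slice.pad l r)) (l ++ s ++ r) (l ++ t ++ r) := by
  induction W generalizing s with
  | nil => cases h; rfl
  | cons x W ih =>
    obtain ⟨rfl, h⟩ := h
    refine ⟨by simp [Slice.pad, Slice.dom], ?_⟩
    have := ih h
    simpa [Slice.pad, Slice.cod] using this

/-- One local move, with vertical strands added on both sides. -/
def PadMove (W W' : List Slice) : Prop :=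
  ∃ (x x' : List Slice) (l r : List Bool), LocalMove x x' ∧
    W = x.map (Slice.pad l r) ∧ W' = x'.map (Slice.pad l r)

/-- On top of the strands `s`, the positional words `p` and `p'` are related by a local move. -/
def MoveAt (s : List Bool) (p p' : List PosPiece) : Prop :=
  ∃ (W W' : List Slice) (t : List Bool), PadMove W W' ∧ W.map Slice.pos = p ∧
    W'.map Slice.pos = p' ∧ Joins W s t ∧ Joins W' s t

/-- The positional words `p` and `p'` are related by a local move wherever one of them fits. -/
def FreeMove (p p' : List PosPiece) : Prop :=
  ∀ s t : List Bool, Runs s p t ∨ Runs s p' t → MoveAt s p p'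

/-! ### Evaluation of positional words -/

section Eval

variable {M : Type*} [AddCommGroup M]

open Classical in
/-- The value of a link invariant on the link drawn by a positional word, or `0` if there is no
such link. -/
noncomputable def evalWord (f : Link → M) (w : List PosPiece) : M :=
  if h : ∃ D : Diagram, D.word.map Slice.pos = w then f h.choose.link else 0

theorem Diagram.ext_pos {D D' : Diagram} (h : D.word.map Slice.pos = D'.word.map Slice.pos) :
    D = D' := by
  obtain ⟨W, hW, hn⟩ := D
  obtain ⟨W', hW', hn'⟩ := D'
  obtain ⟨rfl, -⟩ := hW.eq_of_pos hW' h
  rfl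

theorem evalWord_diagram (f : Link → M) (D : Diagram) :
    evalWord f (D.word.map Slice.pos) = f D.link := by
  have h : ∃ D' : Diagram, D'.word.map Slice.pos = D.word.map Slice.pos := ⟨D, rfl⟩
  rw [evalWord, dif_pos h, Diagram.ext_pos h.choose_spec]

theorem evalWord_nil (f : Link → M) : evalWord f [] = 0 := by
  rw [evalWord, dif_neg]
  rintro ⟨D, hD⟩
  exact D.nonempty (by simpa using hD)

theorem evalWord_eq_zero (f : Link → M) {w : List PosPiece} (h : ¬ Runs [] w []) :
    evalWord f w = 0 := by
  rw [evalWord, dif_neg]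
  rintro ⟨D, rfl⟩
  exact h D.closed.runs

theorem LocalMove.left_ne_nil {x x' : List Slice} (h : LocalMove x x') : x ≠ [] := by
  cases h <;> simp

theorem evalWord_move (f : Link → M) {u : List PosPiece} {s : List Bool} (hu : Runs [] u s)
    {p p' : List PosPiece} (h : MoveAt s p p') (v : List PosPiece) :
    evalWord f (u ++ p ++ v) = evalWord f (u ++ p' ++ v) := by
  obtain ⟨W, W', t, hm, rfl, rfl, hW, hW'⟩ := h
  by_cases hv : Runs t v []
  · obtain ⟨U, rfl, hU⟩ := hu.joins
    obtain ⟨V, rfl, hV⟩ := hv.joins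
    have h1 : Joins (U ++ W ++ V) [] [] := by
      rw [joins_append]; exact ⟨t, (joins_append ..).2 ⟨s, hU, hW⟩, hV⟩
    have h2 : Joins (U ++ W' ++ V) [] [] := by
      rw [joins_append]; exact ⟨t, (joins_append ..).2 ⟨s, hU, hW'⟩, hV⟩
    obtain ⟨x, x', l, r, hx, rfl, rfl⟩ := hm
    have hx0 := hx.left_ne_nil
    have n1 : U ++ x.map (Slice.pad l r) ++ V ≠ [] := by simp [hx0]
    -- The empty word is not a diagram. A move whose right side is empty needs a strand below it, so
    -- it cannot turn a diagram into the empty word.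
    have n2 : U ++ x'.map (Slice.pad l r) ++ V ≠ [] := by
      intro h0
      simp only [List.append_eq_nil_iff, List.map_eq_nil_iff] at h0
      obtain ⟨⟨rfl, rfl⟩, rfl⟩ := h0
      obtain rfl : [] = s := hU
      obtain rfl : [] = t := hW'
      cases hx <;> simp [Joins, Slice.pad, Slice.dom, Piece.dom] at hW
    have e := evalWord_diagram f ⟨_, h1, n1⟩
    have e' := evalWord_diagram f ⟨_, h2, n2⟩
    simp only [List.map_append] at e e' ⊢
    rw [e, e']
    congr 1
    exact Quotient.sound (Relation.EqvGen.rel _ _ ⟨U, V, x, x', l, r, hx, rfl, rfl⟩)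
  · rw [evalWord_eq_zero, evalWord_eq_zero]
    · rw [runs_append]
      rintro ⟨m, h1, h2⟩
      obtain ⟨m', h3, h4⟩ := (runs_append ..).1 h1
      obtain rfl := hu.unique h3
      obtain rfl := hW'.runs.unique h4
      exact hv h2
    · rw [runs_append]
      rintro ⟨m, h1, h2⟩
      obtain ⟨m', h3, h4⟩ := (runs_append ..).1 h1
      obtain rfl := hu.unique h3
      obtain rfl := hW.runs.unique h4
      exact hv h2

/-- No condition on `u` and `v` is needed: if `p` and `p'` do not fit on top of `u`, both words take
the default value `0`. -/
theorem evalWord_freeMove (f : Link → M) {p p' : List PosPiece} (h : FreeMove p p')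
    (u v : List PosPiece) : evalWord f (u ++ p ++ v) = evalWord f (u ++ p' ++ v) := by
  by_cases hs : ∃ s t, Runs [] u s ∧ (Runs s p t ∨ Runs s p' t)
  · obtain ⟨s, t, hu, hp⟩ := hs
    exact evalWord_move f hu (h s t hp) v
  · push Not at hs
    rw [evalWord_eq_zero, evalWord_eq_zero]
    · rw [runs_append]
      rintro ⟨m, h1, h2⟩
      obtain ⟨m', h3, h4⟩ := (runs_append ..).1 h1
      exact (hs _ _ h3).2 h4
    · rw [runs_append]
      rintro ⟨m, h1, h2⟩
      obtain ⟨m', h3, h4⟩ := (runs_append ..).1 h1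
      exact (hs _ _ h3).1 h4

end Eval

/-! ### The free moves -/

theorem MoveAt.of_localMove {x x' : List Slice} (h : LocalMove x x') {d c : List Bool}
    (hx : Joins x d c) (hx' : Joins x' d c) (l r : List Bool) :
    MoveAt (l ++ d ++ r) ((x.map (Slice.pad l r)).map Slice.pos)
      ((x'.map (Slice.pad l r)).map Slice.pos) :=
  ⟨_, _, _, ⟨x, x', l, r, h, rfl, rfl⟩, rfl, rfl, hx.pad l r, hx'.pad l r⟩

theorem exists_append_of_append_eq {α : Type*} {l m a b : List α} (h : l ++ a = m ++ b) (k : ℕ)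
    (hk : m.length = l.length + k) : ∃ c, c.length = k ∧ m = l ++ c ∧ a = c ++ b := by
  rcases List.append_eq_append_iff.1 h with ⟨c, h1, h2⟩ | ⟨c, h1, h2⟩
  · refine ⟨c, ?_, h1, h2⟩
    simp [h1] at hk; omega
  · have : c = [] := by
      rw [← List.length_eq_zero_iff]; simp [h1] at hk; omega
    subst this
    refine ⟨[], ?_, by simpa using h1.symm, by simpa using h2.symm⟩
    simp [h1] at hk; simp [← hk]

/-- Interchanges, slides and the first and third Reidemeister moves are free: on either side the
pieces themselves fix the orientations of all strands involved. The zigzags and the second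
Reidemeister move are not, since their empty side fits on any strands; they enter only through
`Typed`. Here `j'` is the position of `y` before `x` changes the number of strands. -/
theorem freeMove_interchange (x y : Piece) {i j j' : ℕ} (h : i + x.cod.length ≤ j)
    (h' : j' + x.cod.length = j + x.dom.length) :
    FreeMove [(i, x), (j, y)] [(j', y), (i, x)] := by
  have key : ∀ l mid r : List Bool, l.length = i → i + x.cod.length + mid.length = j →
      MoveAt (l ++ x.dom ++ mid ++ y.dom ++ r) [(i, x), (j, y)] [(j', y), (i, x)] := by
    intro l mid r hl hj
    have := MoveAt.of_localMove (LocalMove.interchange x y mid)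
      (d := x.dom ++ mid ++ y.dom) (c := x.cod ++ mid ++ y.cod)
      (by simp [Joins, Slice.dom, Slice.cod]) (by simp [Joins, Slice.dom, Slice.cod]) l r
    simp only [List.map_cons, List.map_nil, Slice.pad, Slice.pos, List.append_nil,
      List.length_append, hl] at this
    convert this using 1
    · simp
    · rw [show j = i + (x.cod.length + mid.length) by omega]
    · rw [show j' = i + (x.dom.length + mid.length) by omega]
  rintro s t (⟨l, r, hl, rfl, l', r', hl', e, -⟩ | ⟨l', r', hl', rfl, l, r, hl, e, -⟩)
  · simp only at hl hl' e
    obtain ⟨c, hc, rfl, hr⟩ := exists_append_of_append_eq (l := l ++ x.cod) (m := l') (a := r)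
      (b := y.dom ++ r') (by simpa using e) (j - (i + x.cod.length))
      (by simp [hl, hl']; omega)
    subst hr
    have := key l c r' hl (by omega)
    simpa using this
  · simp only at hl hl' e
    obtain ⟨c, hc, hd, hr⟩ := exists_append_of_append_eq (l := l) (m := l')
      (a := x.dom ++ r) (b := y.cod ++ r') (by simpa using e.symm) (j' - i)
      (by omega)
    obtain ⟨c', hc', rfl, hr'⟩ := exists_append_of_append_eq (l := x.dom) (m := c)
      (a := r) (b := y.cod ++ r') hr (j' - i - x.dom.length) (by omega)
    subst hd
    have := key l c' r' hl (by omega)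
    simpa using this
theorem freeMove_slide_cup (o s a : Bool) (i : ℕ) :
    FreeMove [(i + 1, .cup a), (i, .cross o s a)] [(i, .cup a), (i + 1, .cross (!o) (!a) s)] := by
  have key : ∀ l r : List Bool, l.length = i → MoveAt (l ++ [s] ++ r)
      [(i + 1, .cup a), (i, .cross o s a)] [(i, .cup a), (i + 1, .cross (!o) (!a) s)] := by
    intro l r hl
    have := MoveAt.of_localMove (LocalMove.slide_cup o s a) (d := [s]) (c := [a, s, !a])
      (by simp [Joins, Slice.dom, Slice.cod, Piece.dom, Piece.cod])
      (by simp [Joins, Slice.dom, Slice.cod, Piece.dom, Piece.cod]) l r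
    simpa [Slice.pad, Slice.pos, hl] using this
  rintro t t' (⟨l, r, hl, rfl, l', r', hl', e, -⟩ | ⟨l, r, hl, rfl, l', r', hl', e, -⟩)
  · simp only [Piece.dom, Piece.cod, List.append_assoc] at hl hl' e
    obtain ⟨c, hc, rfl, hr⟩ := exists_append_of_append_eq e.symm 1 (by omega)
    obtain ⟨c0, rfl⟩ := List.length_eq_one_iff.1 hc
    simp at hr
    obtain ⟨rfl, -⟩ := hr
    simpa [Piece.dom] using key l' r hl'
  · simp only [Piece.dom, Piece.cod, List.append_assoc] at hl hl' e
    obtain ⟨c, hc, rfl, hr⟩ := exists_append_of_append_eq e 1 (by omega)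
    obtain ⟨c0, rfl⟩ := List.length_eq_one_iff.1 hc
    simp at hr
    obtain ⟨-, rfl⟩ := hr
    simpa [Piece.dom] using key l r' hl

theorem freeMove_slide_cap (o s a : Bool) (i : ℕ) :
    FreeMove [(i, .cross o a s), (i + 1, .cap a)] [(i + 1, .cross (!o) s (!a)), (i, .cap a)] := by
  have key : ∀ l r : List Bool, l.length = i → MoveAt (l ++ [a, s, !a] ++ r)
      [(i, .cross o a s), (i + 1, .cap a)] [(i + 1, .cross (!o) s (!a)), (i, .cap a)] := by
    intro l r hl
    have := MoveAt.of_localMove (LocalMove.slide_cap o s a) (d := [a, s, !a]) (c := [s])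
      (by simp [Joins, Slice.dom, Slice.cod, Piece.dom, Piece.cod])
      (by simp [Joins, Slice.dom, Slice.cod, Piece.dom, Piece.cod]) l r
    simpa [Slice.pad, Slice.pos, hl] using this
  rintro t t' (⟨l, r, hl, rfl, l', r', hl', e, -⟩ | ⟨l, r, hl, rfl, l', r', hl', e, -⟩)
  · simp only [Piece.dom, Piece.cod, List.append_assoc] at hl hl' e
    obtain ⟨c, hc, rfl, hr⟩ := exists_append_of_append_eq e 1 (by omega)
    obtain ⟨c0, rfl⟩ := List.length_eq_one_iff.1 hc
    simp at hr
    obtain ⟨-, rfl⟩ := hr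
    simpa [Piece.dom] using key l r' hl
  · simp only [Piece.dom, Piece.cod, List.append_assoc] at hl hl' e
    obtain ⟨c, hc, rfl, hr⟩ := exists_append_of_append_eq e.symm 1 (by omega)
    obtain ⟨c0, rfl⟩ := List.length_eq_one_iff.1 hc
    simp at hr
    obtain ⟨rfl, -⟩ := hr
    simpa [Piece.dom] using key l' r hl'

theorem freeMove_reidemeister1_cup (o a : Bool) (i : ℕ) :
    FreeMove [(i, .cup a), (i, .cross o a (!a))] [(i, .cup (!a))] := by
  have key : ∀ l r : List Bool, l.length = i → MoveAt (l ++ [] ++ r)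
      [(i, .cup a), (i, .cross o a (!a))] [(i, .cup (!a))] := by
    intro l r hl
    have := MoveAt.of_localMove (LocalMove.reidemeister1_cup o a) (d := []) (c := [!a, a])
      (by simp [Joins, Slice.dom, Slice.cod, Piece.dom, Piece.cod])
      (by simp [Joins, Slice.dom, Slice.cod, Piece.dom, Piece.cod]) l r
    simpa [Slice.pad, Slice.pos, hl] using this
  rintro t t' (⟨l, r, hl, rfl, -⟩ | ⟨l, r, hl, rfl, -⟩) <;>
    exact key l r hl

theorem freeMove_reidemeister1_cap (o a : Bool) (i : ℕ) :
    FreeMove [(i, .cross o a (!a)), (i, .cap (!a))] [(i, .cap a)] := by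
  have key : ∀ l r : List Bool, l.length = i → MoveAt (l ++ [a, !a] ++ r)
      [(i, .cross o a (!a)), (i, .cap (!a))] [(i, .cap a)] := by
    intro l r hl
    have := MoveAt.of_localMove (LocalMove.reidemeister1_cap o a) (d := [a, !a]) (c := [])
      (by simp [Joins, Slice.dom, Slice.cod, Piece.dom, Piece.cod])
      (by simp [Joins, Slice.dom, Slice.cod, Piece.dom, Piece.cod]) l r
    simpa [Slice.pad, Slice.pos, hl] using this
  rintro t t' (⟨l, r, hl, rfl, -⟩ | ⟨l, r, hl, rfl, -⟩) <;>
    exact key l r hl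

theorem freeMove_reidemeister3 (o a b c : Bool) (i : ℕ) :
    FreeMove [(i, .cross o a b), (i + 1, .cross o a c), (i, .cross o b c)]
      [(i + 1, .cross o b c), (i, .cross o a c), (i + 1, .cross o a b)] := by
  have key : ∀ l r : List Bool, l.length = i → MoveAt (l ++ [a, b, c] ++ r)
      [(i, .cross o a b), (i + 1, .cross o a c), (i, .cross o b c)]
      [(i + 1, .cross o b c), (i, .cross o a c), (i + 1, .cross o a b)] := by
    intro l r hl
    have := MoveAt.of_localMove (LocalMove.reidemeister3 o a b c) (d := [a, b, c])
      (c := [c, b, a])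
      (by simp [Joins, Slice.dom, Slice.cod, Piece.dom, Piece.cod])
      (by simp [Joins, Slice.dom, Slice.cod, Piece.dom, Piece.cod]) l r
    simpa [Slice.pad, Slice.pos, hl] using this
  rintro t t' (⟨l, r, hl, rfl, l', r', hl', e, -⟩ | ⟨l, r, hl, rfl, l', r', hl', e, -⟩)
  · simp only [Piece.dom, Piece.cod, List.append_assoc] at hl hl' e
    obtain ⟨d, hd, rfl, hr⟩ := exists_append_of_append_eq e 1 (by omega)
    obtain ⟨d0, rfl⟩ := List.length_eq_one_iff.1 hd
    simp at hr
    obtain ⟨-, rfl⟩ := hr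
    simpa [Piece.dom] using key l r' hl
  · simp only [Piece.dom, Piece.cod, List.append_assoc] at hl hl' e
    obtain ⟨d, hd, rfl, hr⟩ := exists_append_of_append_eq e.symm 1 (by omega)
    obtain ⟨d0, rfl⟩ := List.length_eq_one_iff.1 hd
    simp at hr
    obtain ⟨rfl, -⟩ := hr
    simpa [Piece.dom] using key l' r hl'

/-! ### Functionals on positional words -/

section Functionals

variable (R M : Type*) [CommRing R] [AddCommGroup M] [Module R M]

/-- The functionals on positional words that are invariant under the free moves. -/
def functionals : Submodule R (List PosPiece → M) where
  carrier := {φ | ∀ p p', FreeMove p p' → ∀ u v, φ (u ++ p ++ v) = φ (u ++ p' ++ v)}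
  add_mem' := fun hφ hψ p p' h u v => by simp [-List.append_assoc, hφ p p' h u v, hψ p p' h u v]
  zero_mem' := fun _ _ _ _ _ => rfl
  smul_mem' := fun c φ hφ p p' h u v => by simp [-List.append_assoc, hφ p p' h u v]

/-- The module of functionals on positional words that are invariant under the free moves. -/
def Functional : Type _ := functionals R M

instance : AddCommGroup (Functional R M) := inferInstanceAs (AddCommGroup (functionals R M))

instance : Module R (Functional R M) := inferInstanceAs (Module R (functionals R M))

variable {R M}

/-- The value of a functional at a positional word. -/
def valueAt (w : List PosPiece) : Functional R M →ₗ[R] M where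
  toFun φ := φ.1 w
  map_add' _ _ := rfl
  map_smul' _ _ := rfl

/-- Draw a piece first: the functional `w ↦ φ (x w)`. -/
def draw (i : ℕ) (p : Piece) : Functional R M →ₗ[R] Functional R M where
  toFun φ := ⟨fun v => φ.1 ((i, p) :: v), fun q q' h u v => φ.2 q q' h ((i, p) :: u) v⟩
  map_add' _ _ := rfl
  map_smul' _ _ := rfl

/-- A functional stands for the tangle drawn so far, waiting for the rest of the word. In `draw j q
(draw i p φ)` the piece `p` therefore lies below `q`. -/
theorem draw_free2 {i j k l : ℕ} {p q r s : Piece}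
    (h : FreeMove [(i, p), (j, q)] [(k, r), (l, s)])
    (φ : Functional R M) : draw j q (draw i p φ) = draw l s (draw k r φ) :=
  Subtype.ext (funext fun v => φ.2 _ _ h [] v)

theorem draw_comm (x y : Piece) {i j j' : ℕ} (h : i + x.cod.length ≤ j)
    (h' : j' + x.cod.length = j + x.dom.length) (φ : Functional R M) :
    draw j y (draw i x φ) = draw i x (draw j' y φ) :=
  draw_free2 (freeMove_interchange x y h h') φ

theorem slide_cup (o s a : Bool) (i : ℕ) (φ : Functional R M) :
    draw i (.cross o s a) (draw (i + 1) (.cup a) φ) =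
      draw (i + 1) (.cross (!o) (!a) s) (draw i (.cup a) φ) :=
  draw_free2 (freeMove_slide_cup o s a i) φ

theorem slide_cap (o s a : Bool) (i : ℕ) (φ : Functional R M) :
    draw (i + 1) (.cap a) (draw i (.cross o a s) φ) =
      draw i (.cap a) (draw (i + 1) (.cross (!o) s (!a)) φ) :=
  draw_free2 (freeMove_slide_cap o s a i) φ

theorem twist_cup (o a : Bool) (i : ℕ) (φ : Functional R M) :
    draw i (.cross o a (!a)) (draw i (.cup a) φ) = draw i (.cup (!a)) φ :=
  Subtype.ext (funext fun v => φ.2 _ _ (freeMove_reidemeister1_cup o a i) [] v)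

theorem twist_cap (o a : Bool) (i : ℕ) (φ : Functional R M) :
    draw i (.cap (!a)) (draw i (.cross o a (!a)) φ) = draw i (.cap a) φ :=
  Subtype.ext (funext fun v => φ.2 _ _ (freeMove_reidemeister1_cap o a i) [] v)

theorem braid (o a b c : Bool) (i : ℕ) (φ : Functional R M) :
    draw i (.cross o b c) (draw (i + 1) (.cross o a c) (draw i (.cross o a b) φ)) =
      draw (i + 1) (.cross o a b) (draw i (.cross o a c) (draw (i + 1) (.cross o b c) φ)) :=
  Subtype.ext (funext fun v => φ.2 _ _ (freeMove_reidemeister3 o a b c i) [] v)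

/-- The functionals on positional words with bottom strands `t`: they are invariant under all
local moves and satisfy the skein relation. -/
def Typed (a z : Rˣ) (t : List Bool) : Submodule R (Functional R M) where
  carrier := {φ | ∀ u s, Runs t u s → ∀ v,
    (∀ p p', MoveAt s p p' → valueAt (u ++ p ++ v) φ = valueAt (u ++ p' ++ v) φ) ∧
    ∀ l r, s = l ++ [true, true] ++ r →
      (a : R) • valueAt (u ++ (l.length, .cross true true true) :: v) φ +
        ((a⁻¹ : Rˣ) : R) • valueAt (u ++ (l.length, .cross false true true) :: v) φ =
        (z : R) • valueAt (u ++ v) φ}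
  add_mem' := by
    intro φ ψ hφ hψ u s hu v
    refine ⟨fun p p' h => ?_, fun l r h => ?_⟩
    · rw [map_add, map_add, (hφ u s hu v).1 p p' h, (hψ u s hu v).1 p p' h]
    · rw [map_add, map_add, map_add, smul_add, smul_add, smul_add, ← (hφ u s hu v).2 l r h,
        ← (hψ u s hu v).2 l r h]
      abel
  zero_mem' := fun u s hu v => ⟨fun p p' h => by simp, fun l r h => by simp⟩
  smul_mem' := by
    intro c φ hφ u s hu v
    refine ⟨fun p p' h => ?_, fun l r h => ?_⟩
    · rw [map_smul, map_smul, (hφ u s hu v).1 p p' h]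
    · rw [map_smul, map_smul, map_smul, smul_comm (a : R), smul_comm ((a⁻¹ : Rˣ) : R),
        smul_comm (z : R), ← (hφ u s hu v).2 l r h, smul_add]

theorem draw_mem_typed {a z : Rˣ} {t : List Bool} {φ : Functional R M} (h : φ ∈ Typed a z t)
    {i : ℕ} {p : Piece}
    (l r : List Bool) (hl : l.length = i) (ht : t = l ++ p.dom ++ r) :
    draw i p φ ∈ Typed a z (l ++ p.cod ++ r) := by
  intro u s hu v
  exact h ((i, p) :: u) s ⟨l, r, hl, ht, hu⟩ v

/-- The moves with an empty side become cancellation rules, for which the bottom strands `t` must be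
known. -/
theorem draw_draw_of_moveAt {a z : Rˣ} {t : List Bool} {φ : Functional R M}
    (h : φ ∈ Typed a z t) {i j : ℕ} {p q : Piece}
    (hm : MoveAt t [(i, p), (j, q)] []) : draw j q (draw i p φ) = φ :=
  Subtype.ext (funext fun v => (h [] t rfl v).1 _ _ hm)

theorem cancel_cross {α z : Rˣ} {φ : Functional R M} (o a b : Bool) {l r : List Bool}
    (h : φ ∈ Typed α z (l ++ [a, b] ++ r)) {i : ℕ} (hl : l.length = i) :
    draw i (.cross (!o) b a) (draw i (.cross o a b) φ) = φ := by
  apply draw_draw_of_moveAt h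
  have := MoveAt.of_localMove (LocalMove.reidemeister2 o a b) (d := [a, b]) (c := [a, b])
    (by simp [Joins, Slice.dom, Slice.cod, Piece.dom, Piece.cod])
    (by simp [Joins]) l r
  simpa [Slice.pad, Slice.pos, hl] using this

theorem zigzag_left {α z : Rˣ} {φ : Functional R M} (a : Bool) {l r : List Bool}
    (h : φ ∈ Typed α z (l ++ [a] ++ r)) {i : ℕ} (hl : l.length = i) :
    draw (i + 1) (.cap (!a)) (draw i (.cup a) φ) = φ := by
  apply draw_draw_of_moveAt h
  have := MoveAt.of_localMove (LocalMove.zigzag_left a) (d := [a]) (c := [a])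
    (by simp [Joins, Slice.dom, Slice.cod, Piece.dom, Piece.cod])
    (by simp [Joins]) l r
  simpa [Slice.pad, Slice.pos, hl] using this

theorem zigzag_right {α z : Rˣ} {φ : Functional R M} (a : Bool) {l r : List Bool}
    (h : φ ∈ Typed α z (l ++ [a] ++ r)) {i : ℕ} (hl : l.length = i) :
    draw i (.cap a) (draw (i + 1) (.cup (!a)) φ) = φ := by
  apply draw_draw_of_moveAt h
  have := MoveAt.of_localMove (LocalMove.zigzag_right a) (d := [a]) (c := [a])
    (by simp [Joins, Slice.dom, Slice.cod, Piece.dom, Piece.cod])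
    (by simp [Joins]) l r
  simpa [Slice.pad, Slice.pos, hl] using this

theorem skein_typed {a z : Rˣ} {φ : Functional R M} {l r : List Bool}
    (h : φ ∈ Typed a z (l ++ [true, true] ++ r)) {i : ℕ} (hl : l.length = i) :
    (a : R) • draw i (.cross true true true) φ +
      ((a⁻¹ : Rˣ) : R) • draw i (.cross false true true) φ = (z : R) • φ := by
  subst hl
  exact Subtype.ext (funext fun v => (h [] _ rfl v).2 l r rfl)

/-- The link invariant `f` as a functional on positional words. -/
noncomputable def start (R : Type*) [CommRing R] [Module R M] (f : Link → M) : Functional R M :=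
  ⟨evalWord f, fun _ _ h u v => evalWord_freeMove f h u v⟩

theorem start_typed {a z : Rˣ} {f : Link → M}
    (hf : ∀ Lp Lm L0 : Link, SkeinTriple Lp Lm L0 →
      (a : R) • f Lp + ((a⁻¹ : Rˣ) : R) • f Lm = (z : R) • f L0) :
    start R f ∈ Typed a z [] := by
  intro u s hu v
  refine ⟨fun p p' h => evalWord_move f hu h v, ?_⟩
  rintro l r rfl
  change (a : R) • evalWord f _ + ((a⁻¹ : Rˣ) : R) • evalWord f _ =
    (z : R) • evalWord f _
  obtain ⟨U, rfl, hU⟩ := hu.joins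
  have hc : ∀ o, Joins [⟨l, .cross o true true, r⟩] (l ++ [true, true] ++ r)
      (l ++ [true, true] ++ r) := fun o => ⟨rfl, rfl⟩
  by_cases hv : Runs (l ++ [true, true] ++ r) v []
  · obtain ⟨V, rfl, hV⟩ := hv.joins
    have n0 : U ++ V ≠ [] := by
      intro h0
      obtain ⟨rfl, rfl⟩ := List.append_eq_nil_iff.1 h0
      have : [] = l ++ [true, true] ++ r := hU
      simp at this
    have h0 : Joins (U ++ V) [] [] := (joins_append ..).2 ⟨_, hU, hV⟩
    have h1 : ∀ o, Joins (U ++ [⟨l, .cross o true true, r⟩] ++ V) [] [] := fun o =>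
      (joins_append ..).2 ⟨_, (joins_append ..).2 ⟨_, hU, hc o⟩, hV⟩
    let D : Bool → Diagram := fun o => ⟨_, h1 o, by simp⟩
    have e0 := evalWord_diagram f ⟨_, h0, n0⟩
    have e1 := fun o => evalWord_diagram f (D o)
    have := hf (D true).link (D false).link (Diagram.link ⟨_, h0, n0⟩)
      ⟨D true, D false, ⟨_, h0, n0⟩, U, V, l, r, rfl, rfl, rfl, rfl, rfl, rfl⟩
    rw [← e0, ← e1, ← e1] at this
    simpa [D, Slice.pos] using this
  -- If the rest of the word does not fit, all three terms of the skein relation are the default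
  -- value `0`.
  · have hz : ∀ w, Runs (l ++ [true, true] ++ r) w (l ++ [true, true] ++ r) →
        evalWord f (U.map Slice.pos ++ (w ++ v)) = 0 := by
      intro w hw
      apply evalWord_eq_zero
      rw [runs_append]
      rintro ⟨m, h1, h2⟩
      obtain rfl := hu.unique h1
      obtain ⟨m', h3, h4⟩ := (runs_append ..).1 h2
      obtain rfl := hw.unique h3
      exact hv h4
    have hd : ∀ o, Runs (l ++ [true, true] ++ r) [(l.length, .cross o true true)]
        (l ++ [true, true] ++ r) := fun o => ⟨l, r, rfl, rfl, rfl⟩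
    have z1 := hz _ (hd true)
    have z2 := hz _ (hd false)
    have z0 := hz [] rfl
    simp only [List.cons_append, List.nil_append] at z1 z2 z0
    rw [z1, z2, z0]
    simp

end Functionals

/-! ### The Hecke algebra acting on upward strands -/

section Functionals

variable {R M : Type*} [CommRing R] [AddCommGroup M] [Module R M] {a z : Rˣ}

/-! ### Distant pieces commute -/

theorem cross_cross (o a b o' a' b' : Bool) {i j : ℕ} (h : i + 2 ≤ j) (φ : Functional R M) :
    draw j (.cross o a b) (draw i (.cross o' a' b') φ) =
      draw i (.cross o' a' b') (draw j (.cross o a b) φ) :=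
  draw_comm _ _ (by simpa [Piece.cod] using h) (by simp [Piece.cod, Piece.dom]) φ

theorem cup_cross (a o' a' b' : Bool) {i j : ℕ} (h : i + 2 ≤ j) (φ : Functional R M) :
    draw j (.cup a) (draw i (.cross o' a' b') φ) =
      draw i (.cross o' a' b') (draw j (.cup a) φ) :=
  draw_comm _ _ (by simpa [Piece.cod] using h) (by simp [Piece.cod, Piece.dom]) φ

theorem cap_cross (a o' a' b' : Bool) {i j : ℕ} (h : i + 2 ≤ j) (φ : Functional R M) :
    draw j (.cap a) (draw i (.cross o' a' b') φ) =
      draw i (.cross o' a' b') (draw j (.cap a) φ) :=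
  draw_comm _ _ (by simpa [Piece.cod] using h) (by simp [Piece.cod, Piece.dom]) φ

theorem cross_cup (o a b a' : Bool) {i j : ℕ} (h : i ≤ j) (φ : Functional R M) :
    draw (j + 2) (.cross o a b) (draw i (.cup a') φ) =
      draw i (.cup a') (draw j (.cross o a b) φ) :=
  draw_comm _ _ (by simpa [Piece.cod] using h) (by simp [Piece.cod, Piece.dom]) φ

theorem cross_cap (o a b a' : Bool) {i j : ℕ} (h : i ≤ j) (φ : Functional R M) :
    draw j (.cross o a b) (draw i (.cap a') φ) =
      draw i (.cap a') (draw (j + 2) (.cross o a b) φ) :=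
  draw_comm _ _ (by simpa [Piece.cod] using h) (by simp [Piece.cod, Piece.dom]) φ

theorem cup_cup (a a' : Bool) {i j : ℕ} (h : i ≤ j) (φ : Functional R M) :
    draw (j + 2) (.cup a) (draw i (.cup a') φ) = draw i (.cup a') (draw j (.cup a) φ) :=
  draw_comm _ _ (by simpa [Piece.cod] using h) (by simp [Piece.cod, Piece.dom]) φ

theorem cup_cap (a a' : Bool) {i j : ℕ} (h : i ≤ j) (φ : Functional R M) :
    draw j (.cup a) (draw i (.cap a') φ) = draw i (.cap a') (draw (j + 2) (.cup a) φ) :=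
  draw_comm _ _ (by simpa [Piece.cod] using h) (by simp [Piece.cod, Piece.dom]) φ

theorem cap_cap (a a' : Bool) {i j : ℕ} (h : i ≤ j) (φ : Functional R M) :
    draw j (.cap a) (draw i (.cap a') φ) = draw i (.cap a') (draw (j + 2) (.cap a) φ) :=
  draw_comm _ _ (by simpa [Piece.cod] using h) (by simp [Piece.cod, Piece.dom]) φ

/-! ### The action of positive braids -/

/-- A positive crossing of upward strands. -/
abbrev posX (i : ℕ) : Functional R M →ₗ[R] Functional R M := draw i (.cross true true true)

theorem replicate_split {α : Type*} (a : α) {n i : ℕ} (h : i + 2 ≤ n) :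
    List.replicate n a = List.replicate i a ++ [a, a] ++ List.replicate (n - (i + 2)) a := by
  rw [show [a, a] = List.replicate 2 a from rfl, ← List.replicate_add, ← List.replicate_add]
  congr 1; omega

theorem cross_mem_typed (o : Bool) {n i : ℕ} {r : List Bool} (h : i + 2 ≤ n) {φ : Functional R M}
    (hφ : φ ∈ Typed a z (List.replicate n true ++ r)) :
    draw i (.cross o true true) φ ∈ Typed a z (List.replicate n true ++ r) := by
  rw [replicate_split true h, List.append_assoc _ _ r] at hφ ⊢
  exact draw_mem_typed (p := .cross o true true) hφ (List.replicate i true) _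
    List.length_replicate rfl

theorem skein_replicate {n i : ℕ} {r : List Bool} (h : i + 2 ≤ n) {φ : Functional R M}
    (hφ : φ ∈ Typed a z (List.replicate n true ++ r)) :
    (a : R) • posX i φ + ((a⁻¹ : Rˣ) : R) • draw i (.cross false true true) φ =
      (z : R) • φ := by
  rw [replicate_split true h, List.append_assoc _ _ r] at hφ
  exact skein_typed hφ List.length_replicate

theorem cancel_replicate (o : Bool) {n i : ℕ} {r : List Bool} (h : i + 2 ≤ n) {φ : Functional R M}
    (hφ : φ ∈ Typed a z (List.replicate n true ++ r)) :
    draw i (.cross (!o) true true) (draw i (.cross o true true) φ) = φ := by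
  rw [replicate_split true h, List.append_assoc _ _ r] at hφ
  exact cancel_cross o true true hφ List.length_replicate

/-- The skein relation expresses a negative crossing through a positive one and the identity, so
spans only need products of positive crossings. -/
theorem negX_eq {n i : ℕ} {r : List Bool} (h : i + 2 ≤ n) {φ : Functional R M}
    (hφ : φ ∈ Typed a z (List.replicate n true ++ r)) :
    draw i (.cross false true true) φ =
      (a : R) • ((z : R) • φ - (a : R) • posX i φ) := by
  rw [← skein_replicate h hφ, add_sub_cancel_left, smul_smul, Units.mul_inv, one_smul]

/-- The quadratic relation of the Hecke algebra: the skein relation applied on top of one more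
positive crossing, where the negative one cancels. -/
theorem posX_posX {n i : ℕ} {r : List Bool} (h : i + 2 ≤ n) {φ : Functional R M}
    (hφ : φ ∈ Typed a z (List.replicate n true ++ r)) :
    posX i (posX i φ) = ((a⁻¹ : Rˣ) : R) •
      ((z : R) • posX i φ - ((a⁻¹ : Rˣ) : R) • φ) := by
  have hc := cancel_replicate true h hφ
  rw [Bool.not_true] at hc
  rw [← skein_replicate h (cross_mem_typed true h hφ), hc,
    add_sub_cancel_right, smul_smul, Units.inv_mul, one_smul]

/-- A product of positive crossings of upward strands. -/
def hecke : List ℕ → Functional R M →ₗ[R] Functional R M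
  | [] => LinearMap.id
  | i :: h => hecke h ∘ₗ posX i

@[simp] theorem hecke_nil (φ : Functional R M) : hecke [] φ = φ := rfl

@[simp] theorem hecke_cons (i : ℕ) (h : List ℕ) (φ : Functional R M) :
    hecke (i :: h) φ = hecke h (posX i φ) := rfl

theorem hecke_append (h h' : List ℕ) (φ : Functional R M) :
    hecke (h ++ h') φ = hecke h' (hecke h φ) := by
  induction h generalizing φ with
  | nil => rfl
  | cons i h ih => simp [ih]

theorem posX_hecke (i : ℕ) (h : List ℕ) (φ : Functional R M) :
    posX i (hecke h φ) = hecke (h ++ [i]) φ := by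
  simp [hecke_append]

theorem hecke_mem_typed {n : ℕ} {r : List Bool} (h : List ℕ) (hh : ∀ i ∈ h, i + 2 ≤ n)
    {φ : Functional R M} (hφ : φ ∈ Typed a z (List.replicate n true ++ r)) :
    hecke h φ ∈ Typed a z (List.replicate n true ++ r) := by
  induction h generalizing φ with
  | nil => exact hφ
  | cons i h ih =>
    exact ih (fun j hj => hh j (by simp [hj])) (cross_mem_typed true (hh i (by simp)) hφ)

theorem draw_hecke (p : Piece) {j : ℕ} (hp : ∀ i, i + 2 ≤ j → ∀ φ : Functional R M,
      draw j p (posX i φ) = posX i (draw j p φ)) (h : List ℕ) (hh : ∀ i ∈ h, i + 2 ≤ j)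
    (φ : Functional R M) : draw j p (hecke h φ) = hecke h (draw j p φ) := by
  induction h generalizing φ with
  | nil => rfl
  | cons i h ih =>
    rw [hecke_cons, ih (fun j hj => hh j (by simp [hj])), hp i (hh i (by simp)), hecke_cons]

/-- The combinations of the products `h` and `h₁ X_m h₂`, where `h`, `h₁`, `h₂` only use the
crossings `X_i` with `i < m`. -/
def heckeSpan (m : ℕ) (φ : Functional R M) : Submodule R (Functional R M) :=
  Submodule.span R
    ({ψ | ∃ h : List ℕ, (∀ i ∈ h, i < m) ∧ ψ = hecke h φ} ∪
      {ψ | ∃ h₁ h₂ : List ℕ, (∀ i ∈ h₁, i < m) ∧ (∀ i ∈ h₂, i < m) ∧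
        ψ = hecke h₂ (posX m (hecke h₁ φ))})

theorem hecke_mem_heckeSpan' {m : ℕ} {φ : Functional R M} {h : List ℕ} (hh : ∀ i ∈ h, i < m) :
    hecke h φ ∈ heckeSpan m φ :=
  Submodule.subset_span (Or.inl ⟨h, hh, rfl⟩)

theorem hecke_posX_hecke_mem {m : ℕ} {φ : Functional R M} {h₁ h₂ : List ℕ}
    (hh₁ : ∀ i ∈ h₁, i < m) (hh₂ : ∀ i ∈ h₂, i < m) :
    hecke h₂ (posX m (hecke h₁ φ)) ∈ heckeSpan m φ :=
  Submodule.subset_span (Or.inr ⟨h₁, h₂, hh₁, hh₂, rfl⟩)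

theorem forall_mem_append {α : Type*} {P : α → Prop} {h h' : List α} (H : ∀ i ∈ h, P i)
    (H' : ∀ i ∈ h', P i) : ∀ i ∈ h ++ h', P i := by
  intro i hi
  rcases List.mem_append.1 hi with hi | hi
  exacts [H i hi, H' i hi]

/-- The classical reduction in the Hecke algebra. Only right multiplication of `h₁ X_m h₂` by `X_m`
is a problem. By induction `h₂` contains at most one `X_{m-1}`; the rest commutes with `X_m`, so
either `X_m X_m` appears and the quadratic relation applies, or `X_m X_{m-1} X_m` appears and the
braid relation leaves a single `X_m`. -/
theorem hecke_mem_heckeSpan (m : ℕ) {r : List Bool} {φ : Functional R M}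
    (hφ : φ ∈ Typed a z (List.replicate (m + 2) true ++ r)) (h : List ℕ) (hh : ∀ i ∈ h, i < m + 1) :
    hecke h φ ∈ heckeSpan m φ := by
  induction m generalizing r φ h with
  | zero =>
    have key : heckeSpan 0 φ ≤ (heckeSpan 0 φ).comap (posX 0) := by
      refine Submodule.span_le.2 ?_
      rintro ψ (⟨h, hh, rfl⟩ | ⟨h₁, h₂, hh₁, hh₂, rfl⟩)
      · exact hecke_posX_hecke_mem (h₁ := h) (h₂ := []) hh (by simp)
      · obtain rfl : h₁ = [] := List.eq_nil_iff_forall_not_mem.2 fun i hi => by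
          simpa using hh₁ i hi
        obtain rfl : h₂ = [] := List.eq_nil_iff_forall_not_mem.2 fun i hi => by
          simpa using hh₂ i hi
        simp only [hecke_nil, SetLike.mem_coe, Submodule.mem_comap]
        rw [posX_posX (by omega) hφ]
        exact Submodule.smul_mem _ _ (Submodule.sub_mem _
          (Submodule.smul_mem _ _ (hecke_posX_hecke_mem (h₁ := []) (h₂ := []) (by simp) (by simp)))
          (Submodule.smul_mem _ _ (hecke_mem_heckeSpan' (h := []) (by simp))))
    induction h using List.reverseRecOn with
    | nil => exact hecke_mem_heckeSpan' (h := []) (by simp)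
    | append_singleton h i ih =>
      obtain rfl : i = 0 := by simpa using hh i (by simp)
      rw [← posX_hecke]
      exact key (ih fun j hj => hh j (by simp [hj]))
  | succ m IH =>
    have keyTop : heckeSpan (m + 1) φ ≤ (heckeSpan (m + 1) φ).comap (posX (m + 1)) := by
      refine Submodule.span_le.2 ?_
      rintro ψ (⟨h, hh, rfl⟩ | ⟨h₁, h₂, hh₁, hh₂, rfl⟩)
      · exact hecke_posX_hecke_mem (h₁ := h) (h₂ := []) hh (by simp)
      · set χ := posX (m + 1) (hecke h₁ φ) with hχ
        have h1t : hecke h₁ φ ∈ Typed a z (List.replicate (m + 1 + 2) true ++ r) :=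
          hecke_mem_typed h₁ (fun i hi => by have := hh₁ i hi; omega) hφ
        -- The induction hypothesis for `m` is applied to `χ`, with the last of the `m + 3` upward
        -- strands counted among the idle strands; this is why `r` and `φ` are generalized.
        have hχt : χ ∈ Typed a z (List.replicate (m + 2) true ++ (true :: r)) := by
          have := cross_mem_typed true (i := m + 1) (by omega) h1t
          rw [show List.replicate (m + 2) true ++ (true :: r) =
            List.replicate (m + 1 + 2) true ++ r by
              rw [List.replicate_succ' (n := m + 2)]; simp]
          exact this
        have sub : heckeSpan m χ ≤ (heckeSpan (m + 1) φ).comap (posX (m + 1)) := by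
          refine Submodule.span_le.2 ?_
          rintro ψ (⟨h, hh, rfl⟩ | ⟨h₃, h₄, hh₃, hh₄, rfl⟩)
          · simp only [SetLike.mem_coe, Submodule.mem_comap]
            rw [draw_hecke _ (fun i hi φ => cross_cross _ _ _ _ _ _ hi φ) h
              (fun i hi => by have := hh i hi; omega), hχ, posX_posX (by omega) h1t]
            simp only [map_smul, map_sub]
            refine Submodule.smul_mem _ _ (Submodule.sub_mem _ (Submodule.smul_mem _ _
              (hecke_posX_hecke_mem hh₁ fun i hi => by have := hh i hi; omega))
              (Submodule.smul_mem _ _ ?_))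
            rw [← hecke_append]
            exact hecke_mem_heckeSpan' (forall_mem_append hh₁ fun i hi => by
              have := hh i hi; omega)
          · simp only [SetLike.mem_coe, Submodule.mem_comap]
            rw [draw_hecke _ (fun i hi φ => cross_cross _ _ _ _ _ _ hi φ) h₄
              (fun i hi => by have := hh₄ i hi; omega), hχ,
              ← draw_hecke _ (fun i hi φ => cross_cross _ _ _ _ _ _ hi φ) h₃
              (fun i hi => by have := hh₃ i hi; omega), ← braid, ← hecke_append, posX_hecke,
              ← hecke_cons]
            exact hecke_posX_hecke_mem
              (forall_mem_append (forall_mem_append hh₁ fun i hi => by have := hh₃ i hi; omega)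
                (by simp))
              (by
                intro i hi
                rcases List.mem_cons.1 hi with rfl | hi
                · omega
                · have := hh₄ i hi; omega)
        exact sub (IH hχt h₂ hh₂)
    have key : ∀ i < m + 2, heckeSpan (m + 1) φ ≤ (heckeSpan (m + 1) φ).comap (posX i) := by
      intro i hi
      rcases Nat.lt_succ_iff_lt_or_eq.1 hi with hi | rfl
      · refine Submodule.span_le.2 ?_
        rintro ψ (⟨h, hh, rfl⟩ | ⟨h₁, h₂, hh₁, hh₂, rfl⟩)
        · simp only [SetLike.mem_coe, Submodule.mem_comap]
          rw [posX_hecke]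
          exact hecke_mem_heckeSpan' (forall_mem_append hh (by simpa using hi))
        · simp only [SetLike.mem_coe, Submodule.mem_comap]
          rw [posX_hecke]
          exact hecke_posX_hecke_mem hh₁ (forall_mem_append hh₂ (by simpa using hi))
      · exact keyTop
    induction h using List.reverseRecOn with
    | nil => exact hecke_mem_heckeSpan' (h := []) (by simp)
    | append_singleton h i ih =>
      rw [← posX_hecke]
      exact key i (hh i (by simp)) (ih fun j hj => hh j (by simp [hj]))

end Functionals

/-! ### Circles, nested arcs and closure under the innermost maximum -/

section Functionals

variable {R M : Type*} [CommRing R] [AddCommGroup M] [Module R M] {a z : Rˣ}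

/-! ### Small circles and curls -/

/-- A circle next to a strand may be moved to the other side of it. -/
theorem circle_past (s : Bool) {l r : List Bool} {φ : Functional R M}
    (h : φ ∈ Typed a z (l ++ [s] ++ r)) {i : ℕ} (hl : l.length = i) :
    draw i (.cap true) (draw i (.cup true) φ) =
      draw (i + 1) (.cap true) (draw (i + 1) (.cup true) φ) := by
  have h1 : draw (i + 1) (.cup true) φ ∈ Typed a z (l ++ [s, true] ++ (false :: r)) := by
    have := draw_mem_typed (i := i + 1) (p := .cup true) h (l ++ [s]) r (by simp [hl])
      (by simp [Piece.dom])
    simpa [Piece.cod] using this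
  have h0 : draw i (.cup true) φ ∈ Typed a z ((l ++ [true]) ++ [false, s] ++ r) := by
    have := draw_mem_typed (p := .cup true) h l (s :: r) hl (by simp [Piece.dom])
    simpa [Piece.cod] using this
  -- The strand is pulled through the circle: it slides across the minimum, then across the maximum,
  -- and the two crossings cancel at either end.
  have e1 := slide_cup true s true i φ
  have e2 := slide_cap false s true i (draw i (.cross true s true) (draw (i + 1) (.cup true) φ))
  rw [e1] at e2
  have c1 := cancel_cross true s true h1 hl
  have c0 := cancel_cross false false s h0 (i := i + 1) (by simp [hl])
  simp only [Bool.not_true, Bool.not_false] at e1 e2 c1 c0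
  rw [c0, ← e1, c1] at e2
  exact e2.symm

/-- A curl of a strand with the left leg of a minimum can be undone. -/
theorem curl {l r : List Bool} {φ : Functional R M} (o : Bool)
    (h : φ ∈ Typed a z (l ++ [true] ++ r)) {i : ℕ} (hl : l.length = i) :
    draw (i + 1) (.cap true) (draw i (.cross o true true) (draw (i + 1) (.cup true) φ)) = φ := by
  rw [slide_cup, Bool.not_true]
  have := twist_cap (!o) false (i + 1) (draw i (.cup true) φ)
  rw [Bool.not_false] at this
  rw [this]
  exact zigzag_left true h hl

/-- The value of a trivial component next to a strand. -/
def circleValue (a z : Rˣ) : R := ((z⁻¹ : Rˣ) : R) * (a + ((a⁻¹ : Rˣ) : R))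

/-- In the skein relation for a strand and the left leg of a new minimum, closing the minimum turns
both crossings into curls and the smoothing into a circle; dividing by `z` gives its value. An
upward strand to the left is needed, so a lone circle cannot be removed this way, and `standard`
keeps `circle ξ` as a second generator. -/
theorem circle_eq {l r : List Bool} {φ : Functional R M}
    (h : φ ∈ Typed a z (l ++ [true] ++ r)) {i : ℕ} (hl : l.length = i) :
    draw (i + 1) (.cap true) (draw (i + 1) (.cup true) φ) = circleValue a z • φ := by
  have h1 : draw (i + 1) (.cup true) φ ∈ Typed a z (l ++ [true, true] ++ (false :: r)) := by
    have := draw_mem_typed (i := i + 1) (p := .cup true) h (l ++ [true]) r (by simp [hl])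
      (by simp [Piece.dom])
    simpa [Piece.cod] using this
  have := congrArg (draw (i + 1) (.cap true)) (skein_typed h1 hl)
  simp only [map_add, map_smul, curl _ h hl] at this
  rw [circleValue, mul_smul, add_smul, this, smul_smul, Units.inv_mul, one_smul]

/-! ### Nested arcs -/

/-- Add `n` nested arcs. -/
def nest : ℕ → Functional R M →ₗ[R] Functional R M
  | 0 => LinearMap.id
  | n + 1 => draw n (.cup true) ∘ₗ nest n

/-- The boundary of `n` nested arcs. -/
abbrev nestType (n : ℕ) : List Bool := List.replicate n true ++ List.replicate n false

@[simp] theorem nest_zero (φ : Functional R M) : nest 0 φ = φ := rfl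

@[simp] theorem nest_succ (n : ℕ) (φ : Functional R M) :
    nest (n + 1) φ = draw n (.cup true) (nest n φ) := rfl

theorem nestType_succ (n : ℕ) :
    nestType (n + 1) = List.replicate n true ++ [true, false] ++ List.replicate n false := by
  rw [nestType, List.replicate_succ', List.replicate_succ]; simp

theorem cup_mem_typed {n : ℕ} {φ : Functional R M} (h : φ ∈ Typed a z (nestType n)) :
    draw n (.cup true) φ ∈ Typed a z (nestType (n + 1)) := by
  rw [nestType_succ]
  exact draw_mem_typed (p := .cup true) h (List.replicate n true) _ (by simp) (by simp [Piece.dom])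

theorem cap_mem_typed {n : ℕ} {φ : Functional R M} (h : φ ∈ Typed a z (nestType (n + 1))) :
    draw n (.cap true) φ ∈ Typed a z (nestType n) := by
  rw [nestType_succ] at h
  have := draw_mem_typed (i := n) (p := .cap true) h (List.replicate n true) _ (by simp) rfl
  simpa [Piece.cod] using this

theorem nest_mem_typed (n : ℕ) {ξ : Functional R M} (h : ξ ∈ Typed a z []) :
    nest n ξ ∈ Typed a z (nestType n) := by
  induction n with
  | zero => exact h
  | succ n ih => exact cup_mem_typed ih

/-- A closed circle. -/
def circle : Functional R M →ₗ[R] Functional R M := draw 0 (.cap true) ∘ₗ draw 0 (.cup true)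

theorem circle_mem_typed {ξ : Functional R M} (h : ξ ∈ Typed a z []) :
    circle ξ ∈ Typed a z [] :=
  cap_mem_typed (n := 0) (cup_mem_typed (n := 0) h)

/-- The second circle can be drawn while the first is still open. It then lies to the left of an
ascending leg, moves past it by `circle_past`, and is evaluated by `circle_eq`. -/
theorem circle_circle {ξ : Functional R M} (h : ξ ∈ Typed a z []) :
    circle (circle ξ) = circleValue a z • circle ξ := by
  have h1 : draw 0 (.cup true) ξ ∈ Typed a z ([] ++ [true] ++ [false]) := cup_mem_typed (n := 0) h
  simp only [circle, LinearMap.comp_apply]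
  rw [cup_cap _ _ le_rfl, cap_cap _ _ le_rfl, ← cap_cap _ _ le_rfl]
  rw [cup_cup _ _ le_rfl, circle_past true h1 (i := 0) rfl, circle_eq h1 (i := 0) rfl, map_smul]

/-- The functionals of type `nestType n` that are combinations of nested arcs followed by positive
braids, possibly with a separate circle. -/
def standard (ξ : Functional R M) (n : ℕ) : Submodule R (Functional R M) :=
  Submodule.span R {ψ | ∃ h : List ℕ, (∀ i ∈ h, i + 2 ≤ n) ∧
    (ψ = hecke h (nest n ξ) ∨ ψ = hecke h (nest n (circle ξ)))}

variable {ξ : Functional R M}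

theorem standard_le_typed (hξ : ξ ∈ Typed a z []) (n : ℕ) :
    standard ξ n ≤ Typed a z (nestType n) := by
  refine Submodule.span_le.2 ?_
  rintro ψ ⟨h, hh, rfl | rfl⟩
  · exact hecke_mem_typed h hh (nest_mem_typed n hξ)
  · exact hecke_mem_typed h hh (nest_mem_typed n (circle_mem_typed hξ))

theorem cup_mem_standard {n : ℕ} {φ : Functional R M} (hφ : φ ∈ standard ξ n) :
    draw n (.cup true) φ ∈ standard ξ (n + 1) := by
  have key : standard ξ n ≤ (standard ξ (n + 1)).comap (draw n (.cup true)) := by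
    refine Submodule.span_le.2 ?_
    rintro ψ ⟨h, hh, H⟩
    refine Submodule.subset_span ⟨h, fun i hi => (hh i hi).trans (by omega), ?_⟩
    have e := draw_hecke (R := R) (M := M) (.cup true) (j := n)
      (fun i hi φ => cup_cross _ _ _ _ hi φ) h hh
    rcases H with rfl | rfl
    · exact Or.inl (e _)
    · exact Or.inr (e _)
  exact key hφ

theorem posX_mem_standard {n i : ℕ} (hi : i + 2 ≤ n) {φ : Functional R M}
    (hφ : φ ∈ standard ξ n) : posX i φ ∈ standard ξ n := by
  have key : standard ξ n ≤ (standard ξ n).comap (posX i) := by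
    refine Submodule.span_le.2 ?_
    rintro ψ ⟨h, hh, H⟩
    refine Submodule.subset_span ⟨h ++ [i], forall_mem_append hh (by simpa using hi), ?_⟩
    rcases H with rfl | rfl
    · exact Or.inl (posX_hecke ..)
    · exact Or.inr (posX_hecke ..)
  exact key hφ

theorem cross_mem_standard (hξ : ξ ∈ Typed a z []) (o : Bool) {n i : ℕ} (hi : i + 2 ≤ n)
    {φ : Functional R M} (hφ : φ ∈ standard ξ n) :
    draw i (.cross o true true) φ ∈ standard ξ n := by
  cases o
  · rw [negX_eq hi (standard_le_typed hξ n hφ)]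
    exact Submodule.smul_mem _ _ (Submodule.sub_mem _ (Submodule.smul_mem _ _ hφ)
      (Submodule.smul_mem _ _ (posX_mem_standard hi hφ)))
  · exact posX_mem_standard hi hφ

/-- A crossing of the descending ends of two neighbouring arcs is a crossing of the ascending
ends. -/
theorem cross_down_nest (o : Bool) {n j : ℕ} (hj : j + 2 ≤ n) {φ : Functional R M} :
    draw (n + j) (.cross o false false) (nest n φ) =
      draw (n - 2 - j) (.cross o true true) (nest n φ) := by
  induction n generalizing j with
  | zero => omega
  | succ n ih =>
    cases j with
    | zero =>
      obtain ⟨n, rfl⟩ : ∃ m, n = m + 1 := ⟨n - 1, by omega⟩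
      simp only [nest_succ, Nat.sub_zero, Nat.add_zero]
      -- For the two innermost arcs the crossing slides across the two minima, one after the other.
      rw [show n + 1 + 1 - 2 = n by omega, slide_cup, ← cup_cup _ _ le_rfl, slide_cup]
      simp
    | succ j =>
      rw [show n + 1 + (j + 1) = n + j + 2 by omega, nest_succ, cross_cup _ _ _ _ (by omega),
        ih (by omega), cup_cross _ _ _ _ (by omega)]
      congr 2
      omega

theorem cross_down_mem_standard (hξ : ξ ∈ Typed a z []) (o : Bool) {n j : ℕ} (hj : j + 2 ≤ n)
    {φ : Functional R M} (hφ : φ ∈ standard ξ n) :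
    draw (n + j) (.cross o false false) φ ∈ standard ξ n := by
  have key : standard ξ n ≤ (standard ξ n).comap (draw (n + j) (.cross o false false)) := by
    refine Submodule.span_le.2 ?_
    rintro ψ ⟨h, hh, H⟩
    have e := draw_hecke (R := R) (M := M) (.cross o false false) (j := n + j)
      (fun i hi φ => cross_cross _ _ _ _ _ _ hi φ) h (fun i hi => (hh i hi).trans (by omega))
    have c : ∀ h : List ℕ, (∀ i ∈ h, i + 2 ≤ n) → ∀ φ : Functional R M, φ ∈ standard ξ n →
        hecke h φ ∈ standard ξ n := by
      intro h hh φ hφ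
      induction h generalizing φ with
      | nil => exact hφ
      | cons i h ih =>
        exact ih (fun j hj => hh j (by simp [hj])) _ (posX_mem_standard (hh i (by simp)) hφ)
    have b : nest n ξ ∈ standard ξ n := Submodule.subset_span ⟨[], by simp, Or.inl rfl⟩
    have b' : nest n (circle ξ) ∈ standard ξ n := Submodule.subset_span ⟨[], by simp, Or.inr rfl⟩
    simp only [SetLike.mem_coe, Submodule.mem_comap]
    rcases H with rfl | rfl <;> rw [e, cross_down_nest o hj]
    · exact c h hh _ (cross_mem_standard hξ o (by omega) b)
    · exact c h hh _ (cross_mem_standard hξ o (by omega) b')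
  exact key hφ

/-- The analogue of the Markov trace. After the Hecke reduction the highest crossing occurs at most
once, and the crossings below it commute with the innermost arc. If it does not occur, closing this
arc leaves a circle beside a strand; if it occurs once, a curl is left. With a single arc there is
no strand to help, and `circle_circle` takes over. -/
theorem cap_mem_standard (hξ : ξ ∈ Typed a z []) {n : ℕ} {φ : Functional R M}
    (hφ : φ ∈ standard ξ (n + 1)) : draw n (.cap true) φ ∈ standard ξ n := by
  have key : standard ξ (n + 1) ≤ (standard ξ n).comap (draw n (.cap true)) := by
    refine Submodule.span_le.2 ?_
    rintro ψ ⟨h, hh, H⟩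
    cases n with
    | zero =>
      obtain rfl : h = [] := List.eq_nil_iff_forall_not_mem.2 fun i hi => by
        have := hh i hi; omega
      rcases H with rfl | rfl
      · exact Submodule.subset_span ⟨[], by simp, Or.inr rfl⟩
      · change circle (circle ξ) ∈ standard ξ 0
        rw [circle_circle hξ]
        exact Submodule.smul_mem _ _ (Submodule.subset_span ⟨[], by simp, Or.inr rfl⟩)
    | succ m =>
      have main : ∀ η : Functional R M, η ∈ Typed a z [] →
          (∀ h : List ℕ, (∀ i ∈ h, i + 2 ≤ m + 1) →
            hecke h (nest (m + 1) η) ∈ standard ξ (m + 1)) →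
          hecke h (nest (m + 1 + 1) η) ∈ (standard ξ (m + 1)).comap (draw (m + 1) (.cap true)) := by
        intro η hη hmem
        have ht : nest (m + 1) η ∈ Typed a z (nestType (m + 1)) := nest_mem_typed _ hη
        have hcup := fun (h : List ℕ) (hh : ∀ i ∈ h, i + 2 ≤ m + 1) =>
          draw_hecke (R := R) (M := M) (.cup true) (j := m + 1)
          (fun i hi φ => cup_cross _ _ _ _ hi φ) h hh
        have hcap := fun (h : List ℕ) (hh : ∀ i ∈ h, i + 2 ≤ m + 1) =>
          draw_hecke (R := R) (M := M) (.cap true) (j := m + 1)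
          (fun i hi φ => cap_cross _ _ _ _ hi φ) h hh
        have ht' : ∀ h : List ℕ, (∀ i ∈ h, i < m) → hecke h (nest (m + 1) η) ∈
            Typed a z (List.replicate m true ++ [true] ++ List.replicate (m + 1) false) := by
          intro h hh
          rw [show List.replicate m true ++ [true] = List.replicate (m + 1) true from
            (List.replicate_succ' ..).symm]
          exact hecke_mem_typed h (fun i hi => by have := hh i hi; omega) ht
        have hsub : heckeSpan m (nest (m + 1 + 1) η) ≤
            (standard ξ (m + 1)).comap (draw (m + 1) (.cap true)) := by
          refine Submodule.span_le.2 ?_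
          rintro ψ (⟨h, hh, rfl⟩ | ⟨h₁, h₂, hh₁, hh₂, rfl⟩)
          · have hh' : ∀ i ∈ h, i + 2 ≤ m + 1 := fun i hi => by have := hh i hi; omega
            simp only [SetLike.mem_coe, Submodule.mem_comap]
            rw [nest_succ, ← hcup h hh', circle_eq (ht' h hh) (by simp)]
            exact Submodule.smul_mem _ _ (hmem h hh')
          · have hh₁' : ∀ i ∈ h₁, i + 2 ≤ m + 1 := fun i hi => by have := hh₁ i hi; omega
            have hh₂' : ∀ i ∈ h₂, i + 2 ≤ m + 1 := fun i hi => by have := hh₂ i hi; omega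
            simp only [SetLike.mem_coe, Submodule.mem_comap]
            rw [nest_succ, ← hcup h₁ hh₁', hcap h₂ hh₂', curl true (ht' h₁ hh₁) (by simp),
              ← hecke_append]
            exact hmem _ (forall_mem_append hh₁' hh₂')
        have htop : nest (m + 1 + 1) η ∈ Typed a z (nestType (m + 1 + 1)) := nest_mem_typed _ hη
        exact hsub (hecke_mem_heckeSpan m htop h fun i hi => by have := hh i hi; omega)
      rcases H with rfl | rfl
      · exact main ξ hξ fun h hh => Submodule.subset_span ⟨h, hh, Or.inl rfl⟩
      · exact main _ (circle_mem_typed hξ) fun h hh => Submodule.subset_span ⟨h, hh, Or.inr rfl⟩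
  exact key hφ

end Functionals

/-! ### Tangles with arbitrarily ordered ends: upward strands above downward ones -/

section Functionals

variable {R M : Type*} [CommRing R] [AddCommGroup M] [Module R M] {a z : Rˣ}

/-! ### Sorting the strands -/

/-- Move a downward strand to the left, below `p` upward strands. -/
def moveLeft (k : ℕ) : ℕ → Functional R M →ₗ[R] Functional R M
  | 0 => LinearMap.id
  | p + 1 => moveLeft k p ∘ₗ draw (k + p) (.cross true true false)

@[simp] theorem moveLeft_zero (k : ℕ) (φ : Functional R M) : moveLeft k 0 φ = φ := rfl

theorem moveLeft_succ (k p : ℕ) (φ : Functional R M) :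
    moveLeft k (p + 1) φ = moveLeft k p (draw (k + p) (.cross true true false) φ) := rfl

/-- Bring upward strands followed by downward strands, with `k` strands to the left of them, into
the order `t`, with all upward strands above all downward strands. -/
def sort : List Bool → ℕ → Functional R M →ₗ[R] Functional R M
  | [], _ => LinearMap.id
  | true :: t, k => sort t (k + 1)
  | false :: t, k => sort t (k + 1) ∘ₗ moveLeft k (t.count true)

@[simp] theorem sort_nil (k : ℕ) (φ : Functional R M) : sort [] k φ = φ := rfl

theorem sort_true (t : List Bool) (k : ℕ) (φ : Functional R M) :
    sort (true :: t) k φ = sort t (k + 1) φ := rfl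

theorem sort_false (t : List Bool) (k : ℕ) (φ : Functional R M) :
    sort (false :: t) k φ = sort t (k + 1) (moveLeft k (t.count true) φ) := rfl

theorem draw_moveLeft_of_le (o c d : Bool) {j k p : ℕ} (h : k + p + 1 ≤ j) (φ : Functional R M) :
    draw j (.cross o c d) (moveLeft k p φ) = moveLeft k p (draw j (.cross o c d) φ) := by
  induction p generalizing φ with
  | zero => rfl
  | succ p ih => rw [moveLeft_succ, ih (by omega), cross_cross _ _ _ _ _ _ (by omega)]; rfl

theorem draw_moveLeft_of_ge (o c d : Bool) {j k p : ℕ} (h : j + 2 ≤ k) (φ : Functional R M) :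
    draw j (.cross o c d) (moveLeft k p φ) = moveLeft k p (draw j (.cross o c d) φ) := by
  induction p generalizing φ with
  | zero => rfl
  | succ p ih => rw [moveLeft_succ, ih, ← cross_cross _ _ _ _ _ _ (by omega)]; rfl

theorem draw_sort (o c d : Bool) (t : List Bool) {j k : ℕ} (h : j + 2 ≤ k) (φ : Functional R M) :
    draw j (.cross o c d) (sort t k φ) = sort t k (draw j (.cross o c d) φ) := by
  induction t generalizing k φ with
  | nil => rfl
  | cons b t ih =>
    cases b
    · rw [sort_false, ih (by omega), draw_moveLeft_of_ge _ _ _ h, sort_false]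
    · rw [sort_true, ih (by omega), sort_true]

theorem cup_moveLeft (c : Bool) {j k p : ℕ} (h : j ≤ k) (φ : Functional R M) :
    draw j (.cup c) (moveLeft k p φ) = moveLeft (k + 2) p (draw j (.cup c) φ) := by
  induction p generalizing φ with
  | zero => rfl
  | succ p ih =>
    rw [moveLeft_succ, ih, ← cross_cup _ _ _ _ (by omega), moveLeft_succ,
      show k + 2 + p = k + p + 2 by omega]

theorem cup_sort (c : Bool) (t : List Bool) {j k : ℕ} (h : j ≤ k) (φ : Functional R M) :
    draw j (.cup c) (sort t k φ) = sort t (k + 2) (draw j (.cup c) φ) := by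
  induction t generalizing k φ with
  | nil => rfl
  | cons b t ih =>
    cases b
    · rw [sort_false, ih (by omega), cup_moveLeft _ h, sort_false]
    · rw [sort_true, ih (by omega), sort_true]

theorem cap_moveLeft (c : Bool) {j k p : ℕ} (h : j ≤ k) (φ : Functional R M) :
    draw j (.cap c) (moveLeft (k + 2) p φ) = moveLeft k p (draw j (.cap c) φ) := by
  induction p generalizing φ with
  | zero => rfl
  | succ p ih =>
    rw [moveLeft_succ, ih, show k + 2 + p = k + p + 2 by omega,
      ← cross_cap _ _ _ _ (by omega), moveLeft_succ]

theorem cap_sort (c : Bool) (t : List Bool) {j k : ℕ} (h : j ≤ k) (φ : Functional R M) :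
    draw j (.cap c) (sort t (k + 2) φ) = sort t k (draw j (.cap c) φ) := by
  induction t generalizing k φ with
  | nil => rfl
  | cons b t ih =>
    cases b
    · rw [sort_false, show k + 2 + 1 = k + 1 + 2 by omega, ih (by omega), cap_moveLeft _ h,
        sort_false]
    · rw [sort_true, show k + 2 + 1 = k + 1 + 2 by omega, ih (by omega), sort_true]

/-- The downward strand passes below both crossing strands, so the crossing moves past it by the
third Reidemeister move and shifts by one place. -/
theorem posX_moveLeft {i k p : ℕ} (h : i + 2 ≤ p) (φ : Functional R M) :
    posX (k + 1 + i) (moveLeft k p φ) = moveLeft k p (posX (k + i) φ) := by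
  induction p generalizing φ with
  | zero => omega
  | succ p ih =>
    rcases Nat.lt_or_ge (i + 1) p with h' | h'
    · rw [moveLeft_succ, ih h', ← cross_cross _ _ _ _ _ _ (by omega)]; rfl
    · obtain rfl : p = i + 1 := by omega
      rw [moveLeft_succ, moveLeft_succ, moveLeft_succ, moveLeft_succ,
        draw_moveLeft_of_le _ _ _ (by omega), show k + 1 + i = k + i + 1 by omega,
        show k + (i + 1) = k + i + 1 by omega, ← braid]

/-- Here two downward strands cross below a family of upward strands; each upward strand is moved
over the crossing by a third Reidemeister move. -/
theorem crossDown_moveLeft_moveLeft (k p : ℕ) (φ : Functional R M) :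
    draw k (.cross true false false) (moveLeft (k + 1) p (moveLeft k p φ)) =
      moveLeft (k + 1) p (moveLeft k p (draw (k + p) (.cross true false false) φ)) := by
  induction p generalizing φ with
  | zero => rfl
  | succ p ih =>
    have e : ∀ φ : Functional R M, moveLeft (k + 1) (p + 1) (moveLeft k (p + 1) φ) =
        moveLeft (k + 1) p (moveLeft k p (draw (k + p + 1) (.cross true true false)
          (draw (k + p) (.cross true true false) φ))) := by
      intro φ
      rw [moveLeft_succ, moveLeft_succ, draw_moveLeft_of_le _ _ _ (by omega),
        show k + 1 + p = k + p + 1 by omega]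
    rw [e, e, ih, braid, show k + (p + 1) = k + p + 1 by omega]

theorem draw_moveLeft_succ (k p : ℕ) (φ : Functional R M) :
    draw k (.cross true true false) (moveLeft (k + 1) p φ) = moveLeft k (p + 1) φ := by
  induction p generalizing φ with
  | zero => rfl
  | succ p ih =>
    rw [moveLeft_succ, ih, moveLeft_succ k (p + 1), show k + 1 + p = k + (p + 1) by omega]

/-- Since the upward strands form a layer of their own, a crossing of two of them can be pushed down
through the whole of `sort`. Its new place is its rank among the upward strands. -/
theorem posX_sort (l r : List Bool) (k : ℕ) (φ : Functional R M) :
    posX (k + l.length) (sort (l ++ [true, true] ++ r) k φ) =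
      sort (l ++ [true, true] ++ r) k (posX (k + l.count true) φ) := by
  induction l generalizing k φ with
  | nil => exact draw_sort _ _ _ r (by simp) φ
  | cons b l ih =>
    simp only [List.cons_append, List.length_cons]
    rw [show k + (l.length + 1) = k + 1 + l.length by omega]
    cases b
    · rw [sort_false, ih, posX_moveLeft (by simp), sort_false]
      simp
    · rw [sort_true, ih, sort_true]
      congr 3
      simp; omega

/-- The same in the lower layer. Below `sort` the downward strands come after all the upward ones,
hence the total count of `true` in the new position. -/
theorem crossDown_sort (l r : List Bool) (k : ℕ) (φ : Functional R M) :
    draw (k + l.length) (.cross true false false) (sort (l ++ [false, false] ++ r) k φ) =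
      sort (l ++ [false, false] ++ r) k (draw (k + (l ++ [false, false] ++ r).count true +
        l.count false) (.cross true false false) φ) := by
  induction l generalizing k φ with
  | nil =>
    simp only [List.nil_append, List.cons_append, List.length_nil, List.count_nil, Nat.add_zero]
    rw [sort_false, sort_false, sort_false, sort_false, draw_sort _ _ _ _ (by omega)]
    simp only [List.count_cons, beq_iff_eq, Bool.false_eq_true, if_false, Nat.add_zero]
    rw [crossDown_moveLeft_moveLeft]
  | cons b l ih =>
    simp only [List.cons_append, List.length_cons]
    rw [show k + (l.length + 1) = k + 1 + l.length by omega]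
    cases b
    · rw [sort_false, ih, draw_moveLeft_of_le _ _ _ (by omega), sort_false]
      congr 4
      simp; omega
    · rw [sort_true, ih, sort_true]
      congr 3
      simp; omega

theorem crossUpDown_sort (l r : List Bool) (k : ℕ) (φ : Functional R M) :
    draw (k + l.length) (.cross true true false) (sort (l ++ [true, false] ++ r) k φ) =
      sort (l ++ [false, true] ++ r) k φ := by
  induction l generalizing k φ with
  | nil =>
    simp only [List.nil_append, List.cons_append, List.length_nil, Nat.add_zero]
    rw [sort_true, sort_false, sort_false, sort_true, draw_sort _ _ _ _ (by omega),
      draw_moveLeft_succ]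
    simp
  | cons b l ih =>
    simp only [List.cons_append, List.length_cons]
    rw [show k + (l.length + 1) = k + 1 + l.length by omega]
    cases b
    · rw [sort_false, ih, sort_false]
      simp
    · rw [sort_true, ih, sort_true]

theorem moveLeft_mem_typed {l r : List Bool} {k p : ℕ} (hl : l.length = k) {φ : Functional R M}
    (h : φ ∈ Typed a z (l ++ List.replicate p true ++ (false :: r))) :
    moveLeft k p φ ∈ Typed a z (l ++ (false :: List.replicate p true) ++ r) := by
  induction p generalizing r φ with
  | zero => simpa using h
  | succ p ih =>
    have := draw_mem_typed (i := k + p) (p := .cross true true false) h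
      (l ++ List.replicate p true) r (by simp [hl])
      (by rw [List.replicate_succ']; simp [Piece.dom])
    have := ih (r := true :: r) (by simpa [Piece.cod] using this)
    rw [moveLeft_succ, List.replicate_succ']
    simpa using this

theorem sort_mem_typed {l : List Bool} (t : List Bool) {k : ℕ} (hl : l.length = k)
    {φ : Functional R M} (h : φ ∈ Typed a z (l ++
      (List.replicate (t.count true) true ++ List.replicate (t.count false) false))) :
    sort t k φ ∈ Typed a z (l ++ t) := by
  induction t generalizing l k φ with
  | nil => simpa using h
  | cons b t ih =>
    cases b
    · have h1 := moveLeft_mem_typed (r := List.replicate (t.count false) false) hl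
        (p := t.count true) (φ := φ) (by simpa [List.replicate_succ] using h)
      have := ih (l := l ++ [false]) (k := k + 1) (by simp [hl]) (by simpa using h1)
      rw [sort_false]
      simpa using this
    · have := ih (l := l ++ [true]) (k := k + 1) (by simp [hl]) (φ := φ)
        (by simpa [List.replicate_succ] using h)
      rw [sort_true]
      simpa using this

theorem sort_replicate (p q k : ℕ) (φ : Functional R M) :
    sort (List.replicate p true ++ List.replicate q false) k φ = φ := by
  induction p generalizing k with
  | zero =>
    induction q generalizing k with
    | zero => rfl
    | succ q ih =>
      rw [List.replicate_succ, List.replicate_zero, List.nil_append, sort_false]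
      simpa [List.count_replicate] using ih (k + 1)
  | succ p ih => rw [List.replicate_succ, List.cons_append, sort_true, ih]

end Functionals

/-! ### Closure under all pieces and uniqueness of skein invariants -/

section Functionals

variable {R M : Type*} [CommRing R] [AddCommGroup M] [Module R M] {a z : Rˣ}

/-! ### The span of the standard tangles is closed under drawing pieces -/

/-- The functionals of type `t` that are obtained from standard ones by sorting. -/
def Sorted (ξ : Functional R M) (t : List Bool) (φ : Functional R M) : Prop :=
  t.count true = t.count false ∧ ∃ ψ ∈ standard ξ (t.count true), φ = sort t 0 ψ

/-- The crossings in which an upward strand never passes below a downward strand. -/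
def Good (o b c : Bool) : Prop := b ≠ c → o = b

variable {ξ : Functional R M}

theorem sort_nest_mem_typed {t : List Bool} (hb : t.count true = t.count false)
    {ψ : Functional R M} (hψ : ψ ∈ Typed a z (nestType (t.count true))) :
    sort t 0 ψ ∈ Typed a z t := by
  refine sort_mem_typed (l := []) t rfl ?_
  rw [← hb]
  exact hψ

theorem Sorted.typed (hξ : ξ ∈ Typed a z []) {t : List Bool} {φ : Functional R M}
    (h : Sorted ξ t φ) : φ ∈ Typed a z t := by
  obtain ⟨hb, ψ, hψ, rfl⟩ := h
  exact sort_nest_mem_typed hb (standard_le_typed hξ _ hψ)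

theorem sorted_nestType (n : ℕ) (φ : Functional R M) :
    Sorted ξ (nestType n) φ ↔ φ ∈ standard ξ n := by
  have h1 : (nestType n).count true = n := by simp [List.count_replicate]
  have h2 : (nestType n).count false = n := by simp [List.count_replicate]
  rw [Sorted, h1, h2]
  simp [nestType, sort_replicate]

/-- Crossings that respect the two layers keep them. A crossing of equally oriented strands is
pushed below `sort` into the standard part; one of opposite strands is either absorbed by `sort` or
cancels one of its crossings. -/
theorem Sorted.cross (hξ : ξ ∈ Typed a z []) {o b c : Bool} (hg : Good o b c) {l r : List Bool}
    {φ : Functional R M} (h : Sorted ξ (l ++ [b, c] ++ r) φ) {i : ℕ} (hl : l.length = i) :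
    Sorted ξ (l ++ [c, b] ++ r) (draw i (.cross o b c) φ) := by
  obtain ⟨hb, ψ, hψ, rfl⟩ := h
  subst hl
  -- The sliding lemmas treat positive crossings only; for negative ones the result follows by
  -- cancelling a positive crossing on both sides.
  have same : ∀ (b : Bool) (j : ℕ), (l ++ [b, b] ++ r).count true = (l ++ [b, b] ++ r).count false →
      ψ ∈ standard ξ ((l ++ [b, b] ++ r).count true) →
      (∀ ψ : Functional R M, draw l.length (.cross true b b) (sort (l ++ [b, b] ++ r) 0 ψ) =
        sort (l ++ [b, b] ++ r) 0 (draw j (.cross true b b) ψ)) →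
      (∀ o, ∀ ψ ∈ standard ξ ((l ++ [b, b] ++ r).count true),
        draw j (.cross o b b) ψ ∈ standard ξ ((l ++ [b, b] ++ r).count true)) →
      draw j (.cross true b b) (draw j (.cross false b b) ψ) = ψ →
      Sorted ξ (l ++ [b, b] ++ r)
        (draw l.length (.cross o b b) (sort (l ++ [b, b] ++ r) 0 ψ)) := by
    intro b j hb hψ h1 h2 h3
    refine ⟨hb, draw j (.cross o b b) ψ, h2 o ψ hψ, ?_⟩
    cases o
    · have h4 := sort_nest_mem_typed hb (standard_le_typed hξ _ (h2 false ψ hψ))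
      have h5 := cancel_cross true b b h4 rfl
      rw [h1, h3] at h5
      exact h5
    · exact h1 ψ
  have hψt := standard_le_typed hξ _ hψ
  cases b <;> cases c
  · have hj : l.count false + 2 ≤ (l ++ [false, false] ++ r).count true := by
      rw [hb]; simp
    refine same false _ hb hψ (fun ψ => ?_)
      (fun o ψ hψ => cross_down_mem_standard hξ o hj hψ) ?_
    · have := crossDown_sort l r 0 ψ
      rwa [Nat.zero_add, Nat.zero_add] at this
    · rw [nestType, replicate_split false hj, ← List.append_assoc, ← List.append_assoc] at hψt
      exact cancel_cross false false false hψt (by simp)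
  · obtain rfl : o = false := hg (by simp)
    have hb' : (l ++ [true, false] ++ r).count true = (l ++ [true, false] ++ r).count false := by
      simpa [add_comm, add_left_comm] using hb
    refine ⟨hb', ψ, by simpa using hψ, ?_⟩
    have h1 : sort (l ++ [true, false] ++ r) 0 ψ ∈ Typed a z (l ++ [true, false] ++ r) :=
      sort_nest_mem_typed hb' (by simpa using hψt)
    have := crossUpDown_sort l r 0 ψ
    rw [Nat.zero_add] at this
    rw [← this]
    exact cancel_cross true true false h1 rfl
  · obtain rfl : o = true := hg (by simp)
    refine ⟨by simpa [add_comm, add_left_comm] using hb, ψ, by simpa using hψ, ?_⟩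
    have := crossUpDown_sort l r 0 ψ
    rwa [Nat.zero_add] at this
  · have hj : l.count true + 2 ≤ (l ++ [true, true] ++ r).count true := by
      simp
    refine same true _ hb hψ (fun ψ => ?_)
      (fun o ψ hψ => cross_mem_standard hξ o hj hψ) (cancel_replicate false hj hψt)
    have := posX_sort l r 0 ψ
    rwa [Nat.zero_add, Nat.zero_add] at this

theorem Sorted.moveLeft_mem (hξ : ξ ∈ Typed a z []) {l r : List Bool} {k p : ℕ} (hl : l.length = k)
    {φ : Functional R M} (h : Sorted ξ (l ++ List.replicate p true ++ (false :: r)) φ) :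
    Sorted ξ (l ++ (false :: List.replicate p true) ++ r) (moveLeft k p φ) := by
  induction p generalizing r φ with
  | zero => simpa using h
  | succ p ih =>
    have := Sorted.cross hξ (o := true) (b := true) (c := false) (l := l ++ List.replicate p true)
      (r := r) (fun _ => rfl) (i := k + p) (φ := φ)
      (by simpa [List.replicate_succ'] using h) (by simp [hl])
    have := ih (r := true :: r) (by simpa using this)
    rw [moveLeft_succ, List.replicate_succ']
    simpa using this

theorem Sorted.sort_mem (hξ : ξ ∈ Typed a z []) {l : List Bool} (t : List Bool) {k : ℕ}
    (hl : l.length = k) {φ : Functional R M} (h : Sorted ξ (l ++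
      (List.replicate (t.count true) true ++ List.replicate (t.count false) false)) φ) :
    Sorted ξ (l ++ t) (sort t k φ) := by
  induction t generalizing l k φ with
  | nil => simpa using h
  | cons b t ih =>
    cases b
    · have h1 := Sorted.moveLeft_mem hξ (r := List.replicate (t.count false) false) hl
        (p := t.count true) (φ := φ) (by simpa [List.replicate_succ] using h)
      have := ih (l := l ++ [false]) (k := k + 1) (by simp [hl]) (by simpa using h1)
      rw [sort_false]
      simpa using this
    · have := ih (l := l ++ [true]) (k := k + 1) (by simp [hl]) (φ := φ)
        (by simpa [List.replicate_succ] using h)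
      rw [sort_true]
      simpa using this

/-- The crossings that undo `moveLeft` also have the upward strand on top, so undoing it does not
leave the sorted span. -/
theorem Sorted.exists_moveLeft (hξ : ξ ∈ Typed a z []) {l r : List Bool} {k p : ℕ}
    (hl : l.length = k) {φ : Functional R M}
    (h : Sorted ξ (l ++ (false :: List.replicate p true) ++ r) φ) :
    ∃ χ, Sorted ξ (l ++ List.replicate p true ++ (false :: r)) χ ∧
      φ = moveLeft k p χ := by
  induction p generalizing r φ with
  | zero => exact ⟨φ, by simpa using h, rfl⟩
  | succ p ih =>
    obtain ⟨χ, hχ, rfl⟩ := ih (r := true :: r) (φ := φ) (by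
      rw [List.replicate_succ'] at h; simpa using h)
    have hχ' : Sorted ξ ((l ++ List.replicate p true) ++ [false, true] ++ r) χ := by
      simpa using hχ
    have := hχ'.cross hξ (o := false) (fun _ => rfl) (i := k + p) (by simp [hl])
    refine ⟨draw (k + p) (.cross false false true) χ, ?_, ?_⟩
    · rw [List.replicate_succ']
      simpa using this
    · rw [moveLeft_succ]
      congr 1
      exact (cancel_cross false false true (hχ'.typed hξ) (by simp [hl])).symm

theorem Sorted.exists_sort (hξ : ξ ∈ Typed a z []) {l : List Bool} (t : List Bool) {k : ℕ}
    (hl : l.length = k) {φ : Functional R M} (h : Sorted ξ (l ++ t) φ) :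
    ∃ χ, Sorted ξ (l ++
      (List.replicate (t.count true) true ++ List.replicate (t.count false) false)) χ ∧
      φ = sort t k χ := by
  induction t generalizing l k φ with
  | nil => exact ⟨φ, by simpa using h, rfl⟩
  | cons b t ih =>
    obtain ⟨χ, hχ, rfl⟩ := ih (l := l ++ [b]) (k := k + 1) (by simp [hl]) (φ := φ)
      (by simpa using h)
    cases b
    · obtain ⟨χ', hχ', rfl⟩ := Sorted.exists_moveLeft hξ (l := l)
        (r := List.replicate (t.count false) false) (p := t.count true) (φ := χ) hl
        (by simpa using hχ)
      exact ⟨χ', by simpa [List.replicate_succ] using hχ', rfl⟩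
    · exact ⟨χ, by simpa [List.replicate_succ] using hχ, rfl⟩

/-! ### Minima -/

/-- A strand is led across a minimum, above it if it is upward and below it if it is downward. With
this choice both crossings are `Good`, so the position of a minimum is irrelevant for being
`Sorted`. -/
theorem cup_right_eq (s b : Bool) {l r : List Bool} {φ : Functional R M}
    (h : φ ∈ Typed a z (l ++ [s] ++ r)) {i : ℕ} (hl : l.length = i) :
    draw (i + 1) (.cup b) φ = draw i (.cross (!s) b s)
      (draw (i + 1) (.cross (!s) (!b) s) (draw i (.cup b) φ)) := by
  have h1 : draw (i + 1) (.cup b) φ ∈ Typed a z (l ++ [s, b] ++ ((!b) :: r)) := by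
    have := draw_mem_typed (i := i + 1) (p := .cup b) h (l ++ [s]) r (by simp [hl])
      (by simp [Piece.dom])
    simpa [Piece.cod] using this
  rw [← slide_cup, cancel_cross s s b h1 hl]

theorem cup_left_eq (s b : Bool) {l r : List Bool} {φ : Functional R M}
    (h : φ ∈ Typed a z (l ++ [s] ++ r)) {i : ℕ} (hl : l.length = i) :
    draw i (.cup b) φ = draw (i + 1) (.cross s s (!b))
      (draw i (.cross s s b) (draw (i + 1) (.cup b) φ)) := by
  have h0 : draw i (.cup b) φ ∈ Typed a z ((l ++ [b]) ++ [!b, s] ++ r) := by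
    have := draw_mem_typed (i := i) (p := .cup b) h l (s :: r) hl (by simp [Piece.dom])
    simpa [Piece.cod] using this
  have := cancel_cross (!s) (!b) s h0 (i := i + 1) (by simp [hl])
  rw [Bool.not_not] at this
  rw [slide_cup, this]

theorem good_self (s c : Bool) : Good s s c := fun _ => rfl

theorem good_not (s c : Bool) : Good (!s) c s := by
  cases s <;> cases c <;> simp [Good]

theorem sorted_cup_iff (hξ : ξ ∈ Typed a z []) (s b : Bool) {l r : List Bool}
    {φ : Functional R M} (h : φ ∈ Typed a z (l ++ [s] ++ r)) {i : ℕ} (hl : l.length = i) :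
    Sorted ξ (l ++ [s] ++ [b, !b] ++ r) (draw (i + 1) (.cup b) φ) ↔
      Sorted ξ (l ++ [b, !b] ++ ([s] ++ r)) (draw i (.cup b) φ) := by
  constructor
  · intro H
    rw [cup_left_eq s b h hl]
    have := Sorted.cross hξ (good_self s b) (l := l) (r := (!b) :: r) (by simpa using H) hl
    have := Sorted.cross hξ (good_self s (!b)) (l := l ++ [b]) (r := r) (i := i + 1)
      (by simpa using this) (by simp [hl])
    simpa using this
  · intro H
    rw [cup_right_eq s b h hl]
    have := Sorted.cross hξ (good_not s (!b)) (l := l ++ [b]) (r := r) (i := i + 1)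
      (by simpa using H) (by simp [hl])
    have := Sorted.cross hξ (good_not s b) (l := l) (r := (!b) :: r) (by simpa using this) hl
    simpa using this

theorem sorted_cup_zero_iff (hξ : ξ ∈ Typed a z []) (b : Bool) (l r : List Bool)
    {φ : Functional R M} (h : φ ∈ Typed a z (l ++ r)) {i : ℕ} (hl : l.length = i) :
    Sorted ξ (l ++ [b, !b] ++ r) (draw i (.cup b) φ) ↔
      Sorted ξ ([b, !b] ++ (l ++ r)) (draw 0 (.cup b) φ) := by
  induction l using List.reverseRecOn generalizing r i with
  | nil => subst hl; simp
  | append_singleton l s ih =>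
    subst hl
    rw [List.length_append, List.length_singleton,
      sorted_cup_iff hξ s b h rfl, ih _ (by simpa using h) rfl, List.append_assoc]

/-- At the far left the minimum commutes with the whole of `sort`. Below `sort` it is then brought
from the far left to the middle, where it is a new innermost arc. -/
theorem Sorted.cup (hξ : ξ ∈ Typed a z []) (b : Bool) (l r : List Bool)
    {φ : Functional R M} (h : Sorted ξ (l ++ r) φ) {i : ℕ} (hl : l.length = i) :
    Sorted ξ (l ++ [b, !b] ++ r) (draw i (.cup b) φ) := by
  rw [sorted_cup_zero_iff hξ b l r (h.typed hξ) hl]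
  generalize l ++ r = t at h
  obtain ⟨hb, ψ, hψ, rfl⟩ := h
  have hψt := standard_le_typed hξ _ hψ
  rw [cup_sort _ _ le_rfl]
  refine Sorted.sort_mem hξ t rfl ?_
  rw [← hb]
  generalize t.count true = n at hψ hψt
  rw [← sorted_cup_zero_iff hξ b _ _ hψt List.length_replicate]
  have htrue : Sorted ξ (List.replicate n true ++ [true, false] ++ List.replicate n false)
      (draw n (.cup true) ψ) := by
    rw [← nestType_succ]
    exact (sorted_nestType _ _).2 (cup_mem_standard hψ)
  -- A minimum with the other orientation is the standard one followed by a crossing, by the first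
  -- Reidemeister move.
  cases b
  · have := Sorted.cross hξ (good_self true false) htrue (i := n) (by simp)
    rwa [show draw n (.cross true true false) (draw n (.cup true) ψ) = draw n (.cup false) ψ from
      twist_cup true true n ψ] at this
  · exact htrue

/-! ### Maxima -/

/-- Drawing a maximum preserves the span of the standard tangles. -/
def CapClosed (ξ : Functional R M) (b : Bool) (l r : List Bool) : Prop :=
  ∀ φ, Sorted ξ (l ++ [b, !b] ++ r) φ → Sorted ξ (l ++ r) (draw l.length (.cap b) φ)

theorem capClosed_step (hξ : ξ ∈ Typed a z []) (b s : Bool) (l r : List Bool) :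
    CapClosed ξ b (l ++ [s]) r ↔ CapClosed ξ b l ([s] ++ r) := by
  constructor
  · intro H φ hφ
    have hφ' : Sorted ξ ((l ++ [b]) ++ [!b, s] ++ r) φ := by simpa using hφ
    have h1 := hφ'.cross hξ (good_not s (!b)) (i := l.length + 1) (by simp)
    have h2 := Sorted.cross hξ (good_not s b) (l := l) (r := (!b) :: r) (by simpa using h1) rfl
    have h3 := H _ (by simpa using h2)
    rw [List.length_append, List.length_singleton, slide_cap, Bool.not_not] at h3
    have := cancel_cross (!s) (!b) s (hφ'.typed hξ) (i := l.length + 1) (by simp)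
    rw [Bool.not_not] at this
    rw [this] at h3
    simpa using h3
  · intro H φ hφ
    have hφ' : Sorted ξ (l ++ [s, b] ++ ((!b) :: r)) φ := by simpa using hφ
    have h1 := hφ'.cross hξ (good_self s b) rfl
    have h2 := Sorted.cross hξ (good_self s (!b)) (l := l ++ [b]) (r := r) (i := l.length + 1)
      (by simpa using h1) (by simp)
    have h3 := H _ (by simpa using h2)
    have e := slide_cap (!s) s b l.length (draw l.length (.cross s s b) φ)
    rw [Bool.not_not] at e
    rw [← e, cancel_cross s s b (hφ'.typed hξ) rfl] at h3
    simpa using h3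

theorem capClosed_zero_iff (hξ : ξ ∈ Typed a z []) (b : Bool) (l r : List Bool) :
    CapClosed ξ b l r ↔ CapClosed ξ b [] (l ++ r) := by
  induction l using List.reverseRecOn generalizing r with
  | nil => rfl
  | append_singleton l s ih => rw [capClosed_step hξ, ih, List.append_assoc]

theorem capClosed_nest (hξ : ξ ∈ Typed a z []) (b : Bool) (n : ℕ) :
    CapClosed ξ b (List.replicate n true) (List.replicate n false) := by
  have htrue : CapClosed ξ true (List.replicate n true) (List.replicate n false) := by
    intro φ hφ
    rw [Bool.not_true, ← nestType_succ, sorted_nestType] at hφ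
    rw [List.length_replicate]
    exact (sorted_nestType _ _).2 (cap_mem_standard hξ hφ)
  cases b
  · intro φ hφ
    have := htrue _ (hφ.cross hξ (good_not true false) rfl)
    rwa [show ∀ i, draw i (.cap true) (draw i (.cross (!true) false true) φ) =
      draw i (.cap false) φ from fun i => twist_cap false false i φ] at this
  · exact htrue

/-- The maximum is moved to the far left, `sort` is undone on the remaining strands so that the
maximum can be drawn below it, and there it is moved to the middle, where `cap_mem_standard`
applies. -/
theorem Sorted.cap (hξ : ξ ∈ Typed a z []) (b : Bool) (l r : List Bool)
    {φ : Functional R M} (h : Sorted ξ (l ++ [b, !b] ++ r) φ) {i : ℕ} (hl : l.length = i) :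
    Sorted ξ (l ++ r) (draw i (.cap b) φ) := by
  subst hl
  revert φ
  change CapClosed ξ b l r
  rw [capClosed_zero_iff hξ]
  generalize l ++ r = t
  intro φ hφ
  have hb : t.count true = t.count false := by
    have := hφ.1
    cases b <;> simpa using this
  obtain ⟨χ, hχ, rfl⟩ := Sorted.exists_sort hξ (l := [] ++ [b, !b]) t rfl hφ
  have h1 := (capClosed_zero_iff hξ b _ _).1 (capClosed_nest hξ b (t.count true)) χ
    (by rw [← hb] at hχ; exact hχ)
  have e := cap_sort b t (le_refl 0) χ
  rw [List.length_nil] at h1 ⊢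
  change Sorted ξ t (draw 0 (.cap b) (sort t (0 + 2) χ))
  rw [e]
  refine Sorted.sort_mem hξ (l := []) t rfl ?_
  rw [← hb]
  exact h1

/-! ### The spanning theorem -/

/-- A crossing with the upward strand underneath is turned, with the help of a minimum and a
maximum, into a crossing of two upward strands, for which being `Good` is no condition. This relies
on closure under minima and maxima, whose proofs use only good crossings. -/
theorem Sorted.any_cross (hξ : ξ ∈ Typed a z []) (o b c : Bool) (l r : List Bool)
    {φ : Functional R M} (h : Sorted ξ (l ++ [b, c] ++ r) φ) {i : ℕ} (hl : l.length = i) :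
    Sorted ξ (l ++ [c, b] ++ r) (draw i (.cross o b c) φ) := by
  by_cases hg : Good o b c
  · exact h.cross hξ hg hl
  have ht : draw i (.cross o b c) φ ∈ Typed a z (l ++ [c, b] ++ r) :=
    draw_mem_typed (i := i) (p := .cross o b c) (h.typed hξ) l r hl rfl
  cases b <;> cases c
  · exact absurd (fun h => absurd rfl h) hg
  · have h1 := Sorted.cup hξ true (l ++ [false, true]) r h (i := i + 2) (by simp [hl])
    have h2 := Sorted.cross hξ (o := !o) (b := true) (c := true) (l := l ++ [false])
      (r := false :: r) (fun h => absurd rfl h) (i := i + 1) (by simpa using h1) (by simp [hl])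
    have h3 := Sorted.cap hξ false l (true :: false :: r) (by simpa using h2) hl
    have e := slide_cap o true false i (draw (i + 2) (.cup true) φ)
    rw [Bool.not_false] at e
    rw [← e, ← cup_cross _ _ _ _ le_rfl] at h3
    have := zigzag_right false (l := l ++ [true]) (r := r) (by simpa using ht) (i := i + 1)
      (by simp [hl])
    rw [Bool.not_false] at this
    rw [this] at h3
    simpa using h3
  · have h1 := Sorted.cup hξ false l _ (by simpa using h) hl
    have h2 := Sorted.cross hξ (o := !o) (b := true) (c := true) (l := l ++ [false])
      (r := false :: r) (fun h => absurd rfl h) (i := i + 1) (by simpa using h1) (by simp [hl])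
    have h3 := Sorted.cap hξ true (l ++ [false, true]) r (i := i + 2) (by simpa using h2)
      (by simp [hl])
    have e := slide_cap (!o) true true (i + 1) (draw i (.cup false) φ)
    rw [Bool.not_not, Bool.not_true] at e
    rw [e, cross_cup _ _ _ _ le_rfl] at h3
    have := zigzag_left false (l := l) (r := true :: r) (by simpa using ht) hl
    rw [Bool.not_false] at this
    rw [this] at h3
    simpa using h3
  · exact absurd (fun h => absurd rfl h) hg

theorem Sorted.exists_valueAt_eq (hξ : ξ ∈ Typed a z []) {w : List PosPiece} {t : List Bool}
    (hw : Runs t w []) {φ : Functional R M} (h : Sorted ξ t φ) :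
    ∃ c c' : R, valueAt w φ = c • valueAt [] ξ + c' • valueAt [] (circle ξ) := by
  induction w generalizing t φ with
  | nil =>
    obtain rfl : t = [] := hw
    have h0 : φ ∈ standard ξ 0 := (sorted_nestType 0 φ).1 h
    have : standard ξ 0 ≤ Submodule.span R {ξ, circle ξ} := by
      refine Submodule.span_le.2 ?_
      rintro ψ ⟨h, hh, H⟩
      obtain rfl : h = [] := List.eq_nil_iff_forall_not_mem.2 fun i hi => by
        have := hh i hi; omega
      rcases H with rfl | rfl
      · exact Submodule.subset_span (by simp)
      · exact Submodule.subset_span (by simp)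
    obtain ⟨c, c', e⟩ := Submodule.mem_span_pair.1 (this h0)
    exact ⟨c, c', by rw [← e]; simp⟩
  | cons x w ih =>
    obtain ⟨i, p⟩ := x
    obtain ⟨l, r, hl, rfl, hw⟩ := hw
    refine ih hw (φ := draw i p φ) ?_
    cases p with
    | cup b => simpa [Piece.cod] using Sorted.cup hξ b l r (by simpa [Piece.dom] using h) hl
    | cap b => simpa [Piece.cod] using Sorted.cap hξ b l r h hl
    | cross o b c => exact Sorted.any_cross hξ o b c l r h hl

/-- A link invariant that satisfies the skein relation is determined by its value on the trivial
knot. -/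
theorem exists_smul_trivialKnot {f : Link → M}
    (hf : ∀ Lp Lm L0 : Link, SkeinTriple Lp Lm L0 →
      (a : R) • f Lp + ((a⁻¹ : Rˣ) : R) • f Lm = (z : R) • f L0) (L : Link) :
    ∃ c : R, f L = c • f trivialKnot := by
  obtain ⟨D, rfl⟩ := Quotient.exists_rep L
  have hs : start R f ∈ Typed a z [] := start_typed hf
  have h0 : Sorted (start R f) [] (start R f) :=
    (sorted_nestType 0 _).2 (Submodule.subset_span ⟨[], by simp, Or.inl rfl⟩)
  obtain ⟨c, c', e⟩ := h0.exists_valueAt_eq hs D.closed.runs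
  refine ⟨c', ?_⟩
  have e1 : valueAt (D.word.map Slice.pos) (start R f) = f D.link := evalWord_diagram f D
  -- The empty link is excluded, so the empty word has the default value `0`; only the multiple of
  -- the circle survives.
  have e2 : valueAt [] (start R f) = 0 := evalWord_nil f
  have e3 : valueAt [] (circle (start R f)) = f trivialKnot := evalWord_diagram f trivialKnotDiagram
  rw [e1, e2, e3, smul_zero, zero_add] at e
  exact e

end Functionals

/-! ### A state model -/

/-- The parameters of the state model with labels `0, …, n - 1` at `a` and `z = s + s⁻¹`. -/
structure StateModel (n : ℕ) where
  a : ℂ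
  s : ℂ
  τ : ℂ
  μ : Fin n → ℂ
  a_ne : a ≠ 0
  s_ne : s ≠ 0
  μ_ne : ∀ i, μ i ≠ 0
  τ_sq : τ * τ = -1
  sum_lt : ∀ i, ∑ k, (if k < i then (s + s⁻¹) * μ k else 0) = a⁻¹ - s⁻¹ * μ i
  sum_gt : ∀ i, ∑ k, (if i < k then (s + s⁻¹) * μ k else 0) = a - s * μ i
  sum_inv_lt : ∀ i, ∑ k, (if k < i then (s + s⁻¹) * (μ k)⁻¹ else 0) = a - s * (μ i)⁻¹
  sum_inv_gt : ∀ i, ∑ k, (if i < k then (s + s⁻¹) * (μ k)⁻¹ else 0) = a⁻¹ - s⁻¹ * (μ i)⁻¹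

/-! ### Vertex weights and the first Reidemeister move -/

namespace StateModel

variable {n : ℕ} (S : StateModel n)

/-- The weight of the state where the labels of the two strands cross. -/
noncomputable def straight (o : Bool) (i j : Fin n) : ℂ :=
  if o then S.a⁻¹ * (if i = j then S.s else S.τ) else S.a * (if i = j then S.s⁻¹ else -S.τ)

/-- The weight of the state where the labels follow the smoothing of the crossing. -/
noncomputable def splice (o : Bool) (i j : Fin n) : ℂ :=
  if o then (if i < j then S.a⁻¹ * (S.s + S.s⁻¹) else 0)
  else (if j < i then S.a * (S.s + S.s⁻¹) else 0)

/-- The weights of the crossing of two upward strands. -/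
noncomputable def base (o : Bool) (i j k m : Fin n) : ℂ :=
  (if i = m ∧ j = k then S.straight o i j else 0) + (if i = k ∧ j = m then S.splice o i j else 0)

/-- The weights of a crossing with bottom labels `i, j` and top labels `k, m`. -/
noncomputable def weight (o : Bool) : Bool → Bool → Fin n → Fin n → Fin n → Fin n → ℂ
  | true, true, i, j, k, m => S.base o i j k m
  | false, false, i, j, k, m => S.base o m k j i
  | true, false, i, j, k, m => S.base (!o) k i m j
  | false, true, i, j, k, m => S.μ m * (S.μ i)⁻¹ * S.base (!o) j m i k

/-- The weights of a minimum. -/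
noncomputable def cupWeight (b : Bool) (i : Fin n) : ℂ := if b then S.μ i else 1

/-- The weights of a maximum. -/
noncomputable def capWeight (b : Bool) (i : Fin n) : ℂ := if b then 1 else (S.μ i)⁻¹

/-- A weight vanishes unless the top labels are the bottom labels in some order. The factors `μ` can
therefore be carried across a crossing when strands slide over minima and maxima. -/
theorem base_balance (o : Bool) (i j k m : Fin n) :
    S.μ i * S.μ j * S.base o i j k m = S.μ k * S.μ m * S.base o i j k m := by
  unfold base
  by_cases h1 : i = m ∧ j = k
  · obtain ⟨rfl, rfl⟩ := h1
    rw [mul_comm (S.μ i)]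
  · by_cases h2 : i = k ∧ j = m
    · obtain ⟨rfl, rfl⟩ := h2
      rfl
    · simp [h1, h2]

theorem weight_slide_cup (o s b : Bool) (p i k m : Fin n) :
    S.cupWeight b i * S.weight o s b p i k m =
      S.cupWeight b k * S.weight (!o) (!b) s k p m i := by
  have hp := S.μ_ne p
  have hk := S.μ_ne k
  cases s <;> cases b <;> simp only [cupWeight, weight, Bool.not_true, Bool.not_false,
    Bool.not_not, Bool.false_eq_true, if_true, if_false]
  · have := S.base_balance (!o) i m p k
    field_simp
    linear_combination this
  · field_simp

theorem weight_slide_cap (o s b : Bool) (i p k j : Fin n) :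
    S.capWeight b j * S.weight o b s i p k j =
      S.capWeight b i * S.weight (!o) s (!b) p j i k := by
  have hp := S.μ_ne p
  have hi := S.μ_ne i
  have hj := S.μ_ne j
  cases s <;> cases b <;> simp only [capWeight, weight, Bool.not_true, Bool.not_false,
    Bool.not_not, Bool.false_eq_true, if_true, if_false]
  · have := S.base_balance o j k p i
    field_simp
    linear_combination -this
  · field_simp

theorem cup_mul_cap (b : Bool) (i : Fin n) : S.cupWeight b i * S.capWeight (!b) i = 1 := by
  cases b <;> simp [cupWeight, capWeight, S.μ_ne i]

/-- The content of the first Reidemeister move. The four sum conditions in `StateModel` are what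
this lemma and `sum_splice_inv` require for both kinds of crossing. -/
theorem sum_splice (o : Bool) (i : Fin n) :
    S.μ i * S.straight o i i + ∑ k, S.μ k * S.splice o i k = 1 := by
  have ha := S.a_ne
  cases o
  · have := S.sum_lt i
    simp only [straight, splice, Bool.false_eq_true, if_true, if_false]
    have e : ∀ k, S.μ k * (if k < i then S.a * (S.s + S.s⁻¹) else 0) =
        S.a * (if k < i then (S.s + S.s⁻¹) * S.μ k else 0) := fun k => by
      split_ifs <;> ring
    simp only [e, ← Finset.mul_sum, this]
    field_simp
    simp
  · have := S.sum_gt i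
    simp only [straight, splice, if_true]
    have e : ∀ k, S.μ k * (if i < k then S.a⁻¹ * (S.s + S.s⁻¹) else 0) =
        S.a⁻¹ * (if i < k then (S.s + S.s⁻¹) * S.μ k else 0) := fun k => by
      split_ifs <;> ring
    simp only [e, ← Finset.mul_sum, this]
    field_simp
    simp

theorem sum_splice_inv (o : Bool) (i : Fin n) :
    (S.μ i)⁻¹ * S.straight o i i + ∑ k, (S.μ k)⁻¹ * S.splice o k i = 1 := by
  have ha := S.a_ne
  cases o
  · have := S.sum_inv_gt i
    simp only [straight, splice, Bool.false_eq_true, if_true, if_false]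
    have e : ∀ k, (S.μ k)⁻¹ * (if i < k then S.a * (S.s + S.s⁻¹) else 0) =
        S.a * (if i < k then (S.s + S.s⁻¹) * (S.μ k)⁻¹ else 0) := fun k => by
      split_ifs <;> ring
    simp only [e, ← Finset.mul_sum, this, mul_sub]
    rw [mul_inv_cancel₀ ha]
    ring
  · have := S.sum_inv_lt i
    simp only [straight, splice, if_true]
    have e : ∀ k, (S.μ k)⁻¹ * (if k < i then S.a⁻¹ * (S.s + S.s⁻¹) else 0) =
        S.a⁻¹ * (if k < i then (S.s + S.s⁻¹) * (S.μ k)⁻¹ else 0) := fun k => by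
      split_ifs <;> ring
    simp only [e, ← Finset.mul_sum, this, mul_sub]
    rw [inv_mul_cancel₀ ha]
    ring

theorem sum_base_cup (o : Bool) (k m : Fin n) :
    ∑ i, S.μ i * S.base o k i m i = if k = m then 1 else 0 := by
  by_cases h : k = m
  · subst h
    rw [if_pos rfl, ← S.sum_splice o k]
    simp only [base, mul_add, Finset.sum_add_distrib]
    congr 1
    · rw [Finset.sum_eq_single k (fun i _ hi => by simp [hi]) (by simp)]
      simp
  · rw [if_neg h]
    refine Finset.sum_eq_zero fun i _ => ?_
    have h1 : ¬ (k = i ∧ i = m) := fun ⟨h1, h2⟩ => h (h1.trans h2)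
    simp [base, h, h1]

theorem sum_base_cap (o : Bool) (k m : Fin n) :
    ∑ i, (S.μ i)⁻¹ * S.base o i k i m = if k = m then 1 else 0 := by
  by_cases h : k = m
  · subst h
    rw [if_pos rfl, ← S.sum_splice_inv o k]
    simp only [base, mul_add, Finset.sum_add_distrib]
    congr 1
    · rw [Finset.sum_eq_single k (fun i _ hi => by simp [hi]) (by simp)]
      simp
  · rw [if_neg h]
    refine Finset.sum_eq_zero fun i _ => ?_
    have h1 : ¬ (i = m ∧ k = i) := fun ⟨h1, h2⟩ => h (h2.trans h1)
    simp [base, h, h1]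

theorem weight_twist_cup (o b : Bool) (k m : Fin n) :
    ∑ i, S.cupWeight b i * S.weight o b (!b) i i k m =
      if k = m then S.cupWeight (!b) k else 0 := by
  have hm := S.μ_ne m
  cases b
  · simp only [cupWeight, weight, Bool.not_false, Bool.false_eq_true, if_false, if_true, one_mul,
      mul_assoc, ← Finset.mul_sum, S.sum_base_cap]
    by_cases h : m = k
    · simp [h]
    · simp [h, Ne.symm h]
  · simp only [cupWeight, weight, Bool.not_true, Bool.false_eq_true, if_false, if_true,
      S.sum_base_cup]

theorem weight_twist_cap (o b : Bool) (i j : Fin n) :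
    ∑ k, S.weight o b (!b) i j k k * S.capWeight (!b) k =
      if i = j then S.capWeight b i else 0 := by
  cases b
  · simp only [capWeight, weight, Bool.not_false, Bool.false_eq_true, if_false, if_true, mul_one]
    have := S.sum_base_cup (!o) j i
    simp only [mul_right_comm _ (S.μ i)⁻¹, ← Finset.sum_mul, this]
    by_cases h : i = j
    · simp [h]
    · simp [h, Ne.symm h]
  · simp only [capWeight, weight, Bool.not_true, Bool.false_eq_true, if_false, if_true]
    simp only [mul_comm _ (S.μ _)⁻¹, S.sum_base_cap]

theorem weight_skein (i j k m : Fin n) :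
    S.a * S.weight true true true i j k m + S.a⁻¹ * S.weight false true true i j k m =
      (S.s + S.s⁻¹) * if i = k ∧ j = m then 1 else 0 := by
  have ha := S.a_ne
  simp only [weight, base, straight, splice, Bool.false_eq_true, if_false, if_true]
  rcases lt_trichotomy i j with h | rfl | h
  · by_cases h1 : i = m ∧ j = k
    · obtain ⟨rfl, rfl⟩ := h1
      simp [h.ne, h.ne']
      field_simp
      ring
    · by_cases h2 : i = k ∧ j = m
      · obtain ⟨rfl, rfl⟩ := h2
        simp [h, h.not_gt, h.ne]
        field_simp
      · simp [h1, h2]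
  · by_cases h2 : i = k ∧ i = m
    · obtain ⟨rfl, rfl⟩ := h2
      simp
      field_simp
    · have h1 : ¬ (i = m ∧ i = k) := fun h => h2 h.symm
      simp [h1, h2]
  · by_cases h1 : i = m ∧ j = k
    · obtain ⟨rfl, rfl⟩ := h1
      simp [h.ne, h.ne']
      field_simp
      ring
    · by_cases h2 : i = k ∧ j = m
      · obtain ⟨rfl, rfl⟩ := h2
        simp [h, h.not_gt, h.ne']
        field_simp
      · simp [h1, h2]

end StateModel

namespace StateModel

variable {n : ℕ} (S : StateModel n)

/-! ### The second Reidemeister move -/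

theorem sum_base (o : Bool) (i j : Fin n) (F : Fin n → Fin n → ℂ) :
    ∑ k, ∑ m, S.base o i j k m * F k m = S.straight o i j * F j i + S.splice o i j * F i j := by
  simp only [base, add_mul, Finset.sum_add_distrib, ite_and, ite_mul, zero_mul]
  congr 1
  · rw [Finset.sum_eq_single j (fun k _ hk => by simp [hk.symm]) (by simp)]
    simp
  · rw [Finset.sum_eq_single i (fun k _ hk => by simp [hk.symm]) (by simp)]
    simp

theorem sum_base_up_down (o : Bool) (i j : Fin n) (F : Fin n → Fin n → ℂ) :
    ∑ k, ∑ m, S.base o k i m j * F k m =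
      S.straight o j i * F j i + if i = j then ∑ k, S.splice o k i * F k k else 0 := by
  simp only [base, add_mul, Finset.sum_add_distrib, ite_mul, zero_mul]
  congr 1
  · rw [Finset.sum_eq_single j (fun k _ hk => by simp [hk]) (by simp)]
    rw [Finset.sum_eq_single i (fun k _ hk => by simp [hk.symm]) (by simp)]
    simp
  · by_cases h : i = j
    · subst h
      simp
    · simp [h]

theorem sum_base_down_up (o : Bool) (i j : Fin n) (F : Fin n → Fin n → ℂ) :
    ∑ k, ∑ m, S.base o j m i k * F k m =
      S.straight o j i * F j i + if i = j then ∑ k, S.splice o i k * F k k else 0 := by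
  simp only [base, add_mul, Finset.sum_add_distrib, ite_mul, zero_mul]
  congr 1
  · rw [Finset.sum_eq_single j (fun k _ hk => by simp [hk.symm]) (by simp)]
    rw [Finset.sum_eq_single i (fun k _ hk => by simp [hk]) (by simp)]
    simp
  · by_cases h : i = j
    · subst h
      simp only [true_and, if_true]
      refine Finset.sum_congr rfl fun k _ => ?_
      simp
    · simp [h, Ne.symm h]

theorem sum_between_aux {x y : Fin n} (h : x < y) (f : Fin n → ℂ) :
    ∑ k, (if x < k ∧ k < y then f k else 0) = (∑ k, if x < k then f k else 0) - f y -
      ∑ k, if y < k then f k else 0 := by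
  have e : f y = ∑ k, if k = y then f k else 0 := by simp
  rw [e, ← Finset.sum_sub_distrib, ← Finset.sum_sub_distrib]
  refine Finset.sum_congr rfl fun k _ => ?_
  rcases lt_trichotomy k y with h1 | rfl | h1
  · simp [h1, h1.ne, h1.not_gt]
  · simp [h]
  · simp [h1, h1.ne', h1.not_gt, h.trans h1]

/-- Subtracting two of the sum conditions gives sums over the labels strictly between two given
ones; these occur in the second Reidemeister move for strands of opposite orientation. -/
theorem sum_between {x y : Fin n} (h : x < y) :
    ∑ k, (if x < k ∧ k < y then (S.s + S.s⁻¹) * S.μ k else 0) =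
      -(S.s⁻¹ * S.μ y) - S.s * S.μ x := by
  rw [sum_between_aux h, S.sum_gt, S.sum_gt]
  ring

theorem sum_inv_between {x y : Fin n} (h : x < y) :
    ∑ k, (if x < k ∧ k < y then (S.s + S.s⁻¹) * (S.μ k)⁻¹ else 0) =
      -(S.s * (S.μ y)⁻¹) - S.s⁻¹ * (S.μ x)⁻¹ := by
  rw [sum_between_aux h, S.sum_inv_gt, S.sum_inv_gt]
  ring

/-- For antiparallel strands a label can change from `i` to `q` by smoothing the lower crossing, the
upper one, or both, with an intermediate label `k` in the last case. The three contributions cancel.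
-/
theorem splice_up_down (o : Bool) (i q : Fin n) :
    (S.μ i)⁻¹ * S.straight (!o) i i * S.splice o i q +
      (S.μ q)⁻¹ * S.splice (!o) q i * S.straight o q q +
      ∑ k, S.splice (!o) k i * ((S.μ k)⁻¹ * S.splice o k q) = 0 := by
  have ha := S.a_ne
  cases o
  · have e : ∀ k, S.splice true k i * ((S.μ k)⁻¹ * S.splice false k q) =
        (S.s + S.s⁻¹) * (if q < k ∧ k < i then (S.s + S.s⁻¹) * (S.μ k)⁻¹ else 0) := by
      intro k
      by_cases h1 : q < k <;> by_cases h2 : k < i <;> simp [splice, h1, h2]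
      field_simp
    simp only [Bool.not_false, e, ← Finset.mul_sum]
    rcases lt_or_ge q i with h | h
    · rw [S.sum_inv_between h]
      simp only [straight, splice, h, Bool.false_eq_true, if_true, if_false]
      field_simp
      ring
    · have : ∀ k, ¬ (q < k ∧ k < i) := fun k hk => (hk.1.trans hk.2).not_ge h
      simp [splice, this, h.not_gt]
  · have e : ∀ k, S.splice false k i * ((S.μ k)⁻¹ * S.splice true k q) =
        (S.s + S.s⁻¹) * (if i < k ∧ k < q then (S.s + S.s⁻¹) * (S.μ k)⁻¹ else 0) := by
      intro k
      by_cases h1 : i < k <;> by_cases h2 : k < q <;> simp [splice, h1, h2]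
      field_simp
    simp only [Bool.not_true, e, ← Finset.mul_sum]
    rcases lt_or_ge i q with h | h
    · rw [S.sum_inv_between h]
      simp only [straight, splice, h, Bool.false_eq_true, if_true, if_false]
      field_simp
      ring
    · have : ∀ k, ¬ (i < k ∧ k < q) := fun k hk => (hk.1.trans hk.2).not_ge h
      simp [splice, this, h.not_gt]

theorem splice_down_up (o : Bool) (i p : Fin n) :
    S.μ i * S.straight (!o) i i * S.splice o p i +
      S.μ p * S.splice (!o) i p * S.straight o p p +
      ∑ k, S.splice (!o) i k * (S.μ k * S.splice o p k) = 0 := by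
  have ha := S.a_ne
  cases o
  · have e : ∀ k, S.splice true i k * (S.μ k * S.splice false p k) =
        (S.s + S.s⁻¹) * (if i < k ∧ k < p then (S.s + S.s⁻¹) * S.μ k else 0) := by
      intro k
      by_cases h1 : i < k <;> by_cases h2 : k < p <;> simp [splice, h1, h2]
      field_simp
    simp only [Bool.not_false, e, ← Finset.mul_sum]
    rcases lt_or_ge i p with h | h
    · rw [S.sum_between h]
      simp only [straight, splice, h, Bool.false_eq_true, if_true, if_false]
      field_simp
      ring
    · have : ∀ k, ¬ (i < k ∧ k < p) := fun k hk => (hk.1.trans hk.2).not_ge h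
      simp [splice, this, h.not_gt]
  · have e : ∀ k, S.splice false i k * (S.μ k * S.splice true p k) =
        (S.s + S.s⁻¹) * (if p < k ∧ k < i then (S.s + S.s⁻¹) * S.μ k else 0) := by
      intro k
      by_cases h1 : p < k <;> by_cases h2 : k < i <;> simp [splice, h1, h2]
      field_simp
    simp only [Bool.not_true, e, ← Finset.mul_sum]
    rcases lt_or_ge p i with h | h
    · rw [S.sum_between h]
      simp only [straight, splice, h, Bool.false_eq_true, if_true, if_false]
      field_simp
      ring
    · have : ∀ k, ¬ (p < k ∧ k < i) := fun k hk => (hk.1.trans hk.2).not_ge h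
      simp [splice, this, h.not_gt]

/-- For different labels the product is `-τ ^ 2`, which is the reason for requiring `τ ^ 2 = -1`. -/
theorem straight_mul_straight (o : Bool) (i j : Fin n) :
    S.straight (!o) j i * S.straight o i j = 1 := by
  have ha := S.a_ne
  have hs := S.s_ne
  have hτ := S.τ_sq
  cases o <;> by_cases h : i = j
  · subst h; simp [straight]; field_simp
  · simp [straight, h, Ne.symm h]; field_simp; linear_combination -hτ
  · subst h; simp [straight]; field_simp
  · simp [straight, h, Ne.symm h]; field_simp; linear_combination -hτ

theorem base_inverse (o : Bool) (i j p q : Fin n) :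
    ∑ k, ∑ m, S.base o i j k m * S.base (!o) k m p q = if i = p ∧ j = q then 1 else 0 := by
  rw [S.sum_base]
  have ha := S.a_ne
  have hs := S.s_ne
  have h0 := S.straight_mul_straight o i j
  have hsp : S.splice o i j * S.splice (!o) i j = 0 := by
    cases o <;> rcases lt_trichotomy i j with h | h | h <;> simp [splice, h, h.not_gt]
  have hx : S.straight o i j * S.splice (!o) j i + S.splice o i j * S.straight (!o) i j = 0 := by
    cases o <;> rcases lt_trichotomy i j with h | rfl | h <;>
      simp_all [splice, straight, not_lt_of_gt, ne_of_lt, ne_of_gt] <;> field_simp <;> simp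
  unfold base
  simp only [mul_add]
  by_cases h1 : i = p ∧ j = q
  · obtain ⟨rfl, rfl⟩ := h1
    by_cases h2 : i = j
    · subst h2
      simp
      linear_combination h0 + hx + hsp
    · simp [h2, Ne.symm h2]
      linear_combination h0 + hsp
  · by_cases h2 : i = q ∧ j = p
    · obtain ⟨rfl, rfl⟩ := h2
      have h3 : i ≠ j := fun h => h1 ⟨h, h.symm⟩
      simp [h3, h3.symm]
      exact hx
    · have h3 : ¬ (j = q ∧ i = p) := fun h => h1 h.symm
      have h4 : ¬ (j = p ∧ i = q) := fun h => h2 h.symm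
      simp [h1, h2, h3, h4]

/-- Strands of equal orientation reduce to `base_inverse`. For opposite orientations the terms with
both crossings straight give the identity, and `splice_down_up` or `splice_up_down` removes the
others. -/
theorem weight_inverse (o b c : Bool) (i j p q : Fin n) :
    ∑ k, ∑ m, S.weight o b c i j k m * S.weight (!o) c b k m p q =
      if i = p ∧ j = q then 1 else 0 := by
  cases b <;> cases c
  · simp only [weight]
    rw [Finset.sum_comm]
    have := S.base_inverse (!o) q p j i
    simp only [Bool.not_not] at this
    simp only [mul_comm (S.base o _ _ _ _), this]
    congr 1
    simp only [eq_iff_iff]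
    tauto
  · simp only [weight, Bool.not_not]
    have hi := S.μ_ne i
    have e : ∀ k m, S.μ m * (S.μ i)⁻¹ * S.base (!o) j m i k * S.base o p k q m =
      S.base (!o) j m i k * (S.μ m * (S.μ i)⁻¹ * S.base o p k q m) := fun _ _ => by ring
    simp only [e]
    rw [S.sum_base_down_up (!o) i j fun k m => S.μ m * (S.μ i)⁻¹ * S.base o p k q m]
    have hC := S.splice_down_up o i p
    have h1 := S.straight_mul_straight o i j
    rw [mul_inv_cancel₀ hi, one_mul]
    by_cases hij : i = j
    · subst hij
      rw [if_pos rfl]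
      by_cases hpq : p = q
      · subst hpq
        have e : ∑ k, S.splice (!o) i k * (S.μ k * (S.μ i)⁻¹ * S.base o p k p k) =
            (S.μ i)⁻¹ * (S.μ p * S.splice (!o) i p * S.straight o p p +
              ∑ k, S.splice (!o) i k * (S.μ k * S.splice o p k)) := by
          have e1 : S.μ p * S.splice (!o) i p * S.straight o p p =
              ∑ k, if k = p then S.μ k * S.splice (!o) i k * S.straight o p k else 0 := by simp
          rw [e1, ← Finset.sum_add_distrib, Finset.mul_sum]
          refine Finset.sum_congr rfl fun k _ => ?_
          by_cases hk : k = p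
          · subst hk; simp [base]; ring
          · simp [base, hk, Ne.symm hk]; ring
        rw [e]
        by_cases hip : i = p
        · subst hip
          simp [base]
          linear_combination (S.μ i)⁻¹ * hC + h1 -
            S.straight (!o) i i * S.splice o i i * mul_inv_cancel₀ hi
        · simp [base, hip, Ne.symm hip]
          linear_combination (S.μ i)⁻¹ * hC -
            S.straight (!o) i i * S.splice o p i * mul_inv_cancel₀ hi
      · have e : ∀ k, S.base o p k q k = 0 := by
          intro k
          have : ¬ (p = k ∧ k = q) := fun h => hpq (h.1.trans h.2)
          simp [base, hpq, this]
        have h2 : ¬ (i = p ∧ i = q) := fun h => hpq (h.1.symm.trans h.2)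
        simp [e, h2]
    · rw [if_neg hij, add_zero]
      by_cases h2 : i = p ∧ j = q
      · obtain ⟨rfl, rfl⟩ := h2
        simp [base, hij, h1]
      · have h3 : ¬ (p = i ∧ j = q) := fun h => h2 ⟨h.1.symm, h.2⟩
        simp [base, h2, h3, Ne.symm hij]
  · simp only [weight, Bool.not_not]
    rw [S.sum_base_up_down (!o) i j fun k m => S.μ q * (S.μ k)⁻¹ * S.base o m q k p]
    have hC := S.splice_up_down o i q
    have h1 := S.straight_mul_straight o i j
    have hq := S.μ_ne q
    by_cases hij : i = j
    · subst hij
      rw [if_pos rfl]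
      by_cases hpq : p = q
      · subst hpq
        have e : ∑ k, S.splice (!o) k i * (S.μ p * (S.μ k)⁻¹ * S.base o k p k p) =
            S.μ p * ((S.μ p)⁻¹ * S.splice (!o) p i * S.straight o p p +
              ∑ k, S.splice (!o) k i * ((S.μ k)⁻¹ * S.splice o k p)) := by
          have e1 : (S.μ p)⁻¹ * S.splice (!o) p i * S.straight o p p =
              ∑ k, if k = p then (S.μ k)⁻¹ * S.splice (!o) k i * S.straight o k p else 0 := by
            simp
          rw [e1, ← Finset.sum_add_distrib, Finset.mul_sum]
          refine Finset.sum_congr rfl fun k _ => ?_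
          by_cases hk : k = p
          · subst hk; simp [base]; ring
          · simp [base, hk, Ne.symm hk]; ring
        rw [e]
        by_cases hip : i = p
        · subst hip
          simp [base]
          linear_combination S.μ i * hC + h1 +
            S.straight (!o) i i * S.straight o i i * mul_inv_cancel₀ hq
        · simp [base, hip, Ne.symm hip]
          linear_combination S.μ p * hC
      · have e : ∀ k, S.base o k q k p = 0 := by
          intro k
          have : ¬ (k = p ∧ q = k) := fun h => hpq (h.1.symm.trans h.2.symm)
          simp [base, Ne.symm hpq, this]
        have h2 : ¬ (i = p ∧ i = q) := fun h => hpq (h.1.symm.trans h.2)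
        simp [e, h2]
    · rw [if_neg hij, add_zero]
      by_cases h2 : i = p ∧ j = q
      · obtain ⟨rfl, rfl⟩ := h2
        simp [base, hij, hq, h1]
      · have h3 : ¬ (i = p ∧ q = j) := fun h => h2 ⟨h.1, h.2.symm⟩
        simp [base, h2, h3, hij]
  · simp only [weight]
    exact S.base_inverse o i j p q

end StateModel

/-! ### The third Reidemeister move -/

section Matrices

variable {L : Type*} [Fintype L] [DecidableEq L]

/-- The weights `A` on the first two of three strands. -/
def onLeft (A : L → L → L → L → ℂ) : Matrix (L × L × L) (L × L × L) ℂ :=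
  fun x y => if x.2.2 = y.2.2 then A x.1 x.2.1 y.1 y.2.1 else 0

/-- The weights `A` on the last two of three strands. -/
def onRight (A : L → L → L → L → ℂ) : Matrix (L × L × L) (L × L × L) ℂ :=
  fun x y => if x.1 = y.1 then A x.2.1 x.2.2 y.2.1 y.2.2 else 0

theorem onLeft_onRight_onLeft (A B C : L → L → L → L → ℂ) (i j k l m n : L) :
    (onLeft A * onRight B * onLeft C) (i, j, k) (l, m, n) =
      ∑ x, ∑ w, ∑ y, A i j x y * B y k w n * C x w l m := by
  have h : ∀ x w n', (onLeft A * onRight B) (i, j, k) (x, w, n') =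
      ∑ y, A i j x y * B y k w n' := by
    intro x w n'
    simp [Matrix.mul_apply, onLeft, onRight, Fintype.sum_prod_type]
  rw [Matrix.mul_apply]
  simp [Fintype.sum_prod_type, h, onLeft, Finset.sum_mul]

theorem onRight_onLeft_onRight (A B C : L → L → L → L → ℂ) (i j k l m n : L) :
    (onRight C * onLeft B * onRight A) (i, j, k) (l, m, n) =
      ∑ w, ∑ y, ∑ x, C j k x y * B i x l w * A w y m n := by
  have h : ∀ l' w y, (onRight C * onLeft B) (i, j, k) (l', w, y) =
      ∑ x, C j k x y * B i x l' w := by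
    intro l' w y
    simp [Matrix.mul_apply, onLeft, onRight, Fintype.sum_prod_type]
  rw [Matrix.mul_apply]
  simp only [Fintype.sum_prod_type, h, onRight, mul_ite, mul_zero]
  rw [Finset.sum_eq_single l (fun x _ hx => by simp [hx]) (by simp)]
  simp [Finset.sum_mul]

theorem onLeft_mul_onLeft {A B : L → L → L → L → ℂ}
    (h : ∀ i j p q, ∑ k, ∑ m, A i j k m * B k m p q = if i = p ∧ j = q then 1 else 0) :
    onLeft A * onLeft B = 1 := by
  ext ⟨i, j, k⟩ ⟨l, m, n⟩
  rw [Matrix.mul_apply, Matrix.one_apply]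
  simp only [Fintype.sum_prod_type, onLeft, ite_mul, zero_mul, mul_ite, mul_zero, Prod.mk.injEq]
  by_cases hk : k = n
  · simp [hk, h]
  · simp [hk]

theorem onRight_mul_onRight {A B : L → L → L → L → ℂ}
    (h : ∀ i j p q, ∑ k, ∑ m, A i j k m * B k m p q = if i = p ∧ j = q then 1 else 0) :
    onRight A * onRight B = 1 := by
  ext ⟨i, j, k⟩ ⟨l, m, n⟩
  rw [Matrix.mul_apply, Matrix.one_apply]
  simp only [Fintype.sum_prod_type, onRight, ite_mul, zero_mul, mul_ite, mul_zero, Prod.mk.injEq]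
  rw [Finset.sum_eq_single i (fun x _ hx => by simp [hx.symm]) (by simp)]
  by_cases hi : i = l
  · simp [hi, h]
  · simp [hi]

end Matrices

/-! ### The Yang–Baxter equation and its variants for all orientations -/

namespace StateModel

variable {n : ℕ} (S : StateModel n)

theorem onLeft_base_mulVec (o : Bool) (g : Fin n × Fin n × Fin n → ℂ) (i j k : Fin n) :
    (onLeft (S.base o)).mulVec g (i, j, k) =
      S.straight o i j * g (j, i, k) + S.splice o i j * g (i, j, k) := by
  rw [← S.sum_base o i j fun x y => g (x, y, k)]
  simp [Matrix.mulVec, dotProduct, onLeft, Fintype.sum_prod_type]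

theorem onRight_base_mulVec (o : Bool) (g : Fin n × Fin n × Fin n → ℂ) (i j k : Fin n) :
    (onRight (S.base o)).mulVec g (i, j, k) =
      S.straight o j k * g (i, k, j) + S.splice o j k * g (i, j, k) := by
  rw [← S.sum_base o j k fun x y => g (i, x, y)]
  simp only [Matrix.mulVec, dotProduct, onRight, Fintype.sum_prod_type]
  rw [Finset.sum_eq_single i (fun x _ hx => by simp [hx.symm]) (by simp)]
  simp

/-- Both sides are compared as operators on functions of three labels. Each crossing then yields
only two terms, and the identity depends only on the relative order of the labels, which leaves
finitely many polynomial identities. -/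
theorem base_braid_pos :
    onLeft (S.base true) * onRight (S.base true) * onLeft (S.base true) =
      onRight (S.base true) * onLeft (S.base true) * onRight (S.base true) := by
  apply Matrix.toLin'.injective
  refine LinearMap.ext fun g => funext ?_
  rintro ⟨i, j, k⟩
  simp only [Matrix.toLin'_mul, LinearMap.comp_apply, Matrix.toLin'_apply,
    onLeft_base_mulVec, onRight_base_mulVec]
  have hs := S.s_ne
  have hτ := S.τ_sq
  have hz : S.s * S.s⁻¹ = 1 := mul_inv_cancel₀ hs
  generalize S.s⁻¹ = s' at *
  have key : ∀ x y : Fin n, x ≠ y → (x < y ∧ ¬ y < x) ∨ (¬ x < y ∧ y < x) := fun x y h =>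
    (lt_or_gt_of_ne h).imp (fun h => ⟨h, h.not_gt⟩) (fun h => ⟨h.not_gt, h⟩)
  simp only [straight, splice, if_true]
  by_cases hij : i = j
  · subst hij
    by_cases hik : i = k
    · subst hik
      simp
    · rcases key i k hik with ⟨h1, h2⟩ | ⟨h1, h2⟩ <;> simp only [hik, Ne.symm hik, h1, h2, if_true,
        if_false, lt_irrefl] <;> grind
  · by_cases hik : i = k
    · subst hik
      rcases key i j hij with ⟨h1, h2⟩ | ⟨h1, h2⟩ <;> simp only [hij, Ne.symm hij, h1, h2, if_true,
        if_false, lt_irrefl] <;> grind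
    · by_cases hjk : j = k
      · subst hjk
        rcases key i j hij with ⟨h1, h2⟩ | ⟨h1, h2⟩ <;> simp only [hij, Ne.symm hij, h1, h2,
          if_true, if_false, lt_irrefl] <;> grind
      · rcases key i j hij with ⟨h1, h2⟩ | ⟨h1, h2⟩ <;>
        rcases key i k hik with ⟨h3, h4⟩ | ⟨h3, h4⟩ <;>
        rcases key j k hjk with ⟨h5, h6⟩ | ⟨h5, h6⟩ <;>
        first
        | exact absurd (h1.trans h5) h3
        | exact absurd (h6.trans h2) h4
        | simp only [hij, Ne.symm hij, hik, hjk, Ne.symm hjk, h1, h2, h3, h5, h6,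
            if_true, if_false]
          ring

theorem onLeft_inverse (o b c : Bool) :
    onLeft (S.weight o b c) * onLeft (S.weight (!o) c b) = 1 :=
  onLeft_mul_onLeft (S.weight_inverse o b c)

theorem onRight_inverse (o b c : Bool) :
    onRight (S.weight o b c) * onRight (S.weight (!o) c b) = 1 :=
  onRight_mul_onRight (S.weight_inverse o b c)

/-- The third Reidemeister move for strands `b`, `c`, `d`, with crossings `p` of `b` and `c`, `q` of
`b` and `d`, and `r` of `c` and `d`. -/
def BraidRel (p q r b c d : Bool) : Prop :=
  onLeft (S.weight p b c) * onRight (S.weight q b d) * onLeft (S.weight r c d) =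
    onRight (S.weight r c d) * onLeft (S.weight q b d) * onRight (S.weight p b c)

variable {S}

/-- Multiplying by the inverse weights of the first two strands on suitable sides gives the relation
with these strands exchanged at the bottom. -/
theorem BraidRel.swap_left {p q r b c d : Bool} (h : S.BraidRel p q r b c d) :
    S.BraidRel (!p) r q c b d := by
  unfold BraidRel at h ⊢
  have h1 := S.onLeft_inverse (!p) c b
  have h2 := S.onRight_inverse p b c
  rw [Bool.not_not] at h1
  calc _ = onLeft (S.weight (!p) c b) * (onRight (S.weight r c d) * onLeft (S.weight q b d) *
        onRight (S.weight p b c)) * onRight (S.weight (!p) c b) := by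
        simp only [mul_assoc, h2, mul_one]
    _ = onLeft (S.weight (!p) c b) * onLeft (S.weight p b c) * (onRight (S.weight q b d) *
        onLeft (S.weight r c d)) * onRight (S.weight (!p) c b) := by
        rw [← h]; simp only [mul_assoc]
    _ = _ := by rw [h1, one_mul]

theorem BraidRel.swap_right {p q r b c d : Bool} (h : S.BraidRel p q r b c d) :
    S.BraidRel q p (!r) b d c := by
  unfold BraidRel at h ⊢
  have h1 := S.onLeft_inverse r c d
  have h2 := S.onRight_inverse (!r) d c
  rw [Bool.not_not] at h2
  calc _ = onRight (S.weight (!r) d c) * (onRight (S.weight r c d) * onLeft (S.weight q b d) *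
        onRight (S.weight p b c)) * onLeft (S.weight (!r) d c) := by
        simp only [← mul_assoc, h2, one_mul]
    _ = onRight (S.weight (!r) d c) * (onLeft (S.weight p b c) * onRight (S.weight q b d)) *
        (onLeft (S.weight r c d) * onLeft (S.weight (!r) d c)) := by
        rw [← h]; simp only [mul_assoc]
    _ = _ := by rw [h1, mul_one, mul_assoc]

theorem weight_rotate (S : StateModel n) (o b d : Bool) (y k w m : Fin n) :
    S.weight o b d y k w m =
      S.capWeight (!d) k * (S.capWeight (!d) w)⁻¹ * S.weight (!o) (!d) b w y m k := by
  have hne : S.capWeight (!d) w ≠ 0 := by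
    cases d <;> simp [capWeight, S.μ_ne]
  have := S.weight_slide_cap (!o) b (!d) w y m k
  rw [Bool.not_not, Bool.not_not] at this
  field_simp
  rw [this, mul_comm]

/-- The third strand is bent around to become the first, with its orientation reversed. Up to the
factors of maxima at its two ends, equal on both sides, the two relations contain the same sums. -/
theorem BraidRel.rotate {p q r b c d : Bool} (h : S.BraidRel (!q) (!r) p (!d) b c) :
    S.BraidRel p q r b c d := by
  unfold BraidRel at h ⊢
  have hne : ∀ w, S.capWeight (!d) w ≠ 0 := by
    intro w
    cases d <;> simp [capWeight, S.μ_ne]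
  ext ⟨i, j, k⟩ ⟨l, m, n'⟩
  have h' := congrFun (congrFun h (l, i, j)) (m, n', k)
  rw [onLeft_onRight_onLeft, onRight_onLeft_onRight] at h' ⊢
  have e1 : ∀ x w y, S.weight p b c i j x y * S.weight q b d y k w n' * S.weight r c d x w l m =
      S.capWeight (!d) k * (S.capWeight (!d) l)⁻¹ * (S.weight p b c i j x y *
        S.weight (!r) (!d) c l x m w * S.weight (!q) (!d) b w y n' k) := by
    intro x w y
    rw [S.weight_rotate q b d, S.weight_rotate r c d]
    have := hne w
    have := hne l
    field_simp
  have e2 : ∀ w y x, S.weight r c d j k x y * S.weight q b d i x l w * S.weight p b c w y m n' =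
      S.capWeight (!d) k * (S.capWeight (!d) l)⁻¹ * (S.weight (!q) (!d) b l i w x *
        S.weight (!r) (!d) c x j y k * S.weight p b c w y m n') := by
    intro w y x
    rw [S.weight_rotate q b d, S.weight_rotate r c d]
    have := hne x
    have := hne l
    field_simp
  simp only [e1, e2, ← Finset.mul_sum]
  congr 1
  rw [Finset.sum_comm]
  exact (Finset.sum_congr rfl fun w _ => Finset.sum_comm).trans h'.symm

/-- The choices of crossings of three strands that come from an order of the strands by height. -/
def Layered (p q r : Bool) : Prop := p = r → q = p

/-- Three strands have six orders by height, and exchanging two strands leads from the positive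
relation to the other five. -/
theorem braidRel_up (S : StateModel n) {p q r : Bool} (h : Layered p q r) :
    S.BraidRel p q r true true true := by
  have hpos : S.BraidRel true true true true true true := S.base_braid_pos
  have hneg : S.BraidRel false false false true true true := by
    have h1 : S.BraidRel false true true true true true := hpos.swap_left
    have h2 : S.BraidRel true false false true true true := h1.swap_right
    exact h2.swap_left
  cases p <;> cases q <;> cases r
  · exact hneg
  · exact hneg.swap_right
  · exact absurd (h rfl) (by decide)
  · exact hpos.swap_left
  · exact hneg.swap_left
  · exact absurd (h rfl) (by decide)
  · exact hpos.swap_right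
  · exact hpos

/-- The third Reidemeister move for strands `b`, `c`, `d` and all orders by height. -/
def BraidRels (S : StateModel n) (b c d : Bool) : Prop :=
  ∀ p q r : Bool, Layered p q r → S.BraidRel p q r b c d

theorem Layered.swap_left {p q r : Bool} (h : Layered p q r) : Layered (!p) r q := by
  revert h; unfold Layered; revert p q r; decide

theorem Layered.swap_right {p q r : Bool} (h : Layered p q r) : Layered q p (!r) := by
  revert h; unfold Layered; revert p q r; decide

theorem Layered.rotate {p q r : Bool} (h : Layered p q r) : Layered (!q) (!r) p := by
  revert h; unfold Layered; revert p q r; decide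

theorem BraidRels.swap_left {b c d : Bool} (H : S.BraidRels b c d) : S.BraidRels c b d := by
  intro p q r h
  have := (H _ _ _ h.swap_left).swap_left
  rwa [Bool.not_not] at this

theorem BraidRels.swap_right {b c d : Bool} (H : S.BraidRels b c d) : S.BraidRels b d c := by
  intro p q r h
  have := (H _ _ _ h.swap_right).swap_right
  rwa [Bool.not_not] at this

theorem BraidRels.rotate {b c d : Bool} (H : S.BraidRels (!d) b c) : S.BraidRels b c d :=
  fun _ _ _ h => (H _ _ _ h.rotate).rotate

/-- Rotations reverse one orientation at a time, starting from three upward strands; exchanges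
permute the orientations. -/
theorem braidRels (S : StateModel n) (b c d : Bool) : S.BraidRels b c d := by
  have uuu : S.BraidRels true true true := fun p q r h => braidRel_up S h
  have uud : S.BraidRels true true false := BraidRels.rotate uuu
  have udd : S.BraidRels true false false := BraidRels.rotate uud
  have ddd : S.BraidRels false false false := BraidRels.rotate udd
  cases b <;> cases c <;> cases d
  · exact ddd
  · exact udd.swap_left.swap_right
  · exact udd.swap_left
  · exact uud.swap_right.swap_left
  · exact udd
  · exact uud.swap_right
  · exact uud
  · exact uuu

theorem weight_braid (S : StateModel n) (o b c d : Bool) (i j k l m n' : Fin n) :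
    ∑ x, ∑ w, ∑ y, S.weight o b c i j x y * S.weight o b d y k w n' * S.weight o c d x w l m =
      ∑ w, ∑ y, ∑ x, S.weight o c d j k x y * S.weight o b d i x l w * S.weight o b c w y m n' := by
  rw [← onLeft_onRight_onLeft, ← onRight_onLeft_onRight]
  exact congrFun (congrFun (S.braidRels b c d o o o fun _ => rfl) _) _

end StateModel

theorem LocalMove.exists_joins {x x' : List Slice} (h : LocalMove x x') :
    ∃ d c, Joins x d c := by
  cases h <;> simp [Joins, Slice.dom, Slice.cod, Piece.dom, Piece.cod]

namespace StateModel

variable {n : ℕ} (S : StateModel n)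

/-! ### State sums -/

/-- The action of a piece on functions of the labels of the strands, where the piece involves the
leftmost strands. -/
noncomputable def act : Piece → (List (Fin n) → ℂ) →ₗ[ℂ] (List (Fin n) → ℂ)
  | .cup b =>
    { toFun := fun g α => ∑ i, S.cupWeight b i * g (i :: i :: α)
      map_add' := fun g g' => by ext α; simp [mul_add, Finset.sum_add_distrib]
      map_smul' := fun c g => by ext α; simp [Finset.mul_sum, mul_left_comm] }
  | .cap b =>
    { toFun := fun g α => match α with
        | i :: j :: α => if i = j then S.capWeight b i * g α else 0
        | _ => 0
      map_add' := fun g g' => by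
        ext α
        rcases α with _ | ⟨i, _ | ⟨j, α⟩⟩ <;> simp
        split_ifs <;> ring
      map_smul' := fun c g => by
        ext α
        rcases α with _ | ⟨i, _ | ⟨j, α⟩⟩ <;> simp
        split_ifs <;> ring }
  | .cross o b c =>
    { toFun := fun g α => match α with
        | i :: j :: α => ∑ k, ∑ m, S.weight o b c i j k m * g (k :: m :: α)
        | _ => 0
      map_add' := fun g g' => by
        ext α
        rcases α with _ | ⟨i, _ | ⟨j, α⟩⟩ <;> simp [mul_add, Finset.sum_add_distrib]
      map_smul' := fun c g => by
        ext α
        rcases α with _ | ⟨i, _ | ⟨j, α⟩⟩ <;> simp [Finset.mul_sum, mul_left_comm] }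

theorem act_cup (b : Bool) (g : List (Fin n) → ℂ) (α : List (Fin n)) :
    S.act (.cup b) g α = ∑ i, S.cupWeight b i * g (i :: i :: α) := rfl

theorem act_cap (b : Bool) (g : List (Fin n) → ℂ) (i j : Fin n) (α : List (Fin n)) :
    S.act (.cap b) g (i :: j :: α) = if i = j then S.capWeight b i * g α else 0 := rfl

theorem act_cross (o b c : Bool) (g : List (Fin n) → ℂ) (i j : Fin n) (α : List (Fin n)) :
    S.act (.cross o b c) g (i :: j :: α) = ∑ k, ∑ m, S.weight o b c i j k m * g (k :: m :: α) := rfl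

/-- The action of a piece with `i` strands to the left of it. -/
noncomputable def actAt : ℕ → Piece → (List (Fin n) → ℂ) →ₗ[ℂ] (List (Fin n) → ℂ)
  | 0, p => S.act p
  | i + 1, p =>
    { toFun := fun g α => match α with
        | [] => 0
        | c :: α => actAt i p (fun β => g (c :: β)) α
      map_add' := fun g g' => by
        ext α
        rcases α with _ | ⟨c, α⟩
        · simp
        · exact congrFun (map_add (actAt i p) (fun β => g (c :: β)) (fun β => g' (c :: β))) α
      map_smul' := fun x g => by
        ext α
        rcases α with _ | ⟨c, α⟩
        · simp
        · exact congrFun (map_smul (actAt i p) x (fun β => g (c :: β))) α }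

theorem actAt_zero (p : Piece) (g : List (Fin n) → ℂ) : S.actAt 0 p g = S.act p g := rfl

theorem actAt_succ (i : ℕ) (p : Piece) (g : List (Fin n) → ℂ) (c : Fin n) (α : List (Fin n)) :
    S.actAt (i + 1) p g (c :: α) = S.actAt i p (fun β => g (c :: β)) α := rfl

theorem actAt_append (i : ℕ) (p : Piece) (g : List (Fin n) → ℂ) (γ α : List (Fin n)) :
    S.actAt (γ.length + i) p g (γ ++ α) = S.actAt i p (fun β => g (γ ++ β)) α := by
  induction γ generalizing g with
  | nil => simp
  | cons c γ ih =>
    rw [List.length_cons, show γ.length + 1 + i = γ.length + i + 1 by omega, List.cons_append,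
      actAt_succ, ih]
    rfl

/-- The action of a positional word. -/
noncomputable def stateSum : List PosPiece → (List (Fin n) → ℂ) → List (Fin n) → ℂ
  | [], g => g
  | x :: w, g => S.actAt x.1 x.2 (stateSum w g)

theorem stateSum_append (u v : List PosPiece) (g : List (Fin n) → ℂ) :
    S.stateSum (u ++ v) g = S.stateSum u (S.stateSum v g) := by
  induction u with
  | nil => rfl
  | cons x u ih => simp [stateSum, ih]

theorem act_congr (p : Piece) (r : List Bool) {g g' : List (Fin n) → ℂ}
    (h : ∀ α, α.length = (p.cod ++ r).length → g α = g' α) (α : List (Fin n))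
    (hα : α.length = (p.dom ++ r).length) : S.act p g α = S.act p g' α := by
  cases p with
  | cup b =>
    simp only [act_cup]
    refine Finset.sum_congr rfl fun i _ => ?_
    rw [h]
    simpa [Piece.cod, Piece.dom] using hα
  | cap b =>
    rcases α with _ | ⟨i, _ | ⟨j, α⟩⟩ <;> simp [Piece.dom] at hα
    simp only [act_cap]
    rw [h]
    simpa [Piece.cod] using hα
  | cross o b c =>
    rcases α with _ | ⟨i, _ | ⟨j, α⟩⟩ <;> simp [Piece.dom] at hα
    simp only [act_cross]
    refine Finset.sum_congr rfl fun k _ => Finset.sum_congr rfl fun m _ => ?_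
    rw [h]
    simpa [Piece.cod] using hα

theorem exists_append_of_length {α : Type*} {x : List α} {k m : ℕ} (h : x.length = k + m) :
    ∃ y w, x = y ++ w ∧ y.length = k ∧ w.length = m :=
  ⟨x.take k, x.drop k, (List.take_append_drop k x).symm, by simp [h], by simp [h]⟩

theorem stateSum_congr {w : List PosPiece} {s t : List Bool} (hw : Runs s w t)
    {g g' : List (Fin n) → ℂ} (h : ∀ α, α.length = t.length → g α = g' α) (α : List (Fin n))
    (hα : α.length = s.length) : S.stateSum w g α = S.stateSum w g' α := by
  induction w generalizing s α with
  | nil =>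
    obtain rfl : s = t := hw
    exact h α hα
  | cons x w ih =>
    obtain ⟨i, p⟩ := x
    obtain ⟨l, r, rfl, rfl, hw⟩ := hw
    obtain ⟨γ, β, rfl, hγ, hβ⟩ := exists_append_of_length (k := l.length)
      (m := (p.dom ++ r).length) (x := α) (by simpa [add_assoc] using hα)
    change S.actAt l.length p _ _ = S.actAt l.length p _ _
    rw [← hγ, ← Nat.add_zero γ.length, actAt_append, actAt_append, actAt_zero, actAt_zero]
    refine S.act_congr p r (fun δ hδ => ?_) β hβ
    refine ih hw _ ?_
    rw [List.length_append, hγ, hδ]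
    simp

/-- A piece further right acts linearly, hence commutes with the finite sums over the labels of `x`;
its position shifts by the change in the number of strands. -/
theorem act_actAt (x y : Piece) (m : ℕ) (r : ℕ) (g : List (Fin n) → ℂ) (α : List (Fin n))
    (hα : α.length = x.dom.length + r) :
    S.act x (S.actAt (x.cod.length + m) y g) α = S.actAt (x.dom.length + m) y (S.act x g) α := by
  have lin : ∀ {ι : Type} (s : Finset ι) (c : ι → ℂ) (G : ι → List (Fin n) → ℂ)
      (β : List (Fin n)), S.actAt m y (fun γ => ∑ i ∈ s, c i * G i γ) β =
        ∑ i ∈ s, c i * S.actAt m y (G i) β := by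
    intro ι s c G β
    have : (fun γ => ∑ i ∈ s, c i * G i γ) = ∑ i ∈ s, c i • G i := by
      ext γ; simp
    rw [this, map_sum]
    simp
  cases x with
  | cup b =>
    simp only [Piece.cod, Piece.dom, List.length_cons, List.length_nil, Nat.zero_add] at hα ⊢
    rw [act_cup, show (1 + 1 + m) = m + 1 + 1 by omega]
    simp only [actAt_succ]
    rw [← lin]
    rfl
  | cap b =>
    rcases α with _ | ⟨i, _ | ⟨j, α⟩⟩
    · simp [Piece.dom] at hα; omega
    · simp [Piece.dom] at hα; omega
    simp only [Piece.cod, Piece.dom, List.length_cons, List.length_nil, Nat.zero_add]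
    rw [act_cap, show (1 + 1 + m) = m + 1 + 1 by omega, actAt_succ, actAt_succ]
    simp only [act_cap]
    by_cases h : i = j
    · simp only [h, if_true]
      have := lin {()} (fun _ => S.capWeight b j) (fun _ => g) α
      simpa using this.symm
    · simp only [h, if_false]
      exact (congrFun (map_zero (S.actAt m y)) α).symm
  | cross o b c =>
    rcases α with _ | ⟨i, _ | ⟨j, α⟩⟩
    · simp [Piece.dom] at hα; omega
    · simp [Piece.dom] at hα; omega
    simp only [Piece.cod, Piece.dom, List.length_cons, List.length_nil, Nat.zero_add]
    rw [act_cross, show (1 + 1 + m) = m + 1 + 1 by omega, actAt_succ, actAt_succ]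
    simp only [actAt_succ, act_cross]
    have := lin (Finset.univ : Finset (Fin n × Fin n)) (fun km => S.weight o b c i j km.1 km.2)
      (fun km γ => g (km.1 :: km.2 :: γ)) α
    simpa [Fintype.sum_prod_type] using this.symm

theorem sum_rotate_two (F : Fin n → Fin n → Fin n → Fin n → ℂ) :
    ∑ k, ∑ m, ∑ p, ∑ q, F k m p q = ∑ p, ∑ q, ∑ k, ∑ m, F k m p q := by
  simp only [← Fintype.sum_prod_type']
  exact Fintype.sum_equiv ⟨fun x => (x.2.2.1, x.2.2.2, x.1, x.2.1),
    fun x => (x.2.2.1, x.2.2.2, x.1, x.2.1), fun _ => rfl, fun _ => rfl⟩ _ _ fun _ => rfl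

theorem sum_rotate_three (F : Fin n → Fin n → Fin n → Fin n → Fin n → Fin n → ℂ) :
    ∑ x, ∑ y, ∑ w, ∑ q, ∑ l, ∑ m, F x y w q l m =
      ∑ l, ∑ m, ∑ q, ∑ x, ∑ w, ∑ y, F x y w q l m := by
  simp only [← Fintype.sum_prod_type']
  exact Fintype.sum_equiv ⟨fun ⟨x, y, w, q, l, m⟩ => (l, m, q, x, w, y),
    fun ⟨l, m, q, x, w, y⟩ => (x, y, w, q, l, m), fun _ => rfl, fun _ => rfl⟩ _ _ fun _ => rfl

theorem sum_rotate_three' (F : Fin n → Fin n → Fin n → Fin n → Fin n → Fin n → ℂ) :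
    ∑ x, ∑ y, ∑ l, ∑ w, ∑ m, ∑ q, F x y l w m q =
      ∑ l, ∑ m, ∑ q, ∑ w, ∑ y, ∑ x, F x y l w m q := by
  simp only [← Fintype.sum_prod_type']
  exact Fintype.sum_equiv ⟨fun ⟨x, y, l, w, m, q⟩ => (l, m, q, w, y, x),
    fun ⟨l, m, q, w, y, x⟩ => (x, y, l, w, m, q), fun _ => rfl, fun _ => rfl⟩ _ _ fun _ => rfl

/-- Local moves do not change the state sum. -/
theorem stateSum_localMove {x x' : List Slice} (h : LocalMove x x') {d c : List Bool}
    (hx : Joins x d c) (g : List (Fin n) → ℂ) (r : ℕ) (α : List (Fin n))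
    (hα : α.length = d.length + r) :
    S.stateSum (x.map Slice.pos) g α = S.stateSum (x'.map Slice.pos) g α := by
  have hd := hx
  cases h with
  | interchange x y mid =>
    obtain ⟨rfl, -⟩ := hx
    have := S.act_actAt x y mid.length (mid.length + y.dom.length + r) g α
      (by simpa [Slice.dom, add_assoc] using hα)
    simpa [stateSum, Slice.pos, actAt_zero] using this
  | zigzag_left b =>
    obtain ⟨rfl, -⟩ := hx
    rcases α with _ | ⟨p, α⟩
    · simp [Slice.dom] at hα; omega
    simp [stateSum, Slice.pos, actAt_zero, actAt_succ, act_cup, act_cap]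
    rw [← mul_assoc, S.cup_mul_cap, one_mul]
  | zigzag_right b =>
    obtain ⟨rfl, -⟩ := hx
    rcases α with _ | ⟨p, α⟩
    · simp [Slice.dom] at hα; omega
    simp [stateSum, Slice.pos, actAt_zero, actAt_succ, act_cup, act_cap]
    have := S.cup_mul_cap (!b) p
    rw [Bool.not_not] at this
    rw [← mul_assoc, this, one_mul]
  | slide_cup o s b =>
    obtain ⟨rfl, -⟩ := hx
    rcases α with _ | ⟨p, α⟩
    · simp [Slice.dom] at hα; omega
    simp only [List.map_cons, List.map_nil, stateSum, Slice.pos, List.length_cons, List.length_nil,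
      Nat.zero_add, actAt_zero, actAt_succ, act_cup, act_cross, Finset.mul_sum]
    rw [Finset.sum_comm]
    refine Finset.sum_congr rfl fun k _ => ?_
    rw [Finset.sum_comm]
    refine Finset.sum_congr rfl fun m _ => Finset.sum_congr rfl fun i _ => ?_
    rw [← mul_assoc, ← mul_assoc, S.weight_slide_cup]
  | slide_cap o s b =>
    obtain ⟨rfl, -⟩ := hx
    rcases α with _ | ⟨i, _ | ⟨p, _ | ⟨j, α⟩⟩⟩ <;> try (simp [Slice.dom, Piece.dom] at hα; omega)
    simp only [List.map_cons, List.map_nil, stateSum, Slice.pos, List.length_cons, List.length_nil,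
      Nat.zero_add, actAt_zero, actAt_succ, act_cap, act_cross]
    simp only [mul_ite, mul_zero, Finset.sum_ite_eq', Finset.mem_univ, if_true]
    rw [Finset.sum_comm]
    simp only [Finset.sum_ite_eq, Finset.mem_univ, if_true]
    refine Finset.sum_congr rfl fun k _ => ?_
    rw [mul_left_comm, ← mul_assoc, ← mul_assoc, mul_right_comm, mul_right_comm, S.weight_slide_cap]
    ring
  | reidemeister1_cup o b =>
    simp only [List.map_cons, List.map_nil, stateSum, Slice.pos, List.length_nil,
      actAt_zero, act_cup, act_cross, Finset.mul_sum]
    rw [Finset.sum_comm]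
    have : ∀ k, ∑ i, ∑ m, S.cupWeight b i * (S.weight o b (!b) i i k m * g (k :: m :: α)) =
        S.cupWeight (!b) k * g (k :: k :: α) := by
      intro k
      rw [Finset.sum_comm]
      simp only [← mul_assoc, ← Finset.sum_mul, S.weight_twist_cup]
      simp
    exact Finset.sum_congr rfl fun k _ => this k
  | reidemeister1_cap o b =>
    obtain ⟨rfl, -⟩ := hx
    rcases α with _ | ⟨i, _ | ⟨j, α⟩⟩ <;> try (simp [Slice.dom, Piece.dom] at hα; omega)
    simp only [List.map_cons, List.map_nil, stateSum, Slice.pos, List.length_nil,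
      actAt_zero, act_cap, act_cross]
    simp only [mul_ite, mul_zero, Finset.sum_ite_eq, Finset.mem_univ, if_true]
    simp only [← mul_assoc, ← Finset.sum_mul, S.weight_twist_cap]
    split_ifs <;> simp
  | reidemeister2 o b c =>
    obtain ⟨rfl, -⟩ := hx
    rcases α with _ | ⟨i, _ | ⟨j, α⟩⟩ <;> try (simp [Slice.dom, Piece.dom] at hα; omega)
    simp only [List.map_cons, List.map_nil, stateSum, Slice.pos, List.length_nil,
      actAt_zero, act_cross, Finset.mul_sum]
    have : ∀ p q, ∑ k, ∑ m, S.weight o b c i j k m * (S.weight (!o) c b k m p q *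
        g (p :: q :: α)) = if i = p ∧ j = q then g (p :: q :: α) else 0 := by
      intro p q
      simp only [← mul_assoc, ← Finset.sum_mul, S.weight_inverse]
      split_ifs <;> simp
    rw [sum_rotate_two fun k m p q => S.weight o b c i j k m * (S.weight (!o) c b k m p q *
        g (p :: q :: α))]
    simp [this, ite_and]
  | reidemeister3 o b c d =>
    obtain ⟨rfl, -⟩ := hx
    rcases α with _ | ⟨i, _ | ⟨j, _ | ⟨k, α⟩⟩⟩ <;> try (simp [Slice.dom, Piece.dom] at hα; omega)
    simp only [List.map_cons, List.map_nil, stateSum, Slice.pos, List.length_nil, List.length_cons,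
      Nat.zero_add, actAt_zero, actAt_succ, act_cross, Finset.mul_sum]
    rw [sum_rotate_three fun x y w q l m => S.weight o b c i j x y * (S.weight o b d y k w q *
        (S.weight o c d x w l m * g (l :: m :: q :: α))),
      sum_rotate_three' fun x y l w m q => S.weight o c d j k x y * (S.weight o b d i x l w *
        (S.weight o b c w y m q * g (l :: m :: q :: α)))]
    refine Finset.sum_congr rfl fun l _ => Finset.sum_congr rfl fun m _ =>
      Finset.sum_congr rfl fun q _ => ?_
    simpa only [Finset.sum_mul, mul_assoc] using
      congrArg (· * g (l :: m :: q :: α)) (S.weight_braid o b c d i j k l m q)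

theorem stateSum_pad (x : List Slice) (l r : List Bool) (g : List (Fin n) → ℂ)
    {γ : List (Fin n)} (hγ : γ.length = l.length) (β : List (Fin n)) :
    S.stateSum ((x.map (Slice.pad l r)).map Slice.pos) g (γ ++ β) =
      S.stateSum (x.map Slice.pos) (fun δ => g (γ ++ δ)) β := by
  induction x generalizing β with
  | nil => rfl
  | cons y x ih =>
    simp only [List.map_cons, stateSum, Slice.pos, Slice.pad, List.length_append]
    rw [← hγ, actAt_append]
    simp only [funext ih]

/-- The state sum of a diagram. -/
noncomputable def diagramSum (D : Diagram) : ℂ :=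
  S.stateSum (D.word.map Slice.pos) (fun _ => 1) []

theorem diagramSum_step {D D' : Diagram} (h : Step D D') : S.diagramSum D = S.diagramSum D' := by
  obtain ⟨u, v, x, x', l, r, hx, hD, hD'⟩ := h
  obtain ⟨d, c, hj⟩ := LocalMove.exists_joins hx
  have hc := D.closed
  rw [hD, joins_append] at hc
  obtain ⟨t, hc, -⟩ := hc
  rw [joins_append] at hc
  obtain ⟨s, hu, hs⟩ := hc
  -- The left side of a move is non-empty, so its first slice determines the strands below it.
  have hs : s = l ++ d ++ r := by
    obtain ⟨y, x, rfl⟩ := List.exists_cons_of_ne_nil hx.left_ne_nil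
    rw [← hs.1, ← (hj.pad l r).1]
  subst hs
  simp only [diagramSum, hD, hD', List.map_append, stateSum_append]
  refine S.stateSum_congr hu.runs (fun α hα => ?_) _ rfl
  obtain ⟨γ, β, rfl, hγ, hβ⟩ := exists_append_of_length (k := l.length)
    (m := d.length + r.length) (x := α) (by simpa [add_assoc] using hα)
  rw [stateSum_pad _ _ _ _ _ hγ, stateSum_pad _ _ _ _ _ hγ]
  exact S.stateSum_localMove hx hj _ _ _ hβ

/-- The state sum as a link invariant. -/
noncomputable def linkSum : Link → ℂ :=
  Quotient.lift S.diagramSum fun D D' h => by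
    change Relation.EqvGen Step D D' at h
    induction h with
    | rel _ _ h => exact S.diagramSum_step h
    | refl _ => rfl
    | symm _ _ _ ih => exact ih.symm
    | trans _ _ _ _ _ ih ih' => exact ih.trans ih'

theorem linkSum_link (D : Diagram) : S.linkSum D.link = S.diagramSum D := rfl

theorem stateSum_linear (w : List PosPiece) (x y : ℂ) (g g' : List (Fin n) → ℂ) :
    S.stateSum w (x • g + y • g') = x • S.stateSum w g + y • S.stateSum w g' := by
  induction w with
  | nil => rfl
  | cons p w ih => simp [stateSum, ih]

theorem linkSum_skein {Lp Lm L0 : Link} (h : SkeinTriple Lp Lm L0) :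
    S.a * S.linkSum Lp + S.a⁻¹ * S.linkSum Lm = (S.s + S.s⁻¹) * S.linkSum L0 := by
  obtain ⟨Dp, Dm, D0, u, v, l, r, rfl, rfl, rfl, hp, hm, h0⟩ := h
  have hc := Dp.closed
  rw [hp, joins_append] at hc
  obtain ⟨t, hc, -⟩ := hc
  rw [joins_append] at hc
  obtain ⟨s, hu, rfl, -⟩ := hc
  simp only [linkSum_link, diagramSum, hp, hm, h0, List.map_append, stateSum_append]
  have e1 : ∀ (x y : ℂ) (g g' : List (Fin n) → ℂ) (α : List (Fin n)),
      x * S.stateSum (u.map Slice.pos) g α + y * S.stateSum (u.map Slice.pos) g' α =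
        S.stateSum (u.map Slice.pos) (x • g + y • g') α := by
    intro x y g g' α
    rw [stateSum_linear]
    rfl
  have e2 : ∀ (x : ℂ) (g : List (Fin n) → ℂ) (α : List (Fin n)),
      x * S.stateSum (u.map Slice.pos) g α =
        S.stateSum (u.map Slice.pos) (x • g + (0 : ℂ) • g) α := by
    intro x g α
    rw [stateSum_linear]
    simp
  rw [e1, e2]
  refine S.stateSum_congr hu.runs (fun α hα => ?_) _ rfl
  obtain ⟨γ, β, rfl, hγ, hβ⟩ := exists_append_of_length (k := l.length)
    (m := 2 + r.length) (x := α) (by simp [Slice.dom, Piece.dom] at hα; omega)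
  rcases β with _ | ⟨i, _ | ⟨j, β⟩⟩
  · simp at hβ; omega
  · simp at hβ; omega
  simp only [List.map_cons, List.map_nil, stateSum, Slice.pos, Pi.add_apply, Pi.smul_apply,
    smul_eq_mul, zero_mul, add_zero]
  rw [← hγ, ← Nat.add_zero γ.length, actAt_append, actAt_append, actAt_zero, actAt_zero,
    act_cross, act_cross, Finset.mul_sum, Finset.mul_sum, ← Finset.sum_add_distrib]
  simp only [Finset.mul_sum, ← Finset.sum_add_distrib, ← mul_assoc, ← add_mul, S.weight_skein]
  simp [ite_and]

theorem linkSum_trivialKnot : S.linkSum trivialKnot = ∑ i, S.μ i := by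
  change S.diagramSum trivialKnotDiagram = _
  simp [diagramSum, trivialKnotDiagram, stateSum, Slice.pos, actAt_zero, act_cup, act_cap,
    cupWeight, capWeight]

end StateModel

/-! ### A family of state models -/

/-- Together with `mul_zpow_add_one` this makes the sum conditions of `quantumModel` telescope. -/
theorem sum_range_ite_lt (F : ℕ → ℂ) {n i : ℕ} (h : i ≤ n) :
    ∑ k ∈ Finset.range n, (if k < i then F (k + 1) - F k else 0) = F i - F 0 := by
  induction n, h using Nat.le_induction with
  | base =>
    rw [← Finset.sum_range_sub]
    exact Finset.sum_congr rfl fun k hk => if_pos (Finset.mem_range.1 hk)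
  | succ m hm ih => rw [Finset.sum_range_succ, ih, if_neg (by omega), add_zero]

theorem sum_range_ite_gt (F : ℕ → ℂ) {n i : ℕ} (h : i + 1 ≤ n) :
    ∑ k ∈ Finset.range n, (if i < k then F (k + 1) - F k else 0) = F n - F (i + 1) := by
  induction n, h using Nat.le_induction with
  | base =>
    rw [sub_self]
    refine Finset.sum_eq_zero fun k hk => if_neg ?_
    have := Finset.mem_range.1 hk
    omega
  | succ m hm ih => rw [Finset.sum_range_succ, ih, if_pos (by omega)]; ring

theorem mul_zpow_add_one {q : ℂ} (hq : q ≠ 0) (e : ℤ) :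
    (Complex.I * q + (Complex.I * q)⁻¹) * q ^ (e + 1) =
      Complex.I * q ^ (e + 1 + 1) - Complex.I * q ^ e := by
  rw [zpow_add_one₀ hq (e + 1), zpow_add_one₀ hq, mul_inv, Complex.inv_I]
  field_simp
  ring

/-- The state model with `n` labels at `a = i qⁿ` and `z = i (q - q⁻¹)`. -/
noncomputable def quantumModel (n : ℕ) (q : ℂ) (hq : q ≠ 0) : StateModel n where
  a := Complex.I * q ^ (n : ℤ)
  s := Complex.I * q
  τ := Complex.I
  μ i := q ^ (2 * (i : ℤ) + 1 - n)
  a_ne := mul_ne_zero Complex.I_ne_zero (zpow_ne_zero _ hq)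
  s_ne := mul_ne_zero Complex.I_ne_zero hq
  μ_ne i := zpow_ne_zero _ hq
  τ_sq := Complex.I_mul_I
  sum_lt i := by
    have := sum_range_ite_lt (fun k => Complex.I * q ^ (2 * (k : ℤ) - n)) i.2.le
    rw [Finset.sum_range] at this
    convert this using 1
    · refine Finset.sum_congr rfl fun k _ => ?_
      simp only [Fin.lt_def]
      congr 1
      rw [show 2 * ((k.1 + 1 : ℕ) : ℤ) - n = 2 * k - n + 1 + 1 by push_cast; ring,
        show 2 * (k : ℤ) + 1 - n = 2 * k - n + 1 by ring, mul_zpow_add_one hq]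
    · rw [show 2 * (i : ℤ) + 1 - n = 2 * i - n + 1 by ring, zpow_add_one₀ hq, mul_inv, mul_inv,
        Complex.inv_I, ← zpow_neg]
      field_simp
      simp
      ring
  sum_gt i := by
    have := sum_range_ite_gt (fun k => Complex.I * q ^ (2 * (k : ℤ) - n)) i.2
    rw [Finset.sum_range] at this
    convert this using 1
    · refine Finset.sum_congr rfl fun k _ => ?_
      simp only [Fin.lt_def]
      congr 1
      rw [show 2 * ((k.1 + 1 : ℕ) : ℤ) - n = 2 * k - n + 1 + 1 by push_cast; ring,
        show 2 * (k : ℤ) + 1 - n = 2 * k - n + 1 by ring, mul_zpow_add_one hq]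
    · rw [show 2 * ((i.1 + 1 : ℕ) : ℤ) - n = 2 * i + 1 - n + 1 by push_cast; ring,
        zpow_add_one₀ hq, show 2 * (n : ℤ) - n = n by ring]
      ring
  sum_inv_lt i := by
    have := sum_range_ite_lt (fun k => -Complex.I * q ^ (n - 2 * (k : ℤ))) i.2.le
    rw [Finset.sum_range] at this
    convert this using 1
    · refine Finset.sum_congr rfl fun k _ => ?_
      simp only [Fin.lt_def]
      congr 1
      rw [← zpow_neg, show -(2 * (k : ℤ) + 1 - n) = n - 2 * ((k.1 + 1 : ℕ) : ℤ) + 1 by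
          push_cast; ring,
        show n - 2 * (k : ℤ) = n - 2 * ((k.1 + 1 : ℕ) : ℤ) + 1 + 1 by push_cast; ring,
        mul_zpow_add_one hq]
      ring
    · rw [← zpow_neg, show (n : ℤ) - 2 * i = -(2 * (i : ℤ) + 1 - n) + 1 by ring, zpow_add_one₀ hq]
      simp
      ring
  sum_inv_gt i := by
    have := sum_range_ite_gt (fun k => -Complex.I * q ^ (n - 2 * (k : ℤ))) i.2
    rw [Finset.sum_range] at this
    convert this using 1
    · refine Finset.sum_congr rfl fun k _ => ?_
      simp only [Fin.lt_def]
      congr 1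
      rw [← zpow_neg, show -(2 * (k : ℤ) + 1 - n) = n - 2 * ((k.1 + 1 : ℕ) : ℤ) + 1 by
          push_cast; ring,
        show n - 2 * (k : ℤ) = n - 2 * ((k.1 + 1 : ℕ) : ℤ) + 1 + 1 by push_cast; ring,
        mul_zpow_add_one hq]
      ring
    · rw [← zpow_neg, show -(2 * (i : ℤ) + 1 - n) = n - 2 * ((i.1 + 1 : ℕ) : ℤ) + 1 by
          push_cast; ring, zpow_add_one₀ hq, mul_inv, mul_inv, Complex.inv_I, ← zpow_neg,
        show (n : ℤ) - 2 * (n : ℕ) = -n by ring]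
      field_simp

/-- For positive real `q` the value of the trivial knot is a sum of positive powers, so it may be
cancelled. -/
theorem linkSum_quantumModel_ne_zero (n : ℕ) {q : ℝ} (hq : 0 < q) :
    (quantumModel (n + 1) (q : ℂ) (by exact_mod_cast hq.ne')).linkSum trivialKnot ≠ 0 := by
  rw [StateModel.linkSum_trivialKnot]
  have : ∑ i : Fin (n + 1), (q : ℂ) ^ (2 * (i : ℤ) + 1 - ((n + 1 : ℕ) : ℤ)) =
      ((∑ i : Fin (n + 1), q ^ (2 * (i : ℤ) + 1 - ((n + 1 : ℕ) : ℤ)) : ℝ) : ℂ) := by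
    push_cast
    rfl
  change ∑ i : Fin (n + 1), (q : ℂ) ^ (2 * (i : ℤ) + 1 - ((n + 1 : ℕ) : ℤ)) ≠ 0
  rw [this]
  exact_mod_cast (Finset.sum_pos (fun i _ => zpow_pos hq _) Finset.univ_nonempty).ne'

/-! ### Existence and uniqueness of the Jones–Conway polynomial -/

/-- The variable `a`, as a unit. -/
noncomputable def varA : LaurentAZˣ where
  val := T 1
  inv := T (-1)
  val_inv := by rw [← T_add]; simp
  inv_val := by rw [← T_add]; simp

/-- The variable `z`, as a unit. -/
noncomputable def varZ : LaurentAZˣ where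
  val := C (T 1)
  inv := C (T (-1))
  val_inv := by rw [← map_mul, ← T_add]; simp
  inv_val := by rw [← map_mul, ← T_add]; simp

/-- The evaluation at given values of `a` and `z`. -/
noncomputable def evalAZ (a z : ℂˣ) : LaurentAZ →+* ℂ :=
  eval₂ (eval₂ (Int.castRingHom ℂ) z) a

theorem evalAZ_varA (a z : ℂˣ) : evalAZ a z (T 1) = a := by simp [evalAZ]

theorem evalAZ_varA_inv (a z : ℂˣ) : evalAZ a z (T (-1)) = (a : ℂ)⁻¹ := by simp [evalAZ]

theorem evalAZ_varZ (a z : ℂˣ) : evalAZ a z (C (T 1)) = z := by simp [evalAZ]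

theorem map_eq_zero_of_eval₂_eq_zero {R : Type*} [CommRing R] (g : R →+* ℂ) {x : ℕ → ℂˣ}
    (hx : Function.Injective x) (f : Polynomial R) (n : ℕ)
    (h : ∀ k, eval₂ g (x k) (Polynomial.toLaurent f * T (-n)) = 0) : f.map g = 0 := by
  refine Polynomial.eq_zero_of_infinite_isRoot _ (Set.infinite_of_injective_forall_mem
    (f := fun k => (x k : ℂ)) (fun i j e => hx (Units.ext e)) fun k => ?_)
  have := h k
  rw [map_mul, eval₂_toLaurent, eval₂_T] at this
  simpa [Polynomial.IsRoot, Polynomial.eval_map] using this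

/-- For each fixed value of `z` there are infinitely many values of `a`, so every coefficient
vanishes at that `z`; infinitely many such `z` then force every coefficient to be zero. -/
theorem eq_zero_of_evalAZ_eq_zero {x : ℕ → ℕ → ℂˣ} {y : ℕ → ℂˣ} (hy : Function.Injective y)
    (hx : ∀ m, Function.Injective (x m)) (p : LaurentAZ)
    (h : ∀ m k, evalAZ (x m k) (y m) p = 0) : p = 0 := by
  induction p using LaurentPolynomial.induction_on_mul_T with
  | _ f n =>
    have h1 : ∀ m, f.map (eval₂ (Int.castRingHom ℂ) (y m)) = 0 := fun m =>
      map_eq_zero_of_eval₂_eq_zero _ (hx m) f n (h m)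
    have : f = 0 := by
      ext1 j
      have h2 : ∀ m, eval₂ (Int.castRingHom ℂ) (y m) (f.coeff j) = 0 := fun m => by
        rw [← Polynomial.coeff_map, h1, Polynomial.coeff_zero]
      rw [Polynomial.coeff_zero]
      generalize f.coeff j = p at h2
      induction p using LaurentPolynomial.induction_on_mul_T with
      | _ f n =>
        have h3 := map_eq_zero_of_eval₂_eq_zero _ hy f n h2
        rw [(Polynomial.map_eq_zero_iff (RingHom.injective_int _)).1 h3]
        simp
    simp [this]

theorem natCast_add_two_ne_zero (m : ℕ) : ((m + 2 : ℕ) : ℂ) ≠ 0 :=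
  Nat.cast_ne_zero.2 (by omega)

/-- Taking `q = m + 2` avoids `q = 1`, where `z` would not be invertible, and makes the powers of
`q` distinct. -/
theorem natCast_sub_inv_ne_zero (m : ℕ) : ((m + 2 : ℕ) : ℂ) - ((m + 2 : ℕ) : ℂ)⁻¹ ≠ 0 := by
  intro h
  have hm := natCast_add_two_ne_zero m
  have h : ((m + 2 : ℕ) : ℂ) * ((m + 2 : ℕ) : ℂ) = ((1 : ℕ) : ℂ) := by
    have e := mul_inv_cancel₀ hm
    rw [← sub_eq_zero.1 h] at e
    rw [e, Nat.cast_one]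
  have h : (m + 2) * (m + 2) = 1 := by exact_mod_cast h
  nlinarith

theorem natCast_sub_inv_injective {m m' : ℕ}
    (h : ((m + 2 : ℕ) : ℂ) - ((m + 2 : ℕ) : ℂ)⁻¹ = ((m' + 2 : ℕ) : ℂ) - ((m' + 2 : ℕ) : ℂ)⁻¹) :
    m = m' := by
  have hm := natCast_add_two_ne_zero m
  have hm' := natCast_add_two_ne_zero m'
  have h : (((m + 2 : ℕ) : ℂ) - ((m' + 2 : ℕ) : ℂ)) * (((m + 2) * (m' + 2) + 1 : ℕ) : ℂ) = 0 := by
    rw [Nat.cast_add ((m + 2) * (m' + 2)), Nat.cast_mul]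
    field_simp at h
    linear_combination h
  rcases mul_eq_zero.1 h with h | h
  · have : m + 2 = m' + 2 := by exact_mod_cast sub_eq_zero.1 h
    omega
  · exact absurd h (Nat.cast_ne_zero.2 (by omega))

/-- The values of `a`. -/
noncomputable def aValue (m n : ℕ) : ℂˣ :=
  Units.mk0 (quantumModel (n + 1) ((m + 2 : ℕ) : ℂ) (natCast_add_two_ne_zero m)).a
    (StateModel.a_ne _)

/-- The values of `z`. -/
noncomputable def zValue (m : ℕ) : ℂˣ :=
  Units.mk0 (Complex.I * (((m + 2 : ℕ) : ℂ) - ((m + 2 : ℕ) : ℂ)⁻¹))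
    (mul_ne_zero Complex.I_ne_zero (natCast_sub_inv_ne_zero m))

theorem aValue_injective (m : ℕ) : Function.Injective (aValue m) := by
  intro n n' h
  have h := congrArg Units.val h
  simp only [aValue, Units.val_mk0, quantumModel, mul_eq_mul_left_iff, Complex.I_ne_zero, or_false,
    zpow_natCast] at h
  have h : (m + 2) ^ (n + 1) = (m + 2) ^ (n' + 1) := by exact_mod_cast h
  have := Nat.pow_right_injective (by omega : 2 ≤ m + 2) h
  omega

theorem zValue_injective : Function.Injective zValue := by
  intro m m' h
  have h := congrArg Units.val h
  simp only [zValue, Units.val_mk0, mul_eq_mul_left_iff, Complex.I_ne_zero, or_false] at h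
  exact natCast_sub_inv_injective h

/-- All state sums together form one invariant with values in a `LaurentAZ`-module, a polynomial
acting on each coordinate by its value at the corresponding point. The spanning theorem supplies a
single coefficient `P L` valid at all points; the axioms for `P` hold at each point and hence as
identities. -/
theorem exists_isJonesConway : ∃ P : Link → LaurentAZ, IsJonesConway P := by
  let S : ∀ x : ℕ × ℕ, StateModel (x.2 + 1) := fun x =>
    quantumModel (x.2 + 1) ((x.1 + 2 : ℕ) : ℂ) (natCast_add_two_ne_zero x.1)
  let ev : ℕ × ℕ → LaurentAZ →+* ℂ := fun x => evalAZ (aValue x.1 x.2) (zValue x.1)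
  let : Module LaurentAZ (ℕ × ℕ → ℂ) := Module.compHom _ (RingHom.pi ev)
  have smul_apply : ∀ (c : LaurentAZ) (v : ℕ × ℕ → ℂ) (x : ℕ × ℕ), (c • v) x = ev x c * v x :=
    fun _ _ _ => rfl
  have ev_skein : ∀ x {Lp Lm L0 : Link}, SkeinTriple Lp Lm L0 →
      ev x (T 1) * (S x).linkSum Lp + ev x (T (-1)) * (S x).linkSum Lm =
        ev x (C (T 1)) * (S x).linkSum L0 := by
    intro x Lp Lm L0 h
    have := (S x).linkSum_skein h
    simp only [ev, evalAZ_varA, evalAZ_varA_inv, evalAZ_varZ]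
    have hz : (zValue x.1 : ℂ) = (S x).s + (S x).s⁻¹ := by
      simp only [zValue, Units.val_mk0, S, quantumModel, mul_inv, Complex.inv_I]
      ring
    rw [hz]
    exact this
  have ne : ∀ x, (S x).linkSum trivialKnot ≠ 0 := fun x => by
    have := linkSum_quantumModel_ne_zero x.2 (q := ((x.1 + 2 : ℕ) : ℝ)) (by positivity)
    exact this
  have inj : ∀ p : LaurentAZ, (∀ x, ev x p = 0) → p = 0 := fun p h =>
    eq_zero_of_evalAZ_eq_zero zValue_injective aValue_injective p fun m k => h (m, k)
  have span := exists_smul_trivialKnot (R := LaurentAZ) (a := varA) (z := varZ)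
    (f := fun L x => (S x).linkSum L) (fun Lp Lm L0 h => funext fun x => ev_skein x h)
  choose P hP using span
  have hP : ∀ L x, (S x).linkSum L = ev x (P L) * (S x).linkSum trivialKnot :=
    fun L x => congrFun (hP L) x
  refine ⟨P, ?_, ?_⟩
  · refine sub_eq_zero.1 (inj _ fun x => ?_)
    have := hP trivialKnot x
    rw [map_sub, map_one, sub_eq_zero]
    exact mul_right_cancel₀ (ne x) (by rw [← this, one_mul])
  · intro Lp Lm L0 h
    refine sub_eq_zero.1 (inj _ fun x => ?_)
    have := ev_skein x h
    rw [hP Lp, hP Lm, hP L0] at this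
    rw [map_sub, sub_eq_zero]
    simp only [map_add, map_mul]
    refine mul_right_cancel₀ (ne x) ?_
    linear_combination this

/-- The spanning theorem is applied to the pair of `P` and `f`. The first component identifies the
unknown scalar as `P L`. -/
theorem IsJonesConway.exists_smul {P : Link → LaurentAZ} (hP : IsJonesConway P) {M : Type*}
    [AddCommGroup M] [Module LaurentAZ M] {f : Link → M}
    (hf : ∀ Lp Lm L0 : Link, SkeinTriple Lp Lm L0 →
      (T 1 : LaurentAZ) • f Lp + (T (-1) : LaurentAZ) • f Lm = (C (T 1) : LaurentAZ) • f L0)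
    (L : Link) : f L = P L • f TkMoves.trivialKnot := by
  obtain ⟨c, hc⟩ := exists_smul_trivialKnot (R := LaurentAZ) (a := varA) (z := varZ)
    (f := fun L => (P L, f L)) (fun Lp Lm L0 h => Prod.ext (hP.skein _ _ _ h) (hf _ _ _ h)) L
  have h1 : P L = c := by simpa [hP.trivialKnot] using congrArg Prod.fst hc
  rw [h1]
  exact congrArg Prod.snd hc

theorem IsJonesConway.unique {P P' : Link → LaurentAZ} (hP : IsJonesConway P)
    (hP' : IsJonesConway P') : P = P' := by
  funext L
  have := hP'.exists_smul (f := P) (fun _ _ _ h => hP.skein _ _ _ h) L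
  rwa [hP.trivialKnot, smul_eq_mul, mul_one] at this

/-- Evaluations at `z = a + a⁻¹` are trivial. -/
theorem IsJonesConway.map_eq_one {P : Link → LaurentAZ} (hP : IsJonesConway P) {K : Type*}
    [CommRing K] (φ : LaurentAZ →+* K) (h : φ (T 1) + φ (T (-1)) = φ (C (T 1))) (L : Link) :
    φ (P L) = 1 := by
  let : Module LaurentAZ K := Module.compHom K φ
  have smul_def : ∀ (c : LaurentAZ) (x : K), c • x = φ c * x := fun _ _ => rfl
  have := hP.exists_smul (f := fun _ => (1 : K)) (fun Lp Lm L0 _ => by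
    simpa only [smul_def, mul_one] using h) L
  rw [smul_def, mul_one] at this
  exact this.symm

/-! ### The effect of twists -/

theorem joins_replicate {x : Slice} (hx : x.cod = x.dom) (n : ℕ) :
    Joins (List.replicate n x) x.dom x.dom := by
  induction n with
  | zero => rfl
  | succ n ih => exact ⟨rfl, by rwa [hx]⟩

/-- The diagrams with `n` half twists in one place. -/
theorem exists_twists {k : ℕ} (hk : 0 < k) {L L' : Link} (h : TkMove k L L') :
    ∃ E : ℕ → Link, E 0 = L ∧ E k = L' ∧ ∀ n, SkeinTriple (E (n + 2)) (E n) (E (n + 1)) := by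
  obtain ⟨D, D', u, v, l, r, rfl, rfl, hD, hD'⟩ := h
  have hu := D'.closed
  rw [hD', joins_append] at hu
  obtain ⟨t, hu, hv⟩ := hu
  rw [joins_append] at hu
  obtain ⟨s, hu, hs⟩ := hu
  -- At least one twist is present, and it shows that the strands at this place are parallel and
  -- upward.
  obtain ⟨j, rfl⟩ : ∃ j, k = j + 1 := ⟨k - 1, by omega⟩
  obtain ⟨rfl, hs⟩ := hs
  set x : Slice := ⟨l, .cross true true true, r⟩ with hx
  have hxc : x.cod = x.dom := rfl
  obtain rfl : x.dom = t := (joins_replicate hxc j).runs.unique hs.runs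
  have closed : ∀ n, Joins (u ++ List.replicate n x ++ v) [] [] := fun n =>
    (joins_append _ _ _ _).2 ⟨_, (joins_append _ _ _ _).2 ⟨_, hu, joins_replicate hxc n⟩, hv⟩
  have nonempty : ∀ w, u ++ w ++ v ≠ [] := fun w e => D.nonempty (by simp_all)
  let E : ℕ → Diagram := fun n => ⟨u ++ List.replicate n x ++ v, closed n, nonempty _⟩
  refine ⟨fun n => (E n).link, ?_, ?_, fun n => ?_⟩
  · exact congrArg Diagram.link (Diagram.ext_pos (by simp [E, hD]))
  · exact congrArg Diagram.link (Diagram.ext_pos (by simp [E, hD']))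
  -- A negative crossing below `n + 1` positive ones cancels the lowest of them, so this diagram
  -- represents `E n`.
  · let Dm : Diagram := ⟨u ++ ⟨l, .cross false true true, r⟩ :: List.replicate (n + 1) x ++ v,
      (joins_append _ _ _ _).2 ⟨_, (joins_append _ _ _ _).2
        ⟨_, hu, rfl, joins_replicate hxc (n + 1)⟩, hv⟩, nonempty _⟩
    have hm : Step Dm (E n) := ⟨u, List.replicate n x ++ v, _, _, l, r,
      .reidemeister2 false true true, by simp [Dm, Slice.pad, List.replicate_succ, hx],
      by simp [E]⟩
    refine ⟨E (n + 2), Dm, E (n + 1), u, List.replicate (n + 1) x ++ v, l, r, rfl,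
      Quotient.sound (.rel _ _ hm), rfl, ?_, by simp [Dm], by simp [E]⟩
    simp [E, List.replicate_succ, hx]

/-- Both sides solve the recursion of the Chebyshev polynomials and agree for `n = 0, 1`. The factor
`sin θ` avoids a division. -/
theorem sin_recursion {M : Type*} [AddCommGroup M] [Module ℝ M] (θ : ℝ) (q : ℕ → M)
    (hq : ∀ n, q (n + 2) = (2 * Real.cos θ) • q (n + 1) - q n) (n : ℕ) :
    Real.sin θ • q n = Real.sin (n * θ) • q 1 - Real.sin (n * θ - θ) • q 0 := by
  induction n using Nat.twoStepInduction with
  | zero => simp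
  | one => simp
  | more n h1 h2 =>
    rw [hq, smul_sub, smul_comm, h1, h2]
    have e1 : Real.sin ((n + 2 : ℕ) * θ) =
        2 * Real.cos θ * Real.sin ((n + 1 : ℕ) * θ) - Real.sin (n * θ) := by
      push_cast
      rw [show ((n : ℝ) + 2) * θ = (n + 1) * θ + θ by ring,
        show (n : ℝ) * θ = (n + 1) * θ - θ by ring, Real.sin_add, Real.sin_sub]
      ring
    have e2 : Real.sin ((n + 2 : ℕ) * θ - θ) =
        2 * Real.cos θ * Real.sin ((n + 1 : ℕ) * θ - θ) - Real.sin (n * θ - θ) := by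
      push_cast
      rw [show ((n : ℝ) + 2) * θ - θ = n * θ + θ by ring,
        show ((n : ℝ) + 1) * θ - θ = n * θ by ring, Real.sin_add, Real.sin_sub]
      ring
    rw [e1, e2]
    module

theorem sin_ne_zero_of_two_mul_cos_ne {θ : ℝ} (h : 2 * Real.cos θ ≠ 2)
    (h' : 2 * Real.cos θ ≠ -2) : Real.sin θ ≠ 0 := by
  intro hs
  rcases Real.sin_eq_zero_iff_cos_eq.1 hs with hc | hc
  · exact h (by rw [hc]; norm_num)
  · exact h' (by rw [hc]; norm_num)

/-! ### The effect of twists on the polynomial, non-vanishing, and levels -/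

section Main

variable {P : Link → LaurentAZ} {k : ℕ} {m : ℤ} {z₀ : ℝ} {h₀ : z₀ ≠ 0}

theorem substZ_T (n : ℤ) : substZ z₀ h₀ (T n) = ((aUnit ^ n : (LaurentPolynomial ℝ)ˣ) :
    LaurentPolynomial ℝ) := by
  simp [substZ]

theorem substZ_varZ : substZ z₀ h₀ (C (T 1)) = C z₀ := by
  simp [substZ]

theorem coe_neg_one_zpow (m : ℤ) :
    (((-1) ^ m : (LaurentPolynomial ℝ)ˣ) : LaurentPolynomial ℝ) = C ((-1 : ℝ) ^ m) := by
  rcases Int.even_or_odd m with h | h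
  · simp [h.neg_one_zpow]
  · simp [h.neg_one_zpow]

theorem IsJonesConway.tkMove (hP : IsJonesConway P) (hk : 0 < k)
    (hz : z₀ = 2 * Real.cos (Real.pi * m / k)) (h2 : z₀ ≠ 2) (h2' : z₀ ≠ -2) {L L' : Link}
    (h : TkMove k L L') :
    substZ z₀ h₀ (P L') = (tkFactor k m : LaurentPolynomial ℝ) * substZ z₀ h₀ (P L) := by
  obtain ⟨E, rfl, rfl, hE⟩ := exists_twists hk h
  set θ := Real.pi * m / k with hθ
  have hkθ : (k : ℝ) * θ = m * Real.pi := by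
    rw [hθ]
    field_simp
  have hs : Real.sin θ ≠ 0 := sin_ne_zero_of_two_mul_cos_ne (hz ▸ h2) (hz ▸ h2')
  -- The powers of `a` absorb the coefficients `a` and `a⁻¹` of the skein relation, leaving a
  -- recursion with real coefficients.
  let q : ℕ → LaurentPolynomial ℝ := fun n =>
    ((aUnit ^ (n : ℤ) : (LaurentPolynomial ℝ)ˣ) : LaurentPolynomial ℝ) * substZ z₀ h₀ (P (E n))
  have hq : ∀ n, q (n + 2) = (2 * Real.cos θ) • q (n + 1) - q n := by
    intro n
    have := congrArg (substZ z₀ h₀) (hP.skein _ _ _ (hE n))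
    simp only [map_add, map_mul, substZ_T, substZ_varZ] at this
    have := congrArg (fun x => ((aUnit ^ ((n : ℤ) + 1) : (LaurentPolynomial ℝ)ˣ) :
      LaurentPolynomial ℝ) * x) this
    simp only [mul_add, ← mul_assoc, ← Units.val_mul, ← zpow_add] at this
    rw [← hz, LaurentPolynomial.smul_eq_C_mul]
    simp only [q]
    rw [eq_sub_iff_add_eq]
    push_cast
    rw [show (n : ℤ) + 1 + 1 = n + 2 by ring, show (n : ℤ) + 1 + -1 = n by ring] at this
    rw [this]
    ring
  have key := sin_recursion θ q hq k
  -- At `n = k` the coefficient of `q 1` is `sin (m π) = 0`, and that of `q 0` is `cos (m π) * sin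
  -- θ`.
  rw [hkθ, Real.sin_sub, Real.sin_int_mul_pi, Real.cos_int_mul_pi, zero_smul, zero_mul, zero_sub,
    zero_sub, neg_smul, neg_neg, mul_comm, mul_smul] at key
  have key := smul_right_injective (LaurentPolynomial ℝ) hs key
  simp only [q, LaurentPolynomial.smul_eq_C_mul, ← coe_neg_one_zpow] at key
  simp only [Nat.cast_zero, zpow_zero, Units.val_one, one_mul] at key
  rw [tkFactor, Units.val_mul, mul_right_comm, ← key, mul_right_comm, ← Units.val_mul, ← zpow_add]
  simp

theorem IsJonesConway.tkPath (hP : IsJonesConway P) (hk : 0 < k)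
    (hz : z₀ = 2 * Real.cos (Real.pi * m / k)) (h2 : z₀ ≠ 2) (h2' : z₀ ≠ -2) {L L' : Link} {n : ℤ}
    (h : TkPath k L L' n) :
    substZ z₀ h₀ (P L') =
      ((tkFactor k m ^ n : (LaurentPolynomial ℝ)ˣ) : LaurentPolynomial ℝ) *
        substZ z₀ h₀ (P L) := by
  induction h with
  | refl => simp
  | move _ h ih => rw [hP.tkMove hk hz h2 h2' h, ih, ← mul_assoc, ← Units.val_mul, ← zpow_one_add,
      add_comm]
  | inverse _ h ih =>
    rw [hP.tkMove hk hz h2 h2' h] at ih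
    rw [← (tkFactor k m).mul_right_inj, ih, ← mul_assoc, ← Units.val_mul, ← zpow_one_add]
    simp

/-- At the complex point `a = exp (i θ)` the value is `1`, because there `z₀ = a + a⁻¹`. -/
theorem IsJonesConway.substZ_ne_zero (hP : IsJonesConway P) {θ : ℝ} (hz : z₀ = 2 * Real.cos θ)
    (L : Link) : substZ z₀ h₀ (P L) ≠ 0 := by
  intro h
  let a : ℂˣ := Units.mk0 (Complex.exp (θ * Complex.I)) (Complex.exp_ne_zero _)
  let φ : LaurentAZ →+* ℂ := (eval₂ (algebraMap ℝ ℂ) a).comp (substZ z₀ h₀)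
  have e : φ (P L) = 1 := hP.map_eq_one φ (by
    simp only [φ, RingHom.comp_apply, substZ_T, substZ_varZ]
    simp only [zpow_one, zpow_neg, aUnit, Units.inv_mk, eval₂_T, eval₂_C]
    simp [a, hz, Complex.cos, ← Complex.exp_neg]
    ring) L
  rw [RingHom.comp_apply, h, map_zero] at e
  exact zero_ne_one e

/-- At `a = 2` the factor has absolute value `2 ^ (-k)`, which is positive and different from `1`.
-/
theorem tkFactor_zpow_injective (hk : 0 < k) (m : ℤ) :
    Function.Injective fun n : ℤ => tkFactor k m ^ n := by
  intro n n' h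
  let ψ : LaurentPolynomial ℝ →+* ℝ := eval₂ (RingHom.id ℝ) (Units.mk0 2 two_ne_zero)
  have e : |(Units.map (ψ : LaurentPolynomial ℝ →* ℝ) (tkFactor k m) : ℝ)| = ((2 : ℝ) ^ k)⁻¹ := by
    rw [tkFactor, map_mul, map_zpow, map_zpow, Units.val_mul, abs_mul]
    simp [aUnit, ψ, abs_zpow]
  have h := congrArg (fun u => |(Units.map (ψ : LaurentPolynomial ℝ →* ℝ) u : ℝ)|) h
  simp only [map_zpow, Units.val_zpow_eq_zpow_val, abs_zpow, e] at h
  refine zpow_right_injective₀ (by positivity) ?_ h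
  exact inv_ne_one.2 (one_lt_pow₀ one_lt_two hk.ne').ne'

/-- For `m = 1` the angle `π / k` lies strictly between `0` and `π / 2`, so `z₀` lies strictly
between `0` and `2`. Two paths give two powers of the factor with the same product with a non-zero
polynomial, hence equal exponents. -/
theorem TkPath.unique (hP : IsJonesConway P) (hk : 2 < k) {L L' : Link} {n n' : ℤ}
    (h : TkPath k L L' n) (h' : TkPath k L L' n') : n = n' := by
  have hk0 : (2 : ℝ) < k := by exact_mod_cast hk
  have pos : 0 < Real.pi * (1 : ℤ) / k := by
    have := Real.pi_pos
    positivity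
  have lt : Real.pi * (1 : ℤ) / k < Real.pi / 2 := by
    rw [Int.cast_one, mul_one]
    exact div_lt_div_of_pos_left Real.pi_pos two_pos hk0
  set θ := Real.pi * (1 : ℤ) / k
  have c0 : 0 < Real.cos θ := Real.cos_pos_of_mem_Ioo ⟨by linarith, lt⟩
  have c1 : Real.cos θ < 1 := by
    rw [← Real.cos_zero]
    exact Real.cos_lt_cos_of_nonneg_of_le_pi_div_two le_rfl lt.le pos
  have hz : 2 * Real.cos θ ≠ 0 := by positivity
  have e : ∀ {j}, TkPath k L L' j → _ := fun {j} h =>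
    hP.tkPath (h₀ := hz) (by omega) rfl (by linarith) (by linarith) h
  have := (e h).symm.trans (e h')
  exact tkFactor_zpow_injective (by omega) 1
    (Units.ext (mul_right_cancel₀ (hP.substZ_ne_zero rfl L) this))

theorem tkPath_levelDistance {L L' : Link} (h : TkEquivalent k L L') :
    TkPath k L L' (levelDistance k L L') := by
  rw [levelDistance, dif_pos h]
  exact h.choose_spec

end Main

end TkMoves

theorem corollary1p2 :
    -- the Jones–Conway polynomial is well defined by its two properties
    (∃! P : Link → LaurentAZ, IsJonesConway P) ∧
    -- the effect of `t_k` moves on `P_L(a, z₀)`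
    (∀ P : Link → LaurentAZ, IsJonesConway P →
      ∀ (k : ℕ) (m : ℤ) (z₀ : ℝ), 0 < k → z₀ = 2 * Real.cos (Real.pi * m / k) →
      ∀ (h₀ : z₀ ≠ 0), z₀ ≠ 2 → z₀ ≠ -2 →
        (∀ L L' : Link, TkMove k L L' →
          substZ z₀ h₀ (P L') = (tkFactor k m : LaurentPolynomial ℝ) * substZ z₀ h₀ (P L)) ∧
        (∀ L L' : Link, TkEquivalent k L L' →
          substZ z₀ h₀ (P L') =
            ((tkFactor k m ^ levelDistance k L L' : (LaurentPolynomial ℝ)ˣ) :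
              LaurentPolynomial ℝ) * substZ z₀ h₀ (P L) ∧
          substZ z₀ h₀ (P L') ≠ 0 ∧
          ((tkFactor k m ^ levelDistance k L L' : (LaurentPolynomial ℝ)ˣ) :
              LaurentPolynomial ℝ) * substZ z₀ h₀ (P L) ≠ 0)) ∧
    -- the level distance does not depend on the path
    (∀ k : ℕ, 2 < k → ∀ (L L' : Link) (n : ℤ),
      TkPath k L L' n → n = levelDistance k L L') := by
  -- The last assertion mentions no polynomial, so its proof also needs the existence of one.
  obtain ⟨P₀, hP₀⟩ := exists_isJonesConway
  refine ⟨⟨P₀, hP₀, fun P hP => hP.unique hP₀⟩, fun P hP k m z₀ hk hz h₀ h2 h2' =>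
    ⟨fun L L' h => hP.tkMove hk hz h2 h2' h, fun L L' h => ?_⟩,
    fun k hk L L' n h => h.unique hP₀ hk (tkPath_levelDistance ⟨n, h⟩)⟩
  have e := hP.tkPath (h₀ := h₀) hk hz h2 h2' (tkPath_levelDistance h)
  exact ⟨e, hP.substZ_ne_zero hz L', e ▸ hP.substZ_ne_zero hz L'⟩
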